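/- Let $d\ge 1$ be an integer, let $R,B>0$ be constants, and let $q\in\mathbb N$. There are a randomized one-pass streaming algorithm and constants $K,A,C,k$, all depending only on $d,R,B,q$, such that the following holds for every $0<\varepsilon\le 1/2$, all integers $n\ge 1$ and $w$ with $n\le 2^w$ and $1/\varepsilon\le 2^w$, and every stream $x_1,\dots,x_n\in\mathbb R^d$ of points with $\|x_i\|_2\le R$ whose coordinates are integer multiples of $2^{-w}$. Put $$ s(\varepsilon)=C\,\varepsilon^{-\frac{2d}{d+3}}\log^k(1/\varepsilon)=\tilde O\big(\varepsilon^{-\frac{2d}{d+3}}\big). $$ The algorithm is given $n$, $\lceil 1/\varepsilon\rceil$ and $w$, and then the stream, one coordinate at a time. It always halts, and its whole memory, including the working memory, consists of at most $s(\varepsilon)$ words of $Kw$ bits each. At the end the memory holds a number $m\le s(\varepsilon)$, points $y_1,\dots,y_m$ that are terms of the stream with pairwise distinct indices, and weights $w_1,\dots,w_m\in\mathbb R$ (in fixed-point representation, with $w$ binary digits after the point). With high probability, namely with probability at least $1-\varepsilon^q$ over the random words that the algorithm draws, for every $(\theta,b)\in\mathbb R^d\times\mathbb R$ with $\|(\theta,b)\|_2\le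 B$, $$ \left|\frac1n\sum_{j=1}^m w_j\max\{0,\,b-\theta^\top y_j\}-\frac1n\sum_{i=1}^n\max\{0,\,b-\theta^\top x_i\}\right|\le A\,\varepsilon . $$ The machine model is a word RAM: a fixed program, independent of $n,\varepsilon,w$ and the stream, with assignments, conditionals and while loops over word arithmetic and indirectly addressed memory, with a one-way input tape, and with a supply of independent uniformly random words each of which can be drawn only once. Running time is not restricted. -/

import Mathlib

/-!
A one-pass randomized streaming word RAM.  The machine has `S` cells, each of which holds one
signed word of `L` bits.  It has a one-way input tape, on which the numbers of the stream arrive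
one after the other, and a source of independent uniformly random words, each of which can be
drawn once.  Whatever the machine wants to remember has to be kept in its `S` cells; the program
itself is a fixed finite object.
-/

namespace StreamRAM

/-- Arithmetic expressions over the memory. -/
inductive Expr : Type where
  | const : ℤ → Expr
  | load : Expr → Expr
  | add : Expr → Expr → Expr
  | sub : Expr → Expr → Expr
  | mul : Expr → Expr → Expr
  | div : Expr → Expr → Expr
  | lt : Expr → Expr → Expr

/-- The signed `L`-bit word (two's complement) that is congruent to `z` modulo `2 ^ L`. -/
def word (L : ℕ) (z : ℤ) : ℤ := Int.bmod z (2 ^ L)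

/-- Value of an expression: every intermediate result is truncated to a word. -/
def Expr.eval (L : ℕ) (M : ℤ → ℤ) : Expr → ℤ
  | .const z => word L z
  | .load a => M (a.eval L M)
  | .add a b => word L (a.eval L M + b.eval L M)
  | .sub a b => word L (a.eval L M - b.eval L M)
  | .mul a b => word L (a.eval L M * b.eval L M)
  | .div a b => word L (a.eval L M / b.eval L M)
  | .lt a b => if a.eval L M < b.eval L M then word L 1 else 0

/-- Programs.  `store a e` writes the value of `e` to the cell with address `a`; `read a` moves
the next number of the stream to that cell; `draw a` puts a fresh random word there. -/
inductive Program : Type where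
  | skip : Program
  | store : Expr → Expr → Program
  | read : Expr → Program
  | draw : Expr → Program
  | seq : Program → Program → Program
  | cond : Expr → Program → Program → Program
  | loop : Expr → Program → Program

/-- A configuration: contents of the memory, the part of the stream that is yet to come, and the
number of random words drawn so far (the machine cannot access this number). -/
structure Config : Type where
  mem : ℤ → ℤ
  input : List ℤ
  drawn : ℕ

/-- Write to a cell.  Only the cells `0, …, S - 1` exist: a write to any other address is lost. -/
def write (S : ℕ) (M : ℤ → ℤ) (a v : ℤ) : ℤ → ℤ :=
  if 0 ≤ a ∧ a < (S : ℤ) then Function.update M a v else M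

/-- Random tapes: the `i`-th random word is determined by `ω i`. -/
abbrev Tape (L : ℕ) : Type := ℕ → Fin (2 ^ L)

/-- `Exec L S ω P c c'`: on the machine with `S` cells of `L` bits and with random tape `ω`, the
program `P`, started in the configuration `c`, halts in the configuration `c'`. -/
inductive Exec (L S : ℕ) (ω : Tape L) : Program → Config → Config → Prop where
  | skip (c : Config) : Exec L S ω .skip c c
  | store (a e : Expr) (c : Config) :
      Exec L S ω (.store a e) c
        { c with mem := write S c.mem (a.eval L c.mem) (e.eval L c.mem) }
  | read (a : Expr) (c : Config) :
      Exec L S ω (.read a) c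
        { c with
          mem := write S c.mem (a.eval L c.mem) (word L (c.input.headD 0))
          input := c.input.tail }
  | draw (a : Expr) (c : Config) :
      Exec L S ω (.draw a) c
        { c with
          mem := write S c.mem (a.eval L c.mem) (word L ((ω c.drawn : ℕ) : ℤ))
          drawn := c.drawn + 1 }
  | seq {P Q : Program} {c c' c'' : Config} :
      Exec L S ω P c c' → Exec L S ω Q c' c'' → Exec L S ω (.seq P Q) c c''
  | cond_true {e : Expr} {P Q : Program} {c c' : Config} :
      e.eval L c.mem ≠ 0 → Exec L S ω P c c' → Exec L S ω (.cond e P Q) c c'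
  | cond_false {e : Expr} {P Q : Program} {c c' : Config} :
      e.eval L c.mem = 0 → Exec L S ω Q c c' → Exec L S ω (.cond e P Q) c c'
  | loop_true {e : Expr} {P : Program} {c c' c'' : Config} :
      e.eval L c.mem ≠ 0 → Exec L S ω P c c' → Exec L S ω (.loop e P) c' c'' →
        Exec L S ω (.loop e P) c c''
  | loop_false {e : Expr} {P : Program} {c : Config} :
      e.eval L c.mem = 0 → Exec L S ω (.loop e P) c c

/-- The law of the random tape: independent uniformly distributed words. -/
noncomputable def tapeLaw (L : ℕ) : MeasureTheory.Measure (Tape L) :=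
  MeasureTheory.Measure.infinitePi
    (fun _ : ℕ => (PMF.uniformOfFintype (Fin (2 ^ L))).toMeasure)

end StreamRAM

namespace StreamSVM

open StreamRAM

/-- The real number with `w` binary digits after the point that an integer stands for. -/
noncomputable def fixedPoint (w : ℕ) (z : ℤ) : ℝ := (z : ℝ) / 2 ^ w

/-- The point of Euclidean space whose coordinates are given in fixed-point representation. -/
noncomputable def point {d : ℕ} (w : ℕ) (z : Fin d → ℤ) : EuclideanSpace ℝ (Fin d) :=
  WithLp.toLp 2 (fun i => fixedPoint w (z i))

/-- The stream: the coordinates of the first point, then those of the second point, etc. -/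
def stream {n d : ℕ} (z : Fin n → Fin d → ℤ) : List ℤ :=
  (List.ofFn (fun i => List.ofFn (z i))).flatten

/-- Start of the computation: cell `0` holds the length of the stream, cell `1` the accuracy
`⌈1 / ε⌉`, cell `2` the precision `w`, all other cells hold `0`. -/
noncomputable def start {n d : ℕ} (ε : ℝ) (w : ℕ) (z : Fin n → Fin d → ℤ) : Config where
  mem := fun a => if a = 0 then (n : ℤ) else if a = 1 then (⌈1 / ε⌉₊ : ℤ)
    else if a = 2 then (w : ℤ) else 0
  input := stream z
  drawn := 0

/-- The output is kept in the memory: cell `0` holds the number of selected points; then follow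
the records, each of which consists of the `d` coordinates of a point and of its weight. -/
def outSize (c : Config) : ℕ := (c.mem 0).toNat

/-- Coordinates (in fixed-point representation) of the `j`-th selected point. -/
def outPoint (d : ℕ) (c : Config) (j : ℕ) : Fin d → ℤ :=
  fun i => c.mem (1 + (j : ℤ) * ((d : ℤ) + 1) + (i : ℕ))

/-- Weight of the `j`-th selected point. -/
noncomputable def outWeight (d w : ℕ) (c : Config) (j : ℕ) : ℝ :=
  fixedPoint w (c.mem (1 + (j : ℤ) * ((d : ℤ) + 1) + (d : ℤ)))

/-- The summand `max {0, b - θᵀ x}` of the SVM objective. -/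
noncomputable def hinge {d : ℕ} (θ : EuclideanSpace ℝ (Fin d)) (b : ℝ)
    (x : EuclideanSpace ℝ (Fin d)) : ℝ :=
  max 0 (b - inner ℝ θ x)

/-- The objective `(1 / n) ∑ i, max {0, b - θᵀ xᵢ}`. -/
noncomputable def objective {n d : ℕ} (x : Fin n → EuclideanSpace ℝ (Fin d))
    (θ : EuclideanSpace ℝ (Fin d)) (b : ℝ) : ℝ :=
  (1 / (n : ℝ)) * ∑ i, hinge θ b (x i)

/-- The estimate `(1 / n) ∑ j, wⱼ max {0, b - θᵀ yⱼ}` from the output of the algorithm. -/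
noncomputable def estimate (n : ℕ) {d : ℕ} (w : ℕ) (c : Config)
    (θ : EuclideanSpace ℝ (Fin d)) (b : ℝ) : ℝ :=
  (1 / (n : ℝ)) * ∑ j ∈ Finset.range (outSize c),
    outWeight d w c j * hinge θ b (point w (outPoint d c j))

/-- `C ε^{-2d/(d+3)} log^k (1/ε)`, that is, `Õ(ε^{-2d/(d+3)})`. -/
noncomputable def sizeBound (d : ℕ) (C : ℝ) (k : ℕ) (ε : ℝ) : ℝ :=
  C * ε ^ (-(2 * (d : ℝ) / ((d : ℝ) + 3))) * Real.log (1 / ε) ^ k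

end StreamSVM

/-! ### Existence of coresets of half the size -/

namespace HingeCoreset

open Finset

/-! Sampling removes the dependence on `n`, merge-and-reduce makes the algorithm one-pass, and the
exponent `2d/(d+3)` comes from an existence theorem for coresets that a machine with unrestricted
time can exploit by exhaustive search. Write `E = ⌈1/ε⌉` and let `Λ` be its bit length.

Sampling. The stream is cut into blocks of equal length and one random position is kept in each, so
that only polynomially many points in `E` survive. Every `(θ, b)` is within `O(1/E)` of one of
polynomially many test functions with coefficients in `(1/E)ℤ` (`exists_testFn_close`). Chebyshev's
inequality and a union bound over this net show that the sample is good for all of them except with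
probability `ε ^ q` (`tapeLaw_deviation_le`, `Fits.tapeLaw_not_accurate_le`). After sampling nothing
is random.

Halving (`exists_half_coreset`). Let `2 * s` points have total weight `W`, with `s` about `r ^ d`.
As long as more than `s` points carry weight, many of them are light, and `d + 2` light ones lie in
a common cell of an arrangement of `(d + 1) * r` hyperplanes: a grid of mesh `2/r`, and `r`
hyperplanes chosen greedily such that points of a cell are separated by only an `O(log s / r)`
fraction of the kinks of the test functions, measured by an exponential potential. These `d + 2`
points have an affine dependence. Moving weight along it preserves the total weight and the sum of
each hinge that is affine on the group; only hinges with a kink inside the group change, by `O(W/(s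
r))`. The move can be made in two opposite directions until a weight vanishes. Choosing between them
at random with mean zero raises the expected potential only to second order, so one of the two is
good (`exists_elimination`). In at most `s` moves this gives a deviation of `W / √(s r³)` up to
logarithms, that is, `r ^ (-(d+3)/2)` relative to `W`. With `r ^ (d+3)` about `E² Λ⁴` the relative
error is `1/(E Λ)`, which can be afforded on `O(Λ)` levels, and `s` is about `E ^ (2d/(d+3))` up to
logarithms.

Merge-and-reduce. Blocks of `s` records are combined like the digits of a binary counter
(`Env.Stack`, `Env.mp_cascade`). Two blocks of equal rank are replaced by one, found by enumerating
all vectors of integer weights; `Env.hasReductions` shows that the enumeration succeeds.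

The machine. Total correctness is proved for an exact integer semantics `IExec` by the rules for
`WP` and `MP`. `IExec.exec` transfers it to truncated words, because all numbers are bounded by a
fixed power of `2 ^ w`. -/

lemma sum_choose_le_pow (N d v : ℕ) (hv : v ≤ d) :
    ∑ k ∈ Iic v, N.choose k ≤ (N + 1) ^ d := by
  calc ∑ k ∈ Iic v, N.choose k ≤ ∑ k ∈ range (d + 1), N.choose k := by
        refine sum_le_sum_of_subset fun k hk => ?_
        simp only [mem_Iic, mem_range] at *
        omega
    _ ≤ ∑ k ∈ range (d + 1), N ^ k * 1 ^ (d - k) * d.choose k := by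
        refine sum_le_sum fun k hk => ?_
        have h1 : 0 < d.choose k := Nat.choose_pos (by simp at hk; omega)
        have h2 := Nat.choose_le_pow N k
        have h3 : N ^ k * 1 ≤ N ^ k * d.choose k := Nat.mul_le_mul_left _ h1
        simpa using h2.trans (by simpa using h3)
    _ = (N + 1) ^ d := by rw [add_pow]; simp

/-- Affine functions realise at most `(N + 1) ^ d` sign patterns on points of `ℝ ^ d`. -/
lemma card_signPatterns_le {ι κ : Type*} [Fintype κ] [DecidableEq κ] (d : ℕ)
    (X : Finset ι) (x : ι → Fin d → ℝ) (α : κ → Fin d → ℝ) (β : κ → ℝ) :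
    (X.image fun i => ({h | 0 ≤ β h + ∑ t, α h t * x i t} : Finset κ)).card
      ≤ (Fintype.card κ + 1) ^ d := by
  set 𝒜 := X.image fun i => ({h | 0 ≤ β h + ∑ t, α h t * x i t} : Finset κ) with h𝒜
  refine (card_le_card_shatterer 𝒜).trans (card_shatterer_le_sum_vcDim.trans ?_)
  refine sum_choose_le_pow _ _ _ (Finset.sup_le fun s hs => ?_)
  rw [mem_shatterer] at hs
  by_contra! hcard
  -- Were more than `d` hyperplanes shattered by points, their normals would be dependent, and the
  -- same combination of the affine functions would not depend on the point. Suitable sign patterns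
  -- force this constant to be negative, both for the dependence and for its negative. That the
  -- exponent is `d` and not `d + 1` matters for the final rate.
  have hdep : ¬ LinearIndependent ℝ (fun h : s => α h) := by
    intro hli
    have := hli.fintype_card_le_finrank
    simp at this
    omega
  rw [Fintype.not_linearIndependent_iff] at hdep
  obtain ⟨g, hg, i0, hi0⟩ := hdep
  have hsum : ∀ c : s → ℝ, (∑ h, c h • α h = 0) → ∀ i,
      ∑ h : s, c h * (β h + ∑ t, α h t * x i t) = ∑ h, c h * β h := by
    intro c hc i
    simp only [mul_add, sum_add_distrib]
    rw [add_eq_left]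
    simp only [mul_sum]
    rw [sum_comm]
    refine sum_eq_zero fun t _ => ?_
    have := congrFun hc t
    simp only [Finset.sum_apply, Pi.smul_apply, smul_eq_mul, Pi.zero_apply] at this
    rw [← zero_mul (x i t), ← this, sum_mul]
    exact sum_congr rfl fun _ _ => by ring
  have key : ∀ c : s → ℝ, (∑ h, c h • α h = 0) → (∃ h, 0 < c h) → ∑ h, c h * β h < 0 := by
    intro c hc ⟨h1, hh1⟩
    -- In the pattern where exactly the functions with negative coefficient are nonnegative, no term
    -- is positive; the term of a positive coefficient is strictly negative, since `0 ≤ ·` fails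
    -- strictly.
    obtain ⟨u, hu, hsu⟩ := hs (t := s.filter fun h => ∃ hh : h ∈ s, c ⟨h, hh⟩ < 0)
      (filter_subset _ _)
    obtain ⟨i, -, rfl⟩ := mem_image.1 hu
    have hmem : ∀ h : s, (0 ≤ β h + ∑ t, α h t * x i t) ↔ c h < 0 := by
      intro h
      have := congrArg (fun z => (h : κ) ∈ z) hsu
      simpa using this
    rw [← hsum c hc i]
    refine sum_neg' (fun h _ => ?_) ⟨h1, mem_univ _, ?_⟩
    · rcases lt_trichotomy (c h) 0 with hneg | hz | hpos
      · exact mul_nonpos_of_nonpos_of_nonneg hneg.le ((hmem h).2 hneg)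
      · simp [hz]
      · refine mul_nonpos_of_nonneg_of_nonpos hpos.le ?_
        by_contra! hcon
        exact absurd ((hmem h).1 hcon.le) (by linarith)
    · refine mul_neg_of_pos_of_neg hh1 ?_
      by_contra! hcon
      exact absurd ((hmem h1).1 hcon) (by linarith)
  -- Without a positive coefficient no term is known to be strict. Then `key` for `-c` makes the
  -- constant positive, while the all-nonnegative pattern makes it at most `0`.
  have key' : ∀ c : s → ℝ, (∑ h, c h • α h = 0) → (∃ h, c h ≠ 0) → ∑ h, c h * β h < 0 := by
    intro c hc ⟨h, hh⟩
    by_cases hex : ∃ h, 0 < c h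
    · exact key c hc hex
    push Not at hex
    have hpos := key (fun h => - c h) (by simpa [neg_smul, sum_neg_distrib] using hc)
      ⟨h, by have := lt_of_le_of_ne (hex h) hh; simpa using this⟩
    obtain ⟨u, hu, hsu⟩ := hs (t := s) subset_rfl
    obtain ⟨i, -, rfl⟩ := mem_image.1 hu
    have hmem : ∀ h : s, (0 ≤ β h + ∑ t, α h t * x i t) := by
      intro h
      have := congrArg (fun z => (h : κ) ∈ z) hsu
      simpa using this
    have : ∑ h : s, c h * (β h + ∑ t, α h t * x i t) ≤ 0 :=
      sum_nonpos fun h _ => mul_nonpos_of_nonpos_of_nonneg (hex h) (hmem h)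
    rw [hsum c hc i] at this
    simp only [neg_mul, sum_neg_distrib] at hpos
    linarith
  have h1 := key' g hg ⟨i0, hi0⟩
  have h2 := key' (fun h => - g h) (by simpa [neg_smul, sum_neg_distrib] using hg)
    ⟨i0, by simpa using hi0⟩
  simp only [neg_mul, sum_neg_distrib] at h2
  linarith

/-- Greedy separation: if every element of `Q` is separated by more than a `δ`-fraction of the
mass `φ`, then `r` suitable separators leave only a fraction `exp (-δ r)` unseparated. -/
lemma exists_separators {F P : Type*} [Fintype F] [Nonempty F] (sep : F → P → Prop)
    [∀ f p, Decidable (sep f p)] (φ : F → ℝ) (hφ : ∀ f, 0 ≤ φ f) (δ : ℝ) (Q : Finset P)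
    (hfar : ∀ p ∈ Q, δ * ∑ f, φ f < ∑ f with sep f p, φ f) (r : ℕ) :
    ∃ g : Fin r → F, ((Q.filter fun p => ∀ k, ¬ sep (g k) p).card : ℝ)
      ≤ Q.card * Real.exp (-(δ * r)) := by
  induction r with
  | zero => exact ⟨Fin.elim0, by simp⟩
  | succ r ih =>
    obtain ⟨g, hg⟩ := ih
    set Q' := Q.filter fun p => ∀ k, ¬ sep (g k) p with hQ'
    -- Double counting of the pairs (function, separated element), with functions weighted by `φ`:
    -- on average a `δ`-fraction of what remains is separated.
    obtain ⟨f, hf⟩ : ∃ f, δ * Q'.card ≤ ((Q'.filter fun p => sep f p).card : ℝ) := by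
      by_contra! hcon
      have h1 : ∑ f, φ f * ((Q'.filter fun p => sep f p).card : ℝ)
          = ∑ p ∈ Q', ∑ f with sep f p, φ f := by
        simp only [card_filter, Nat.cast_sum, mul_sum, sum_filter]
        rw [sum_comm]
        refine sum_congr rfl fun p _ => sum_congr rfl fun f _ => ?_
        split_ifs <;> simp
      have h2 : ∑ f, φ f * ((Q'.filter fun p => sep f p).card : ℝ)
          ≤ ∑ f, φ f * (δ * Q'.card) :=
        sum_le_sum fun f _ => mul_le_mul_of_nonneg_left (hcon f).le (hφ f)
      rcases Q'.eq_empty_or_nonempty with he | hne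
      · obtain ⟨f⟩ := ‹Nonempty F›
        have := hcon f
        simp [he] at this
      · have h3 : ∑ p ∈ Q', δ * ∑ f, φ f < ∑ p ∈ Q', ∑ f with sep f p, φ f :=
          sum_lt_sum_of_nonempty hne fun p hp => hfar p (mem_of_mem_filter p hp)
        rw [← h1, sum_const, nsmul_eq_mul] at h3
        rw [← sum_mul] at h2
        linarith
    refine ⟨Fin.snoc g f, ?_⟩
    have hsub : (Q.filter fun p => ∀ k, ¬ sep (Fin.snoc (α := fun _ => F) g f k) p)
        = Q'.filter fun p => ¬ sep f p := by
      ext p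
      simp only [hQ', mem_filter, Fin.forall_fin_succ', Fin.snoc_castSucc, Fin.snoc_last]
      tauto
    rw [hsub]
    have hc := Finset.card_filter_add_card_filter_not (s := Q') (fun p => sep f p)
    have hc' : ((Q'.filter fun p => sep f p).card : ℝ)
      + ((Q'.filter fun p => ¬ sep f p).card : ℝ) = Q'.card := by exact_mod_cast hc
    have he : 1 - δ ≤ Real.exp (-δ) := by
      have := Real.add_one_le_exp (-δ); linarith
    calc ((Q'.filter fun p => ¬ sep f p).card : ℝ) ≤ Q'.card * (1 - δ) := by linarith
      _ ≤ Q'.card * Real.exp (-δ) := by gcongr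
      _ ≤ (Q.card * Real.exp (-(δ * r))) * Real.exp (-δ) := by gcongr
      _ = Q.card * Real.exp (-(δ * (r + 1 : ℕ))) := by
        rw [mul_assoc, ← Real.exp_add]; push_cast; ring_nf

/-- The thresholds `-1 + 2k/r` cut `[-1, 1]` into intervals of length `2/r`, and the last threshold
below `x` is also below `y`. -/
lemma sub_le_of_same_grid (r : ℕ) (hr : 1 ≤ r) (x y : ℝ) (hx : |x| ≤ 1)
    (h : ∀ k : Fin r, 0 ≤ (1 - 2 * (k : ℕ) / r) + x → 0 ≤ (1 - 2 * (k : ℕ) / r) + y) :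
    x - y ≤ 2 / r := by
  have hr0 : (0 : ℝ) < r := by exact_mod_cast hr
  obtain ⟨hx1, hx2⟩ := abs_le.1 hx
  have hnn : 0 ≤ (x + 1) * r / 2 := by have : 0 ≤ x + 1 := by linarith
                                       positivity
  -- The cap `r - 1` takes effect only at `x = 1`.
  set k := min ⌊(x + 1) * r / 2⌋₊ (r - 1) with hk
  have hk1 : (k : ℝ) ≤ (x + 1) * r / 2 :=
    (Nat.cast_le.2 (min_le_left _ _)).trans (Nat.floor_le hnn)
  have hk2 : (x + 1) * r / 2 ≤ k + 1 := by
    rcases min_choice ⌊(x + 1) * r / 2⌋₊ (r - 1) with h1 | h1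
    · rw [hk, h1]; exact (Nat.lt_floor_add_one _).le
    · rw [hk, h1]
      have : ((r - 1 : ℕ) : ℝ) + 1 = r := by
        rw [Nat.cast_sub hr]; simp
      rw [this]
      nlinarith
  have hlt : k < r := lt_of_le_of_lt (min_le_right _ _) (by omega)
  have h1 := h ⟨k, hlt⟩ (by
    have : 2 * (k : ℝ) / r ≤ x + 1 := by rw [div_le_iff₀ hr0]; linarith
    simp only
    linarith)
  simp only at h1
  have h2 : x + 1 ≤ (2 * k + 2) / r := by rw [le_div_iff₀ hr0]; linarith
  rw [add_div] at h2
  linarith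

/-- Among sufficiently many points of the cube there are `d + 2` that are close to each other and
that are separated by few of the given hyperplanes. -/
lemma exists_close_group {ι F : Type*} [DecidableEq ι] [Fintype F] [Nonempty F] (d r : ℕ)
    (hr : 1 ≤ r) (Y : Finset ι) (x : ι → Fin d → ℝ) (hx : ∀ i ∈ Y, ∀ t, |x i t| ≤ 1)
    (α : F → Fin d → ℝ) (β : F → ℝ) (φ : F → ℝ) (hφ : ∀ f, 0 ≤ φ f) (δ : ℝ)
    (hcard : (d + 1) * ((d + 1) * r + 1) ^ d < Y.card)
    (hfar : (Y.card : ℝ) ^ 2 * Real.exp (-(δ * r)) < 1) :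
    ∃ G ⊆ Y, G.card = d + 2 ∧ (∀ i ∈ G, ∀ j ∈ G, ∀ t, |x i t - x j t| ≤ 2 / r) ∧
      ∀ i ∈ G, ∀ j ∈ G,
        ∑ f with ¬ (0 ≤ β f + ∑ t, α f t * x i t ↔ 0 ≤ β f + ∑ t, α f t * x j t), φ f
          ≤ δ * ∑ f, φ f := by
  classical
  set sep : F → ι × ι → Prop := fun f p =>
    ¬ (0 ≤ β f + ∑ t, α f t * x p.1 t ↔ 0 ≤ β f + ∑ t, α f t * x p.2 t) with hsep
  obtain ⟨g, hg⟩ := exists_separators sep φ hφ δ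
    ((Y ×ˢ Y).filter fun p => δ * ∑ f, φ f < ∑ f with sep f p, φ f)
    (fun p hp => (mem_filter.1 hp).2) r
  -- Fewer than one far pair escapes the `r` separators, hence none.
  have hempty : ∀ p ∈ Y ×ˢ Y, (∀ k, ¬ sep (g k) p) → ∑ f with sep f p, φ f ≤ δ * ∑ f, φ f := by
    intro p hp hk
    by_contra! hcon
    have h1 : p ∈ ((Y ×ˢ Y).filter fun p => δ * ∑ f, φ f < ∑ f with sep f p, φ f).filter
        fun p => ∀ k, ¬ sep (g k) p := mem_filter.2 ⟨mem_filter.2 ⟨hp, hcon⟩, hk⟩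
    have h2 : (1 : ℝ) ≤ (((Y ×ˢ Y).filter fun p => δ * ∑ f, φ f < ∑ f with sep f p, φ f).filter
        fun p => ∀ k, ¬ sep (g k) p).card := by
      exact_mod_cast card_pos.2 ⟨p, h1⟩
    have h3 : (((Y ×ˢ Y).filter fun p => δ * ∑ f, φ f < ∑ f with sep f p, φ f).card : ℝ)
        ≤ (Y.card : ℝ) ^ 2 := by
      have := card_filter_le (Y ×ˢ Y) fun p => δ * ∑ f, φ f < ∑ f with sep f p, φ f
      rw [card_product, ← sq] at this
      exact_mod_cast this
    have h4 := mul_le_mul_of_nonneg_right h3 (Real.exp_pos (-(δ * r))).le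
    linarith
  -- The arrangement consists of the `r` separators and of `r` grid hyperplanes for each coordinate.
  -- The pigeonhole principle on its cells gives the group.
  let α' : Fin r ⊕ (Fin d × Fin r) → Fin d → ℝ :=
    Sum.elim (fun k => α (g k)) (fun p t => if t = p.1 then 1 else 0)
  let β' : Fin r ⊕ (Fin d × Fin r) → ℝ :=
    Sum.elim (fun k => β (g k)) (fun p => 1 - 2 * (p.2 : ℕ) / r)
  let pat : ι → Finset (Fin r ⊕ (Fin d × Fin r)) := fun i =>
    {h | 0 ≤ β' h + ∑ t, α' h t * x i t}
  have hcells : (Y.image pat).card ≤ ((d + 1) * r + 1) ^ d := by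
    refine (card_signPatterns_le d Y x α' β').trans (le_of_eq ?_)
    simp
    ring
  obtain ⟨c, -, hc⟩ := exists_lt_card_fiber_of_mul_lt_card_of_maps_to (s := Y) (t := Y.image pat)
    (f := pat) (n := d + 1) (fun i hi => mem_image_of_mem _ hi)
    (lt_of_le_of_lt (by rw [mul_comm]; exact Nat.mul_le_mul_left _ hcells) hcard)
  obtain ⟨G, hG, hGc⟩ := exists_subset_card_eq (s := Y.filter fun i => pat i = c) (n := d + 2) hc
  have hpat : ∀ i ∈ G, ∀ j ∈ G, ∀ h, (0 ≤ β' h + ∑ t, α' h t * x i t) ↔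
      (0 ≤ β' h + ∑ t, α' h t * x j t) := by
    intro i hi j hj h
    have h1 := (mem_filter.1 (hG hi)).2.trans (mem_filter.1 (hG hj)).2.symm
    have := congrArg (fun z => h ∈ z) h1
    simpa [pat] using this
  have hY : ∀ i ∈ G, i ∈ Y := fun i hi => (mem_filter.1 (hG hi)).1
  have hgrid : ∀ i ∈ G, ∀ j ∈ G, ∀ t, x i t - x j t ≤ 2 / r := by
    intro i hi j hj t
    refine sub_le_of_same_grid r hr _ _ (hx i (hY i hi) t) fun k => ?_
    have := (hpat i hi j hj (Sum.inr (t, k))).1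
    simpa [α', β'] using this
  refine ⟨G, hY, hGc, fun i hi j hj t => ?_, fun i hi j hj => ?_⟩
  · rw [abs_le]
    exact ⟨by linarith [hgrid j hj i hi t], hgrid i hi j hj t⟩
  · refine hempty (i, j) (mem_product.2 ⟨hY i hi, hY j hj⟩) fun k => ?_
    simp only [hsep, not_not]
    exact hpat i hi j hj (Sum.inl k)

/-- The `d + 2` vectors `(1, x i)` live in dimension `d + 1`; the additional coordinate yields `∑ v
= 0`. -/
lemma exists_affine_dependence {ι : Type*} (d : ℕ) (G : Finset ι) (hG : G.card = d + 2)
    (x : ι → Fin d → ℝ) :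
    ∃ v : ι → ℝ, (∃ i ∈ G, v i ≠ 0) ∧ ∑ i ∈ G, v i = 0 ∧ ∀ t, ∑ i ∈ G, v i * x i t = 0 := by
  classical
  let y : G → Option (Fin d) → ℝ := fun i o => o.elim 1 (x i)
  have hdep : ¬ LinearIndependent ℝ y := by
    intro hli
    have := hli.fintype_card_le_finrank
    simp at this
    omega
  rw [Fintype.not_linearIndependent_iff] at hdep
  obtain ⟨g, hg, i0, hi0⟩ := hdep
  have hsum : ∀ z : ι → ℝ, ∑ i ∈ G, (if h : i ∈ G then g ⟨i, h⟩ else 0) * z i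
      = ∑ i : G, g i * z i := by
    intro z
    rw [← sum_coe_sort G]
    refine sum_congr rfl fun i _ => ?_
    simp
  refine ⟨fun i => if h : i ∈ G then g ⟨i, h⟩ else 0, ⟨i0, i0.2, by simpa using hi0⟩, ?_, ?_⟩
  · have h := hsum fun _ => 1
    simp only [mul_one] at h
    rw [h]
    simpa [y] using congrFun hg none
  · intro t
    rw [hsum fun i => x i t]
    simpa [y] using congrFun hg (some t)

/-- The ratio test of the simplex method. A nonzero direction of sum zero has a negative entry, and
the smallest ratio `u i / -v i` tells where a weight vanishes first. -/
lemma exists_pivot {ι : Type*} (G : Finset ι) (u v : ι → ℝ) (hu : ∀ i ∈ G, 0 < u i)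
    (hv : ∃ i ∈ G, v i ≠ 0) (hsum : ∑ i ∈ G, v i = 0) :
    ∃ τ : ℝ, 0 < τ ∧ (∀ i ∈ G, 0 ≤ u i + τ * v i) ∧ ∃ i ∈ G, u i + τ * v i = 0 := by
  have hneg : (G.filter fun i => v i < 0).Nonempty := by
    by_contra hcon
    rw [not_nonempty_iff_eq_empty, filter_eq_empty_iff] at hcon
    have h0 := (sum_eq_zero_iff_of_nonneg fun i hi => not_lt.1 (hcon hi)).1 hsum
    obtain ⟨i, hi, hvi⟩ := hv
    exact hvi (h0 i hi)
  obtain ⟨k, hk, hmin⟩ := exists_min_image _ (fun i => u i / -v i) hneg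
  rw [mem_filter] at hk
  have hvk : 0 < - v k := by linarith [hk.2]
  refine ⟨u k / -v k, div_pos (hu k hk.1) hvk, fun i hi => ?_, k, hk.1, ?_⟩
  · by_cases hvi : v i < 0
    · have h1 := hmin i (mem_filter.2 ⟨hi, hvi⟩)
      rw [le_div_iff₀ (by linarith)] at h1
      linarith
    · have := mul_nonneg (div_pos (hu k hk.1) hvk).le (not_lt.1 hvi)
      linarith [hu i hi]
  · rw [div_neg, neg_mul, div_mul_cancel₀ _ hk.2.ne, add_neg_cancel]

lemma exp_le_one_add_add_sq {y : ℝ} (hy : |y| ≤ 1) : Real.exp y ≤ 1 + y + y ^ 2 := by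
  have := (abs_le.1 (Real.abs_exp_sub_one_sub_id_le hy)).2
  linarith

/-- Moment generating function of a bounded two-valued variable of mean zero: the linear terms
cancel. -/
lemma two_point_exp_le {p q a b c : ℝ} (hp : 0 ≤ p) (hq : 0 ≤ q) (hpq : p + q = 1)
    (hmean : p * a + q * b = 0) (ha : |a| ≤ c) (hb : |b| ≤ c) (hc : c ≤ 1) :
    p * Real.exp a + q * Real.exp b ≤ 1 + c ^ 2 := by
  have h1 := mul_le_mul_of_nonneg_left (exp_le_one_add_add_sq (ha.trans hc)) hp
  have h2 := mul_le_mul_of_nonneg_left (exp_le_one_add_add_sq (hb.trans hc)) hq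
  have h3 : a ^ 2 ≤ c ^ 2 := sq_le_sq' (abs_le.1 ha).1 (abs_le.1 ha).2
  have h4 : b ^ 2 ≤ c ^ 2 := sq_le_sq' (abs_le.1 hb).1 (abs_le.1 hb).2
  have h5 := mul_le_mul_of_nonneg_left h3 hp
  have h6 := mul_le_mul_of_nonneg_left h4 hq
  nlinarith

/-- The exponential potential of a family of discrepancies. -/
noncomputable def potential {F : Type*} [Fintype F] (lam : ℝ) (D : F → ℝ) : ℝ :=
  ∑ f, (Real.exp (lam * D f) + Real.exp (-(lam * D f)))

/-- A mean-zero two-point step changes the potential little if it moves few discrepancies. -/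
lemma exists_potential_le {F : Type*} [Fintype F] (lam c η : ℝ) (hlam : 0 ≤ lam)
    (hc : lam * c ≤ 1) (D κ : F → ℝ) (τ σ : ℝ) (hτ : 0 < τ) (hσ : 0 < σ) (Cr : Finset F)
    (hout : ∀ f ∉ Cr, κ f = 0) (hin : ∀ f ∈ Cr, |τ * κ f| ≤ c ∧ |σ * κ f| ≤ c)
    (hCr : ∑ f ∈ Cr, (Real.exp (lam * D f) + Real.exp (-(lam * D f))) ≤ η * potential lam D) :
    potential lam (fun f => D f + τ * κ f) ≤ potential lam D * (1 + η * (lam * c) ^ 2) ∨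
    potential lam (fun f => D f - σ * κ f) ≤ potential lam D * (1 + η * (lam * c) ^ 2) := by
  classical
  -- Probabilities inversely proportional to the step lengths give a random step of mean zero. The
  -- bound is proved for the expected potential, so one of the two outcomes satisfies it.
  set p := σ / (τ + σ) with hp
  set q := τ / (τ + σ) with hq
  have hp0 : 0 < p := by positivity
  have hq0 : 0 < q := by positivity
  have hpq : p + q = 1 := by rw [hp, hq]; field_simp; ring
  have hm : ∀ y, p * (τ * y) + q * (-(σ * y)) = 0 := fun y => by rw [hp, hq]; field_simp; ring
  have hmain : p * potential lam (fun f => D f + τ * κ f)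
      + q * potential lam (fun f => D f - σ * κ f)
      ≤ potential lam D * (1 + η * (lam * c) ^ 2) := by
    have h1 : ∀ f, p * (Real.exp (lam * (D f + τ * κ f)) + Real.exp (-(lam * (D f + τ * κ f))))
        + q * (Real.exp (lam * (D f - σ * κ f)) + Real.exp (-(lam * (D f - σ * κ f))))
        ≤ (Real.exp (lam * D f) + Real.exp (-(lam * D f)))
          + if f ∈ Cr then (Real.exp (lam * D f) + Real.exp (-(lam * D f))) * (lam * c) ^ 2
            else 0 := by
      intro f
      by_cases hf : f ∈ Cr
      · obtain ⟨ha, hb⟩ := hin f hf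
        have ha' : |lam * (τ * κ f)| ≤ lam * c := by
          rw [abs_mul, abs_of_nonneg hlam]; gcongr
        have hb' : |lam * (σ * κ f)| ≤ lam * c := by
          rw [abs_mul, abs_of_nonneg hlam]; gcongr
        have e1 := two_point_exp_le (a := lam * (τ * κ f)) (b := -(lam * (σ * κ f)))
          hp0.le hq0.le hpq (by linear_combination lam * hm (κ f)) ha' (by rwa [abs_neg]) hc
        have e2 := two_point_exp_le (a := -(lam * (τ * κ f))) (b := lam * (σ * κ f))
          hp0.le hq0.le hpq (by linear_combination -lam * hm (κ f)) (by rwa [abs_neg]) hb' hc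
        rw [if_pos hf]
        have x1 : Real.exp (lam * (D f + τ * κ f))
          = Real.exp (lam * D f) * Real.exp (lam * (τ * κ f)) := by
          rw [← Real.exp_add]; ring_nf
        have x2 : Real.exp (lam * (D f - σ * κ f))
          = Real.exp (lam * D f) * Real.exp (-(lam * (σ * κ f))) := by
          rw [← Real.exp_add]; ring_nf
        have x3 : Real.exp (-(lam * (D f + τ * κ f)))
          = Real.exp (-(lam * D f)) * Real.exp (-(lam * (τ * κ f))) := by
          rw [← Real.exp_add]; ring_nf
        have x4 : Real.exp (-(lam * (D f - σ * κ f)))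
          = Real.exp (-(lam * D f)) * Real.exp (lam * (σ * κ f)) := by
          rw [← Real.exp_add]; ring_nf
        rw [x1, x2, x3, x4]
        have y1 := mul_le_mul_of_nonneg_left e1 (Real.exp_pos (lam * D f)).le
        have y2 := mul_le_mul_of_nonneg_left e2 (Real.exp_pos (-(lam * D f))).le
        linarith
      · rw [if_neg hf, hout f hf]
        simp only [mul_zero, add_zero, sub_zero]
        rw [← add_mul, hpq, one_mul]
    unfold potential at hCr ⊢
    rw [mul_sum, mul_sum, ← sum_add_distrib]
    refine (sum_le_sum fun f _ => h1 f).trans ?_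
    rw [sum_add_distrib, sum_ite_mem, univ_inter, ← sum_mul]
    have := mul_le_mul_of_nonneg_right hCr (sq_nonneg (lam * c))
    linarith
  by_contra! hcon
  obtain ⟨c1, c2⟩ := hcon
  have y1 := mul_lt_mul_of_pos_left c1 hp0
  have y2 := mul_lt_mul_of_pos_left c2 hq0
  have : p * (potential lam D * (1 + η * (lam * c) ^ 2))
    + q * (potential lam D * (1 + η * (lam * c) ^ 2))
    = potential lam D * (1 + η * (lam * c) ^ 2) := by rw [← add_mul, hpq, one_mul]
  linarith

/-- One elimination step. -/
lemma exists_elimination {ι F : Type*} [Fintype ι] [DecidableEq ι] [Fintype F] [Nonempty F]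
    (d r s : ℕ) (hr : 1 ≤ r) (hs : 2 * ((d + 1) * ((d + 1) * r + 1) ^ d) ≤ s)
    (x : ι → Fin d → ℝ) (hx : ∀ i t, |x i t| ≤ 1) (α : F → Fin d → ℝ) (hα : ∀ f t, |α f t| ≤ 1)
    (β : F → ℝ) (h : F → ι → ℝ) (hh : ∀ f i, h f i = max 0 (β f + ∑ t, α f t * x i t))
    (W : ℝ) (hW : 0 < W) (u : ι → ℝ) (hu : ∀ i, 0 ≤ u i) (hsum : ∑ i, u i = W)
    (hm : s < (univ.filter fun i => u i ≠ 0).card) (hcard : Fintype.card ι ≤ 2 * s)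
    (lam : ℝ) (hlam : 0 ≤ lam) (hlamc : lam * (8 * d * (d + 2) * W / (s * r)) ≤ 1)
    (u₀ : ι → ℝ) :
    ∃ u' : ι → ℝ, (∀ i, 0 ≤ u' i) ∧ ∑ i, u' i = W ∧
      (univ.filter fun i => u' i ≠ 0) ⊂ (univ.filter fun i => u i ≠ 0) ∧
      potential lam (fun f => ∑ i, (u' i - u₀ i) * h f i)
        ≤ potential lam (fun f => ∑ i, (u i - u₀ i) * h f i) *
          (1 + (d + 1) * (3 * Real.log (2 * s) / r)
            * (lam * (8 * d * (d + 2) * W / (s * r))) ^ 2) := by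
  have hs1 : 1 ≤ s := by
    have : 0 < (d + 1) * ((d + 1) * r + 1) ^ d := by positivity
    omega
  have hs0 : (0 : ℝ) < s := by exact_mod_cast hs1
  have hr0 : (0 : ℝ) < r := by exact_mod_cast hr
  set D : F → ℝ := fun f => ∑ i, (u i - u₀ i) * h f i with hD
  set Y := univ.filter fun i => u i ≠ 0 ∧ u i ≤ 2 * W / s with hY
  set φ : F → ℝ := fun f => Real.exp (lam * D f) + Real.exp (-(lam * D f)) with hφ
  -- At most `s / 2` points can weigh more than `2 * W / s`, so more than `s / 2` points of the
  -- support are light.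
  have hYcard : (d + 1) * ((d + 1) * r + 1) ^ d < Y.card := by
    have h1 : ((univ.filter fun i => 2 * W / s < u i).card : ℝ) * (2 * W / s) ≤ W := by
      rw [← nsmul_eq_mul, ← sum_const]
      refine (sum_le_sum (g := u) fun i hi => (mem_filter.1 hi).2.le).trans ?_
      rw [← hsum]
      exact sum_le_sum_of_subset_of_nonneg (filter_subset _ _) fun i _ _ => hu i
    have h2 : 2 * (univ.filter fun i => 2 * W / s < u i).card ≤ s := by
      have : ((univ.filter fun i => 2 * W / s < u i).card : ℝ) * 2 ≤ s := by
        rw [mul_div_assoc', div_le_iff₀ hs0] at h1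
        nlinarith
      rw [mul_comm]
      exact_mod_cast this
    have h3 : (univ.filter fun i => u i ≠ 0).card
        ≤ Y.card + (univ.filter fun i => 2 * W / s < u i).card := by
      refine (card_le_card fun i hi => ?_).trans (card_union_le _ _)
      simp only [hY, mem_union, mem_filter, mem_univ, true_and] at hi ⊢
      rcases le_or_gt (u i) (2 * W / s) with hl | hl
      · exact Or.inl ⟨hi, hl⟩
      · exact Or.inr hl
    omega
  -- With `δ = 3 log (2s) / r` the exponential is `(2s)⁻³`, which beats the at most `(2s)²` pairs.
  have hfar : (Y.card : ℝ) ^ 2 * Real.exp (-(3 * Real.log (2 * s) / r * r)) < 1 := by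
    have h1 : (Y.card : ℝ) ≤ 2 * s := by exact_mod_cast (card_le_univ Y).trans hcard
    rw [div_mul_cancel₀ _ hr0.ne', Real.exp_neg, mul_comm 3, Real.exp_mul, Real.exp_log (by positivity)]
    norm_cast
    rw [← div_eq_mul_inv, div_lt_one (by positivity)]
    have h2 : (1 : ℝ) ≤ s := by exact_mod_cast hs1
    push_cast
    have h3 : (Y.card : ℝ) ^ 2 ≤ (2 * s) ^ 2 := by gcongr
    nlinarith [sq_nonneg (s : ℝ)]
  obtain ⟨G, hGY, hGc, hclose, hsep⟩ := exists_close_group d r hr Y x (fun i _ => hx i) α β φ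
    (fun f => by positivity) _ hYcard hfar
  obtain ⟨v, hv0, hv1, hv2⟩ := exists_affine_dependence d G hGc x
  have hupos : ∀ i ∈ G, 0 < u i := fun i hi =>
    lt_of_le_of_ne (hu i) (mem_filter.1 (hGY hi)).2.1.symm
  have hlight : ∑ i ∈ G, u i ≤ (d + 2) * (2 * W / s) := by
    calc ∑ i ∈ G, u i ≤ ∑ i ∈ G, 2 * W / s := sum_le_sum fun i hi => (mem_filter.1 (hGY hi)).2.2
      _ = (d + 2) * (2 * W / s) := by rw [sum_const, hGc, nsmul_eq_mul]; push_cast; ring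
  obtain ⟨i0, hi0⟩ : G.Nonempty := card_pos.1 (by omega)
  -- The product of `2 (d+2) (2W/s)`, which bounds the total change of weight in the group, and of
  -- `2d/r`, which bounds the variation of a hinge on it.
  set c := 8 * d * (d + 2) * W / (s * r) with hc
  have hvar : ∀ f, ∀ i ∈ G, |h f i - h f i0| ≤ d * (2 / r) := by
    intro f i hi
    rw [hh, hh, max_comm (0 : ℝ), max_comm (0 : ℝ)]
    refine (abs_max_sub_max_le_abs _ _ _).trans ?_
    rw [add_sub_add_left_eq_sub, ← sum_sub_distrib]
    refine (abs_sum_le_sum_abs _ _).trans ?_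
    calc ∑ t, |α f t * x i t - α f t * x i0 t| ≤ ∑ _t : Fin d, (2 / r : ℝ) := by
          refine sum_le_sum fun t _ => ?_
          rw [← mul_sub, abs_mul]
          have := mul_le_mul (hα f t) (hclose i hi i0 hi0 t) (abs_nonneg _) zero_le_one
          linarith
      _ = d * (2 / r) := by simp
  have hbound : ∀ v' : ι → ℝ, ∑ i ∈ G, v' i = 0 → (∀ i ∈ G, 0 ≤ u i + v' i) → ∀ f,
      |∑ i ∈ G, v' i * h f i| ≤ c := by
    intro v' hz hnn f
    have e1 : ∑ i ∈ G, v' i * h f i = ∑ i ∈ G, v' i * (h f i - h f i0) := by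
      simp only [mul_sub, sum_sub_distrib]
      rw [← sum_mul, hz]; ring
    -- Since `v' ≥ -u`, the inequality `|v'| ≤ 2 u + v'` holds for either sign; in the sum `v'`
    -- disappears.
    have e2 : ∑ i ∈ G, |v' i| ≤ 2 * ((d + 2) * (2 * W / s)) := by
      calc ∑ i ∈ G, |v' i| ≤ ∑ i ∈ G, (2 * u i + v' i) := by
            refine sum_le_sum fun i hi => ?_
            rw [abs_le]
            constructor
            · linarith [hnn i hi]
            · linarith [hupos i hi]
        _ = 2 * ∑ i ∈ G, u i := by rw [sum_add_distrib, hz, mul_sum]; ring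
        _ ≤ _ := by linarith
    rw [e1]
    calc |∑ i ∈ G, v' i * (h f i - h f i0)| ≤ ∑ i ∈ G, |v' i| * (d * (2 / r)) := by
          refine (abs_sum_le_sum_abs _ _).trans (sum_le_sum fun i hi => ?_)
          rw [abs_mul]
          exact mul_le_mul_of_nonneg_left (hvar f i hi) (abs_nonneg _)
      _ = (∑ i ∈ G, |v' i|) * (d * (2 / r)) := by rw [sum_mul]
      _ ≤ 2 * ((d + 2) * (2 * W / s)) * (d * (2 / r)) := by gcongr
      _ = c := by rw [hc]; field_simp; ring
  obtain ⟨τ, hτ, hτn, hτz⟩ := exists_pivot G u v hupos hv0 hv1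
  obtain ⟨σ, hσ, hσn, hσz⟩ := exists_pivot G u (fun i => - v i) hupos
    (by simpa using hv0) (by simpa using hv1)
  set Cr := univ.filter fun f => ∃ i ∈ G.erase i0,
    ¬ (0 ≤ β f + ∑ t, α f t * x i0 t ↔ 0 ≤ β f + ∑ t, α f t * x i t) with hCr
  set κ : F → ℝ := fun f => ∑ i ∈ G, v i * h f i with hκ
  -- A hinge whose kink does not cross the group is affine or zero on it, and the affine dependence
  -- annihilates both.
  have hout : ∀ f ∉ Cr, κ f = 0 := by
    intro f hf
    have hf' : ∀ i ∈ G, (0 ≤ β f + ∑ t, α f t * x i0 t ↔ 0 ≤ β f + ∑ t, α f t * x i t) := by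
      intro i hi
      by_cases hii : i = i0
      · rw [hii]
      · by_contra hcon
        exact hf (mem_filter.2 ⟨mem_univ _, i, mem_erase.2 ⟨hii, hi⟩, hcon⟩)
    by_cases hpos : 0 ≤ β f + ∑ t, α f t * x i0 t
    · have : κ f = ∑ i ∈ G, v i * (β f + ∑ t, α f t * x i t) :=
        sum_congr rfl fun i hi => by rw [hh, max_eq_right ((hf' i hi).1 hpos)]
      rw [this]
      simp only [mul_add, sum_add_distrib, mul_sum]
      rw [← sum_mul, hv1, sum_comm, zero_mul, zero_add]
      refine sum_eq_zero fun t _ => ?_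
      rw [← mul_zero (α f t), ← hv2 t, mul_sum]
      exact sum_congr rfl fun _ _ => by ring
    · refine sum_eq_zero fun i hi => ?_
      have := mt (hf' i hi).2 hpos
      rw [hh, max_eq_left (by linarith), mul_zero]
  have hin : ∀ f ∈ Cr, |τ * κ f| ≤ c ∧ |σ * κ f| ≤ c := by
    intro f _
    constructor
    · have := hbound (fun i => τ * v i) (by rw [← mul_sum, hv1, mul_zero]) hτn f
      rwa [hκ, mul_sum, sum_congr rfl fun i _ => (mul_assoc τ (v i) (h f i)).symm]
    · have := hbound (fun i => σ * -v i)
        (by rw [← mul_sum, sum_neg_distrib, hv1]; simp) hσn f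
      rw [← abs_neg, hκ, mul_sum, ← sum_neg_distrib]
      convert this using 3
      ring
  -- Union bound over the `d + 1` companions of `i0`, each of which is separated from `i0` by little
  -- potential.
  have hmass : ∑ f ∈ Cr, φ f ≤ (d + 1) * (3 * Real.log (2 * s) / r) * potential lam D := by
    calc ∑ f ∈ Cr, φ f ≤ ∑ i ∈ G.erase i0, ∑ f with
          ¬ (0 ≤ β f + ∑ t, α f t * x i0 t ↔ 0 ≤ β f + ∑ t, α f t * x i t), φ f := by
          simp only [sum_filter, hCr]
          rw [sum_comm]
          refine sum_le_sum fun f _ => ?_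
          split_ifs with hf
          · obtain ⟨i, hi, hsep'⟩ := hf
            refine le_trans (by rw [if_pos hsep']) (single_le_sum (f := fun i =>
              if ¬ (0 ≤ β f + ∑ t, α f t * x i0 t ↔ 0 ≤ β f + ∑ t, α f t * x i t) then φ f else 0)
              (fun i _ => ?_) hi)
            split_ifs <;> positivity
          · exact sum_nonneg fun i _ => by split_ifs <;> positivity
      _ ≤ ∑ i ∈ G.erase i0, 3 * Real.log (2 * s) / r * ∑ f, φ f :=
          sum_le_sum fun i hi => hsep i0 hi0 i (mem_of_mem_erase hi)
      _ = _ := by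
          rw [sum_const, card_erase_of_mem hi0, hGc, nsmul_eq_mul]
          simp only [potential, hφ]
          push_cast
          ring
  have hfin : ∀ τ' : ℝ, (∀ i ∈ G, 0 ≤ u i + τ' * v i) → (∃ i ∈ G, u i + τ' * v i = 0) →
      potential lam (fun f => D f + τ' * κ f)
        ≤ potential lam D * (1 + (d + 1) * (3 * Real.log (2 * s) / r) * (lam * c) ^ 2) →
      ∃ u' : ι → ℝ, (∀ i, 0 ≤ u' i) ∧ ∑ i, u' i = W ∧
      (univ.filter fun i => u' i ≠ 0) ⊂ (univ.filter fun i => u i ≠ 0) ∧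
      potential lam (fun f => ∑ i, (u' i - u₀ i) * h f i)
        ≤ potential lam D * (1 + (d + 1) * (3 * Real.log (2 * s) / r) * (lam * c) ^ 2) := by
    intro τ' hn ⟨k, hk, hkz⟩ hpot
    refine ⟨fun i => u i + if i ∈ G then τ' * v i else 0, fun i => ?_, ?_, ?_, ?_⟩
    · dsimp only
      split_ifs with hi
      · exact hn i hi
      · simpa using hu i
    · rw [sum_add_distrib, sum_ite_mem, univ_inter, ← mul_sum, hv1, hsum]
      ring
    · refine Finset.ssubset_iff_subset_ne.2 ⟨fun i hi => ?_, fun heq => ?_⟩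
      · simp only [mem_filter, mem_univ, true_and] at hi ⊢
        by_cases hG : i ∈ G
        · exact (hupos i hG).ne'
        · simpa [hG] using hi
      · have : k ∈ univ.filter fun i => u i ≠ 0 := mem_filter.2 ⟨mem_univ _, (hupos k hk).ne'⟩
        rw [← heq] at this
        simp [hk, hkz] at this
    · convert hpot using 2
      funext f
      simp only [hD, hκ, add_sub_right_comm, add_mul, sum_add_distrib]
      congr 1
      rw [mul_sum]
      simp only [ite_mul, zero_mul, sum_ite_mem, univ_inter]
      exact sum_congr rfl fun _ _ => by ring
  rcases exists_potential_le lam c _ hlam hlamc D κ τ σ hτ hσ Cr hout hin hmass with hp | hp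
  · exact hfin τ hτn hτz hp
  · refine hfin (-σ) (fun i hi => ?_) ?_ ?_
    · have := hσn i hi; linarith
    · obtain ⟨k, hk, hkz⟩ := hσz
      exact ⟨k, hk, by linarith⟩
    · convert hp using 3
      ring

/-- Half of the points, suitably reweighted, represent a weighted point set well. -/
theorem exists_half_coreset {ι F : Type*} [Fintype ι] [DecidableEq ι] [Fintype F] [Nonempty F]
    (d r s : ℕ) (hd : 1 ≤ d) (hr : 1 ≤ r) (hs : 2 * ((d + 1) * ((d + 1) * r + 1) ^ d) ≤ s)
    (x : ι → Fin d → ℝ) (hx : ∀ i t, |x i t| ≤ 1) (α : F → Fin d → ℝ) (hα : ∀ f t, |α f t| ≤ 1)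
    (β : F → ℝ) (h : F → ι → ℝ) (hh : ∀ f i, h f i = max 0 (β f + ∑ t, α f t * x i t))
    (u : ι → ℝ) (hu : ∀ i, 0 ≤ u i) (hcard : Fintype.card ι ≤ 2 * s) :
    ∃ u' : ι → ℝ, (∀ i, 0 ≤ u' i) ∧ ∑ i, u' i = ∑ i, u i ∧
      (univ.filter fun i => u' i ≠ 0).card ≤ s ∧
      ∀ f, |∑ i, (u' i - u i) * h f i| ≤ (∑ i, u i) * (8 * d * (d + 2) *
        (Real.log (2 * Fintype.card F) + 3 * (d + 1) * Real.log (2 * s))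
          / Real.sqrt (s * r ^ 3)) := by
  set W := ∑ i, u i with hWdef
  have hW0 : 0 ≤ W := sum_nonneg fun i _ => hu i
  rcases hW0.eq_or_lt with hW | hW
  · have hz : ∀ i, u i = 0 := fun i =>
      (sum_eq_zero_iff_of_nonneg fun i _ => hu i).1 hW.symm i (mem_univ i)
    exact ⟨u, hu, rfl, by simp [hz], fun f => by simp [← hW]⟩
  have hrs : r ≤ s := by
    have h1 : r ≤ (d + 1) * r + 1 := by nlinarith
    have h2 : (d + 1) * r + 1 ≤ ((d + 1) * r + 1) ^ d := Nat.le_self_pow (by omega) _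
    nlinarith [Nat.zero_le (((d + 1) * r + 1) ^ d * d)]
  have hr0 : (0 : ℝ) < r := by exact_mod_cast hr
  have hrs' : (r : ℝ) ≤ s := by exact_mod_cast hrs
  have hs0 : (0 : ℝ) < s := hr0.trans_le hrs'
  have hd0 : (0 : ℝ) < d := by exact_mod_cast hd
  set c := 8 * d * (d + 2) * W / (s * r) with hc
  set Q := Real.sqrt (s * r ^ 3) with hQ
  have hQ0 : 0 < Q := Real.sqrt_pos.2 (by positivity)
  have hQ2 : Q ^ 2 = s * r ^ 3 := Real.sq_sqrt (by positivity)
  -- This makes `(lam * c)² = r / s`. Then `s` steps multiply the potential by at most `exp (3 (d+1)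
  -- log (2s))`, so that its logarithm stays of the order `log |F| + log s`. The steps are small
  -- enough, `lam * c ≤ 1`, because `r ≤ s`.
  set lam := Q / (8 * d * (d + 2) * W) with hlam
  have hlam0 : 0 < lam := by positivity
  have hlc : lam * c = Q / (s * r) := by rw [hlam, hc]; field_simp
  have hlc2 : (lam * c) ^ 2 = r / s := by
    rw [hlc, div_pow, hQ2]; field_simp
  have hlc1 : lam * c ≤ 1 := by
    have h1 : (lam * c) ^ 2 ≤ 1 := by rw [hlc2, div_le_one hs0]; exact hrs'
    have h0 : 0 ≤ lam * c := by rw [hlc]; positivity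
    nlinarith
  set η := (d + 1) * (3 * Real.log (2 * s) / r) * (lam * c) ^ 2 with hη
  have hlog0 : 0 ≤ Real.log (2 * s) := by
    refine Real.log_nonneg ?_
    have : (1 : ℝ) ≤ r := by exact_mod_cast hr
    linarith
  have hη0 : 0 ≤ η := by positivity
  have hη1 : s * η = 3 * (d + 1) * Real.log (2 * s) := by
    rw [hη, hlc2]; field_simp
  have hiter : ∀ k : ℕ, ∀ v : ι → ℝ, (∀ i, 0 ≤ v i) → ∑ i, v i = W →
      (univ.filter fun i => v i ≠ 0).card ≤ s + k →
      ∃ u' : ι → ℝ, (∀ i, 0 ≤ u' i) ∧ ∑ i, u' i = W ∧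
        (univ.filter fun i => u' i ≠ 0).card ≤ s ∧
        potential lam (fun f => ∑ i, (u' i - u i) * h f i)
          ≤ potential lam (fun f => ∑ i, (v i - u i) * h f i) * (1 + η) ^ k := by
    intro k
    induction k with
    | zero => exact fun v hv hvW hvc => ⟨v, hv, hvW, hvc, by simp⟩
    | succ k ih =>
      intro v hv hvW hvc
      have hpn : 0 ≤ potential lam (fun f => ∑ i, (v i - u i) * h f i) :=
        sum_nonneg fun f _ => by positivity
      by_cases hle : (univ.filter fun i => v i ≠ 0).card ≤ s
      · refine ⟨v, hv, hvW, hle, ?_⟩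
        exact le_mul_of_one_le_right hpn (one_le_pow₀ (by linarith))
      · obtain ⟨v', hv', hvW', hss, hpot⟩ := exists_elimination d r s hr hs x hx α hα β h hh W hW
          v hv hvW (not_le.1 hle) hcard lam hlam0.le hlc1 u
        obtain ⟨u', h1, h2, h3, h4⟩ := ih v' hv' hvW' (by have := card_lt_card hss; omega)
        refine ⟨u', h1, h2, h3, h4.trans ?_⟩
        rw [pow_succ', ← mul_assoc]
        gcongr
  obtain ⟨u', h1, h2, h3, h4⟩ := hiter s u hu rfl (by
    refine (card_le_univ _).trans (hcard.trans (by omega)))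
  refine ⟨u', h1, h2, h3, fun f => ?_⟩
  have hNpos : (0 : ℝ) < Fintype.card F := by exact_mod_cast Fintype.card_pos
  have h5 : potential lam (fun f => ∑ i, (u' i - u i) * h f i)
      ≤ 2 * Fintype.card F * Real.exp (3 * (d + 1) * Real.log (2 * s)) := by
    refine h4.trans ?_
    have e1 : potential lam (fun f => ∑ i, (u i - u i) * h f i) = 2 * Fintype.card F := by
      simp [potential]; ring
    rw [e1, ← hη1, mul_comm (s : ℝ) η, Real.exp_mul, Real.rpow_natCast]
    gcongr
    linarith [Real.add_one_le_exp η]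
  set D := ∑ i, (u' i - u i) * h f i with hD
  have h6 : Real.exp (lam * |D|) ≤ 2 * Fintype.card F * Real.exp (3 * (d + 1) * Real.log (2 * s)) := by
    refine le_trans ?_ h5
    refine le_trans ?_ (single_le_sum (f := fun f => Real.exp (lam * ∑ i, (u' i - u i) * h f i)
      + Real.exp (-(lam * ∑ i, (u' i - u i) * h f i))) (fun f _ => by positivity) (mem_univ f))
    rw [← hD]
    have p1 := Real.exp_pos (lam * D)
    have p2 := Real.exp_pos (-(lam * D))
    rcases abs_cases D with ⟨ha, -⟩ | ⟨ha, -⟩ <;> rw [ha]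
    · linarith
    · rw [mul_neg]; linarith
  have h7 : lam * |D| ≤ Real.log (2 * Fintype.card F) + 3 * (d + 1) * Real.log (2 * s) := by
    have := Real.log_le_log (Real.exp_pos _) h6
    rwa [Real.log_exp, Real.log_mul (by positivity) (Real.exp_pos _).ne', Real.log_exp] at this
  have h8 : |D| ≤ (Real.log (2 * Fintype.card F) + 3 * (d + 1) * Real.log (2 * s)) / lam := by
    rw [le_div_iff₀ hlam0]; linarith
  refine h8.trans (le_of_eq ?_)
  rw [hlam]
  field_simp

end HingeCoreset

/-! ### Exact integer semantics, word length and rules for total correctness -/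

namespace StreamRAM

open Finset

/-- Value of an expression without truncation to words. -/
def Expr.val (M : ℤ → ℤ) : Expr → ℤ
  | .const z => z
  | .load a => M (a.val M)
  | .add a b => a.val M + b.val M
  | .sub a b => a.val M - b.val M
  | .mul a b => a.val M * b.val M
  | .div a b => a.val M / b.val M
  | .lt a b => if a.val M < b.val M then 1 else 0

/-- Bound for all intermediate results, if the memory holds numbers of absolute value `≤ β`. -/
def Expr.mag (β : ℕ) : Expr → ℕ
  | .const z => z.natAbs + 1
  | .load a => β + a.mag β
  | .add a b => a.mag β + b.mag β
  | .sub a b => a.mag β + b.mag β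
  | .mul a b => a.mag β * b.mag β
  | .div a b => a.mag β + b.mag β
  | .lt a b => a.mag β + b.mag β

/-- Bound for all intermediate results of a program. -/
def Program.mag (β : ℕ) : Program → ℕ
  | .skip => 0
  | .store a e => a.mag β + e.mag β
  | .read a => a.mag β
  | .draw a => a.mag β
  | .seq P Q => P.mag β + Q.mag β
  | .cond e P Q => e.mag β + P.mag β + Q.mag β
  | .loop e P => e.mag β + P.mag β

/-- Ensures that the bound of a product is also a bound for each factor. -/
lemma Expr.one_le_mag (β : ℕ) (e : Expr) : 1 ≤ e.mag β := by
  induction e with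
  | const z => simp [Expr.mag]
  | load a ih => simp only [Expr.mag]; omega
  | add a b iha ihb => simp only [Expr.mag]; omega
  | sub a b iha ihb => simp only [Expr.mag]; omega
  | mul a b iha ihb => simp only [Expr.mag]; exact Nat.mul_pos iha ihb
  | div a b iha ihb => simp only [Expr.mag]; omega
  | lt a b iha ihb => simp only [Expr.mag]; omega

lemma word_eq_self {L : ℕ} (hL : 1 ≤ L) {z : ℤ} (hz : |z| < 2 ^ (L - 1)) : word L z = z := by
  obtain ⟨k, rfl⟩ : ∃ k, L = k + 1 := ⟨L - 1, by omega⟩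
  simp only [Nat.add_sub_cancel] at hz
  rw [abs_lt] at hz
  unfold word
  apply Int.bmod_eq_of_le_mul_two <;> push_cast [pow_succ] <;> omega

lemma Expr.eval_eq_val {L β : ℕ} (hL : 1 ≤ L) {M : ℤ → ℤ} (hM : ∀ a, |M a| ≤ β) (e : Expr)
    (he : e.mag β < 2 ^ (L - 1)) : e.eval L M = e.val M ∧ |e.val M| ≤ e.mag β := by
  have hX : ∀ {m : ℕ} {z : ℤ}, m < 2 ^ (L - 1) → |z| ≤ m → word L z = z := fun h1 h2 =>
    word_eq_self hL (lt_of_le_of_lt h2 (by exact_mod_cast h1))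
  induction e with
  | const z =>
    have : |z| ≤ ((z.natAbs + 1 : ℕ) : ℤ) := by push_cast; linarith
    exact ⟨hX he this, this⟩
  | load a ih =>
    simp only [Expr.mag] at he ⊢
    obtain ⟨h1, h2⟩ := ih (by omega)
    refine ⟨by simp [Expr.eval, Expr.val, h1], ?_⟩
    have := hM (a.val M)
    simp only [Expr.val]
    push_cast
    omega
  | add a b iha ihb =>
    simp only [Expr.mag] at he ⊢
    obtain ⟨h1, h2⟩ := iha (by omega)
    obtain ⟨h3, h4⟩ := ihb (by omega)
    have : |a.val M + b.val M| ≤ ((a.mag β + b.mag β : ℕ) : ℤ) := by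
      push_cast; exact (abs_add_le _ _).trans (add_le_add h2 h4)
    exact ⟨by simp only [Expr.eval, Expr.val, h1, h3]; exact hX he this, this⟩
  | sub a b iha ihb =>
    simp only [Expr.mag] at he ⊢
    obtain ⟨h1, h2⟩ := iha (by omega)
    obtain ⟨h3, h4⟩ := ihb (by omega)
    have : |a.val M - b.val M| ≤ ((a.mag β + b.mag β : ℕ) : ℤ) := by
      push_cast; exact (abs_sub _ _).trans (add_le_add h2 h4)
    exact ⟨by simp only [Expr.eval, Expr.val, h1, h3]; exact hX he this, this⟩
  | mul a b iha ihb =>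
    simp only [Expr.mag] at he ⊢
    have ha := a.one_le_mag β
    have hb := b.one_le_mag β
    obtain ⟨h1, h2⟩ := iha (lt_of_le_of_lt (Nat.le_mul_of_pos_right _ hb) he)
    obtain ⟨h3, h4⟩ := ihb (lt_of_le_of_lt (Nat.le_mul_of_pos_left _ ha) he)
    have : |a.val M * b.val M| ≤ ((a.mag β * b.mag β : ℕ) : ℤ) := by
      push_cast; rw [abs_mul]; exact mul_le_mul h2 h4 (abs_nonneg _) (by positivity)
    exact ⟨by simp only [Expr.eval, Expr.val, h1, h3]; exact hX he this, this⟩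
  | div a b iha ihb =>
    simp only [Expr.mag] at he ⊢
    obtain ⟨h1, h2⟩ := iha (by omega)
    obtain ⟨h3, h4⟩ := ihb (by omega)
    have : |a.val M / b.val M| ≤ ((a.mag β + b.mag β : ℕ) : ℤ) := by
      have := Int.abs_ediv_le_abs (a.val M) (b.val M)
      push_cast; omega
    exact ⟨by simp only [Expr.eval, Expr.val, h1, h3]; exact hX he this, this⟩
  | lt a b iha ihb =>
    simp only [Expr.mag] at he ⊢
    have ha := a.one_le_mag β
    have hb := b.one_le_mag β
    obtain ⟨h1, h2⟩ := iha (by omega)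
    obtain ⟨h3, h4⟩ := ihb (by omega)
    have h5 : word L 1 = 1 := hX (m := 1) (by omega) (by simp)
    refine ⟨by simp only [Expr.eval, Expr.val, h1, h3, h5], ?_⟩
    simp only [Expr.val]
    split_ifs <;> simp <;> omega

/-- Growth is polynomial in `β`, so for a fixed expression a word length that is a constant multiple
of `log β` is enough. -/
lemma Expr.exists_mag_le (e : Expr) : ∃ D, ∀ β, 2 ≤ β → e.mag β ≤ β ^ D := by
  have hadd : ∀ {D D' β x y : ℕ}, 2 ≤ β → x ≤ β ^ D → y ≤ β ^ D' → x + y ≤ β ^ (D + D' + 1) := by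
    intro D D' β x y hβ hx hy
    have h1 : β ^ D ≤ β ^ (D + D') := Nat.pow_le_pow_right (by omega) (by omega)
    have h2 : β ^ D' ≤ β ^ (D + D') := Nat.pow_le_pow_right (by omega) (by omega)
    have h3 : β ^ (D + D') * 2 ≤ β ^ (D + D') * β := Nat.mul_le_mul_left _ hβ
    rw [pow_succ]
    omega
  induction e with
  | const z => exact ⟨z.natAbs + 1, fun β hβ => (Nat.lt_pow_self (by omega)).le⟩
  | load a ih => obtain ⟨D, h⟩ := ih; exact ⟨_, fun β hβ => hadd (D := 1) hβ (by simp) (h β hβ)⟩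
  | add a b iha ihb =>
    obtain ⟨D, h⟩ := iha; obtain ⟨D', h'⟩ := ihb
    exact ⟨_, fun β hβ => hadd hβ (h β hβ) (h' β hβ)⟩
  | sub a b iha ihb =>
    obtain ⟨D, h⟩ := iha; obtain ⟨D', h'⟩ := ihb
    exact ⟨_, fun β hβ => hadd hβ (h β hβ) (h' β hβ)⟩
  | mul a b iha ihb =>
    obtain ⟨D, h⟩ := iha; obtain ⟨D', h'⟩ := ihb
    exact ⟨D + D', fun β hβ => by rw [pow_add]; exact Nat.mul_le_mul (h β hβ) (h' β hβ)⟩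
  | div a b iha ihb =>
    obtain ⟨D, h⟩ := iha; obtain ⟨D', h'⟩ := ihb
    exact ⟨_, fun β hβ => hadd hβ (h β hβ) (h' β hβ)⟩
  | lt a b iha ihb =>
    obtain ⟨D, h⟩ := iha; obtain ⟨D', h'⟩ := ihb
    exact ⟨_, fun β hβ => hadd hβ (h β hβ) (h' β hβ)⟩

lemma Program.exists_mag_le (P : Program) : ∃ D, ∀ β, 2 ≤ β → P.mag β ≤ β ^ D := by
  have hadd : ∀ {D D' β x y : ℕ}, 2 ≤ β → x ≤ β ^ D → y ≤ β ^ D' → x + y ≤ β ^ (D + D' + 1) := by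
    intro D D' β x y hβ hx hy
    have h1 : β ^ D ≤ β ^ (D + D') := Nat.pow_le_pow_right (by omega) (by omega)
    have h2 : β ^ D' ≤ β ^ (D + D') := Nat.pow_le_pow_right (by omega) (by omega)
    have h3 : β ^ (D + D') * 2 ≤ β ^ (D + D') * β := Nat.mul_le_mul_left _ hβ
    rw [pow_succ]
    omega
  induction P with
  | skip => exact ⟨0, fun β _ => by simp [Program.mag]⟩
  | store a e =>
    obtain ⟨D, h⟩ := a.exists_mag_le; obtain ⟨D', h'⟩ := e.exists_mag_le
    exact ⟨_, fun β hβ => hadd hβ (h β hβ) (h' β hβ)⟩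
  | read a => exact a.exists_mag_le
  | draw a => exact a.exists_mag_le
  | seq P Q ihP ihQ =>
    obtain ⟨D, h⟩ := ihP; obtain ⟨D', h'⟩ := ihQ
    exact ⟨_, fun β hβ => hadd hβ (h β hβ) (h' β hβ)⟩
  | cond e P Q ihP ihQ =>
    obtain ⟨D, h⟩ := ihP; obtain ⟨D', h'⟩ := ihQ; obtain ⟨D₀, h₀⟩ := e.exists_mag_le
    exact ⟨_, fun β hβ => hadd hβ (hadd hβ (h₀ β hβ) (h β hβ)) (h' β hβ)⟩
  | loop e P ihP =>
    obtain ⟨D, h⟩ := ihP; obtain ⟨D₀, h₀⟩ := e.exists_mag_le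
    exact ⟨_, fun β hβ => hadd hβ (h₀ β hβ) (h β hβ)⟩

/-- The memory cell with fixed address `k`. -/
abbrev reg (k : ℤ) : Expr := .load (.const k)

/-- Draw a random number between `0` and the number in cell `7` into cell `9`. -/
def drawMod : Program :=
  .seq (.draw (.const 9)) (.store (.const 9) (.sub (reg 9) (.mul (reg 7) (.div (reg 9) (reg 7)))))

/-- Execution in exact integer arithmetic, in which all stores are to existing cells and all stored
numbers have absolute value at most `β`. -/
inductive IExec (β S : ℕ) {L : ℕ} (ω : Tape L) : Program → Config → Config → Prop where
  | skip (c : Config) : IExec β S ω .skip c c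
  | store (a e : Expr) (c : Config) (h0 : 0 ≤ a.val c.mem) (hS : a.val c.mem < S)
      (hβ : |e.val c.mem| ≤ β) :
      IExec β S ω (.store a e) c
        { c with mem := Function.update c.mem (a.val c.mem) (e.val c.mem) }
  | read (a : Expr) (c : Config) (h0 : 0 ≤ a.val c.mem) (hS : a.val c.mem < S)
      (hβ : |c.input.headD 0| ≤ β) :
      IExec β S ω (.read a) c
        { c with
          mem := Function.update c.mem (a.val c.mem) (c.input.headD 0)
          input := c.input.tail }
  | drawMod (c : Config) (k : ℕ) (hk : c.mem 7 = 2 ^ k) (hS : 9 < S) :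
      IExec β S ω drawMod c
        { c with
          mem := Function.update c.mem 9 (((ω c.drawn : ℕ) : ℤ) % c.mem 7)
          drawn := c.drawn + 1 }
  | seq {P Q : Program} {c c' c'' : Config} :
      IExec β S ω P c c' → IExec β S ω Q c' c'' → IExec β S ω (.seq P Q) c c''
  | cond_true {e : Expr} {P Q : Program} {c c' : Config} :
      e.val c.mem ≠ 0 → IExec β S ω P c c' → IExec β S ω (.cond e P Q) c c'
  | cond_false {e : Expr} {P Q : Program} {c c' : Config} :
      e.val c.mem = 0 → IExec β S ω Q c c' → IExec β S ω (.cond e P Q) c c'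
  | loop_true {e : Expr} {P : Program} {c c' c'' : Config} :
      e.val c.mem ≠ 0 → IExec β S ω P c c' → IExec β S ω (.loop e P) c' c'' →
        IExec β S ω (.loop e P) c c''
  | loop_false {e : Expr} {P : Program} {c : Config} :
      e.val c.mem = 0 → IExec β S ω (.loop e P) c c

lemma abs_update_le {M : ℤ → ℤ} {β : ℕ} (hM : ∀ a, |M a| ≤ β) {a v : ℤ} (hv : |v| ≤ β) :
    ∀ a', |Function.update M a v a'| ≤ β := by
  intro a'
  rw [Function.update_apply]
  split_ifs
  · exact hv
  · exact hM a'

/-- A raw random word may exceed `β`; this is why `IExec` treats drawing and reducing as a unit. The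
modulus is a power of two that divides `2 ^ L`, hence neither the sign convention nor truncation
affects the residue. -/
lemma exec_drawMod {L S β : ℕ} {ω : Tape L} (hL : 1 ≤ L) (c : Config) (k : ℕ)
    (hk : c.mem 7 = 2 ^ k) (hS : 9 < S) (hmag : drawMod.mag β < 2 ^ (L - 1))
    (hM : ∀ a, |c.mem a| ≤ β) :
    Exec L S ω drawMod c
        { c with
          mem := Function.update c.mem 9 (((ω c.drawn : ℕ) : ℤ) % c.mem 7)
          drawn := c.drawn + 1 } := by
  have hc : ∀ z : ℤ, |z| ≤ 10 → word L z = z := by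
    intro z hz
    refine word_eq_self hL (lt_of_le_of_lt hz ?_)
    have : (10 : ℕ) < 2 ^ (L - 1) := by
      refine lt_of_le_of_lt ?_ hmag
      simp [drawMod, Program.mag, Expr.mag]
    exact_mod_cast this
  have h9 : word L 9 = 9 := hc 9 (by norm_num)
  have h7 : word L 7 = 7 := hc 7 (by norm_num)
  have hS' : (9 : ℤ) < S := by exact_mod_cast hS
  set r0 := word L ((ω c.drawn : ℕ) : ℤ) with hr0
  have hpow : (0 : ℕ) < 2 ^ L := by positivity
  have e1 := Exec.draw (L := L) (S := S) (ω := ω) (.const 9) c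
  have e2 := Exec.store (L := L) (S := S) (ω := ω) (.const 9)
    (.sub (reg 9) (.mul (reg 7) (.div (reg 9) (reg 7))))
    { c with
          mem := write S c.mem ((Expr.const 9).eval L c.mem) (word L ((ω c.drawn : ℕ) : ℤ))
          drawn := c.drawn + 1 }
  have hX : (0 : ℤ) < 2 ^ L := by positivity
  have hcong : ∀ z : ℤ, (2 : ℤ) ^ L ∣ z - word L z := fun z => by
    have := Int.dvd_self_sub_bmod (x := z) (m := 2 ^ L)
    push_cast at this
    exact this
  have hrange : ∀ z : ℤ, -(2 ^ L : ℤ) ≤ word L z * 2 ∧ word L z * 2 < 2 ^ L := fun z => by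
    have h1 := Int.le_bmod (x := z) hpow
    have h2 := Int.bmod_lt (x := z) hpow
    unfold word
    push_cast at h1 h2
    omega
  have hword : ∀ z : ℤ, -(2 ^ L : ℤ) ≤ z * 2 → z * 2 < 2 ^ L → word L z = z := fun z h1 h2 => by
    unfold word
    apply Int.bmod_eq_of_le_mul_two <;> push_cast <;> omega
  have hkL : (2 : ℤ) ^ (k + 1) ∣ 2 ^ L := by
    refine pow_dvd_pow 2 ?_
    have b1 := hM 7
    rw [hk, abs_of_pos (by positivity)] at b1
    have b2 : 2 ^ k ≤ β := by exact_mod_cast b1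
    have b3 : β < 2 ^ (L - 1) := by
      refine lt_of_le_of_lt ?_ hmag
      simp [drawMod, Program.mag, Expr.mag]
      omega
    have := (Nat.pow_lt_pow_iff_right (a := 2) (by norm_num)).1 (b2.trans_lt b3)
    omega
  have hkp : (1 : ℤ) ≤ 2 ^ k := one_le_pow₀ (by norm_num)
  have hq : word L (r0 / 2 ^ k) = r0 / 2 ^ k := by
    obtain ⟨a1, a2⟩ := hrange (ω c.drawn : ℕ)
    rw [← hr0] at a1 a2
    rcases le_or_gt 0 r0 with h0 | h0
    · have b1 : 0 ≤ r0 / 2 ^ k := Int.ediv_nonneg h0 (by omega)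
      have b2 : r0 / 2 ^ k ≤ r0 := Int.ediv_le_self _ h0
      exact hword _ (by omega) (by omega)
    · have b1 : r0 / 2 ^ k < 0 := Int.ediv_neg_of_neg_of_pos h0 (by omega)
      have b2 : r0 ≤ r0 / 2 ^ k := by
        rw [Int.le_ediv_iff_mul_le (by omega)]
        nlinarith
      exact hword _ (by omega) (by omega)
  have hmod : ((ω c.drawn : ℕ) : ℤ) % 2 ^ k = r0 % 2 ^ k :=
    Int.emod_eq_emod_iff_emod_sub_eq_zero.2 (Int.emod_eq_zero_of_dvd
      ((pow_dvd_pow 2 k.le_succ).trans (hkL.trans (hcong _))))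
  have hval : word L (r0 - word L (2 ^ k * (r0 / 2 ^ k))) = r0 % 2 ^ k := by
    have b1 := Int.emod_nonneg r0 (b := 2 ^ k) (by omega)
    have b2 := Int.emod_lt_of_pos r0 (b := 2 ^ k) (by omega)
    have b3 := Int.mul_ediv_add_emod r0 (2 ^ k)
    have b4 : (2 : ℤ) ^ (k + 1) ≤ 2 ^ L := Int.le_of_dvd hX hkL
    rw [pow_succ] at b4
    have b5 : word L (r0 % 2 ^ k) = r0 % 2 ^ k := hword _ (by omega) (by omega)
    rw [← b5]
    unfold word
    rw [Int.sub_bmod_bmod]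
    congr 1
    omega
  have h3 := Exec.seq e1 e2
  simp only [Expr.eval, h9, h7, write] at h3
  rw [if_pos ⟨by norm_num, hS'⟩, if_pos ⟨by norm_num, hS'⟩] at h3
  rw [Function.update_idem, Function.update_self, Function.update_of_ne (by norm_num), hk, ← hr0,
    hq, hval, ← hmod] at h3
  rw [hk]
  exact h3

/-- All cells stay within `β`, so every evaluated expression stays below `2 ^ (L - 1)` and
truncation never acts. -/
theorem IExec.exec {L S β : ℕ} {ω : Tape L} (hL : 1 ≤ L) {P : Program} {c c' : Config}
    (h : IExec β S ω P c c') (hβL : β < 2 ^ (L - 1))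
    (hmag : P.mag β < 2 ^ (L - 1)) (hM : ∀ a, |c.mem a| ≤ β) :
    Exec L S ω P c c' ∧ ∀ a, |c'.mem a| ≤ β := by
  have hβw : ∀ z : ℤ, |z| ≤ β → word L z = z := fun z h1 =>
    word_eq_self hL (lt_of_le_of_lt h1 (by exact_mod_cast hβL))
  induction h with
  | skip c => exact ⟨.skip c, hM⟩
  | store a e c h0 hS hβ =>
    simp only [Program.mag] at hmag
    have ha := (Expr.eval_eq_val hL hM a (by omega)).1
    have he := (Expr.eval_eq_val hL hM e (by omega)).1
    refine ⟨?_, abs_update_le hM hβ⟩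
    have := Exec.store (L := L) (S := S) (ω := ω) a e c
    rwa [ha, he, write, if_pos ⟨h0, hS⟩] at this
  | read a c h0 hS hβ =>
    simp only [Program.mag] at hmag
    have ha := (Expr.eval_eq_val hL hM a hmag).1
    refine ⟨?_, abs_update_le hM hβ⟩
    have := Exec.read (L := L) (S := S) (ω := ω) a c
    rwa [ha, write, if_pos ⟨h0, hS⟩, hβw _ hβ] at this
  | drawMod c k hk hS =>
    refine ⟨exec_drawMod hL c k hk hS hmag hM, abs_update_le hM ?_⟩
    have h7 := hM 7
    have hp : 0 < c.mem 7 := by rw [hk]; positivity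
    rw [abs_of_pos hp] at h7
    rw [abs_of_nonneg (Int.emod_nonneg _ hp.ne')]
    exact (Int.emod_lt_of_pos _ hp).le.trans h7
  | seq _ _ ih1 ih2 =>
    simp only [Program.mag] at hmag
    obtain ⟨e1, m1⟩ := ih1 (by omega) hM
    obtain ⟨e2, m2⟩ := ih2 (by omega) m1
    exact ⟨.seq e1 e2, m2⟩
  | cond_true he _ ih =>
    simp only [Program.mag] at hmag
    obtain ⟨e1, m1⟩ := ih (by omega) hM
    exact ⟨.cond_true (by rwa [(Expr.eval_eq_val hL hM _ (by omega)).1]) e1, m1⟩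
  | cond_false he _ ih =>
    simp only [Program.mag] at hmag
    obtain ⟨e1, m1⟩ := ih (by omega) hM
    exact ⟨.cond_false (by rwa [(Expr.eval_eq_val hL hM _ (by omega)).1]) e1, m1⟩
  | loop_true he _ _ ih1 ih2 =>
    have hmag' := hmag
    simp only [Program.mag] at hmag'
    obtain ⟨e1, m1⟩ := ih1 (by omega) hM
    obtain ⟨e2, m2⟩ := ih2 hmag m1
    exact ⟨.loop_true (by rwa [(Expr.eval_eq_val hL hM _ (by omega)).1]) e1 e2, m2⟩
  | loop_false he =>
    simp only [Program.mag] at hmag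
    exact ⟨.loop_false (by rwa [(Expr.eval_eq_val hL hM _ (by omega)).1]), hM⟩

/-- Executions are deterministic. -/
theorem Exec.unique {L S : ℕ} {ω : Tape L} {P : Program} {c c₁ c₂ : Config}
    (h₁ : Exec L S ω P c c₁) (h₂ : Exec L S ω P c c₂) : c₁ = c₂ := by
  induction h₁ generalizing c₂ with
  | skip c => cases h₂; rfl
  | store a e c => cases h₂; rfl
  | read a c => cases h₂; rfl
  | draw a c => cases h₂; rfl
  | seq _ _ ih1 ih2 =>
    cases h₂ with
    | seq e1 e2 => obtain rfl := ih1 e1; exact ih2 e2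
  | cond_true he _ ih =>
    cases h₂ with
    | cond_true _ e1 => exact ih e1
    | cond_false hn _ => exact absurd hn he
  | cond_false he _ ih =>
    cases h₂ with
    | cond_true hn _ => exact absurd he hn
    | cond_false _ e1 => exact ih e1
  | loop_true he _ _ ih1 ih2 =>
    cases h₂ with
    | loop_true _ e1 e2 => obtain rfl := ih1 e1; exact ih2 e2
    | loop_false hn => exact absurd hn he
  | loop_false he =>
    cases h₂ with
    | loop_true hn _ _ => exact absurd he hn
    | loop_false _ => rfl

/-- `WP β S ω P Q c`: started in `c`, the program `P` halts in a configuration that satisfies `Q`. -/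
def WP (β S : ℕ) {L : ℕ} (ω : Tape L) (P : Program) (Q : Config → Prop) (c : Config) : Prop :=
  ∃ c', IExec β S ω P c c' ∧ Q c'

section WP

variable {β S L : ℕ} {ω : Tape L} {P P' : Program} {Q Q' : Config → Prop} {c : Config} {a e : Expr}

lemma WP.mono (h : WP β S ω P Q c) (hQ : ∀ c, Q c → Q' c) : WP β S ω P Q' c := by
  obtain ⟨c', h1, h2⟩ := h
  exact ⟨c', h1, hQ _ h2⟩

lemma wp_skip (h : Q c) : WP β S ω .skip Q c := ⟨c, .skip c, h⟩

lemma wp_store (h0 : 0 ≤ a.val c.mem) (hS : a.val c.mem < S) (hβ : |e.val c.mem| ≤ β)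
    (h : Q { c with mem := Function.update c.mem (a.val c.mem) (e.val c.mem) }) :
    WP β S ω (.store a e) Q c := ⟨_, .store a e c h0 hS hβ, h⟩

lemma wp_read (h0 : 0 ≤ a.val c.mem) (hS : a.val c.mem < S) (hβ : |c.input.headD 0| ≤ β)
    (h : Q { c with
              mem := Function.update c.mem (a.val c.mem) (c.input.headD 0)
              input := c.input.tail }) :
    WP β S ω (.read a) Q c := ⟨_, .read a c h0 hS hβ, h⟩

lemma wp_seq (h : WP β S ω P (WP β S ω P' Q) c) : WP β S ω (.seq P P') Q c := by
  obtain ⟨c1, h1, c2, h2, h3⟩ := h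
  exact ⟨c2, .seq h1 h2, h3⟩

lemma wp_cond (ht : e.val c.mem ≠ 0 → WP β S ω P Q c) (hf : e.val c.mem = 0 → WP β S ω P' Q c) :
    WP β S ω (.cond e P P') Q c := by
  by_cases h : e.val c.mem = 0
  · obtain ⟨c1, h1, h2⟩ := hf h
    exact ⟨c1, .cond_false h h1, h2⟩
  · obtain ⟨c1, h1, h2⟩ := ht h
    exact ⟨c1, .cond_true h h1, h2⟩

/-- Total correctness of a loop from an invariant and a variant. -/
lemma wp_loop (Inv : Config → Prop) (V : Config → ℕ) (h0 : Inv c)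
    (hstep : ∀ c, Inv c → e.val c.mem ≠ 0 → WP β S ω P (fun c' => Inv c' ∧ V c' < V c) c)
    (hend : ∀ c, Inv c → e.val c.mem = 0 → Q c) : WP β S ω (.loop e P) Q c := by
  induction hn : V c using Nat.strong_induction_on generalizing c with
  | _ n ih =>
    by_cases he : e.val c.mem = 0
    · exact ⟨c, .loop_false he, hend c h0 he⟩
    · obtain ⟨c1, h1, h2, h3⟩ := hstep c h0 he
      obtain ⟨c2, h4, h5⟩ := ih (V c1) (by omega) h2 rfl
      exact ⟨c2, .loop_true he h1 h4, h5⟩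

/-- Total correctness of a loop with `N` rounds. -/
lemma wp_count (Inv : ℕ → Config → Prop) (N : ℕ) (h0 : Inv 0 c)
    (hstep : ∀ i < N, ∀ c, Inv i c → e.val c.mem ≠ 0 ∧ WP β S ω P (Inv (i + 1)) c)
    (hend : ∀ c, Inv N c → e.val c.mem = 0 ∧ Q c) : WP β S ω (.loop e P) Q c := by
  have key : ∀ k i, i + k = N → ∀ c, Inv i c → WP β S ω (.loop e P) Q c := by
    intro k
    induction k with
    | zero =>
      intro i hi c hc
      obtain ⟨h1, h2⟩ := hend c (by rwa [← hi, add_zero])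
      exact ⟨c, .loop_false h1, h2⟩
    | succ k ih =>
      intro i hi c hc
      obtain ⟨he, c1, h1, h2⟩ := hstep i (by omega) c hc
      obtain ⟨c2, h3, h4⟩ := ih (i + 1) (by omega) c1 h2
      exact ⟨c2, .loop_true he h1 h3, h4⟩
  exact key N 0 (by omega) c h0

end WP

section MP

variable {β S L : ℕ} {ω : Tape L} {P P' : Program} {Q Q' : (ℤ → ℤ) → Prop} {M : ℤ → ℤ}
  {a e : Expr}

/-- Total correctness of a program that neither reads the input nor draws random words. -/
def MP (β S : ℕ) {L : ℕ} (ω : Tape L) (P : Program) (Q : (ℤ → ℤ) → Prop) (M : ℤ → ℤ) : Prop :=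
  ∀ inp k, WP β S ω P (fun c => c.input = inp ∧ c.drawn = k ∧ Q c.mem) ⟨M, inp, k⟩

lemma MP.mono (h : MP β S ω P Q M) (hQ : ∀ M, Q M → Q' M) : MP β S ω P Q' M :=
  fun inp k => (h inp k).mono fun _ ⟨h1, h2, h3⟩ => ⟨h1, h2, hQ _ h3⟩

lemma mp_skip (h : Q M) : MP β S ω .skip Q M := fun _ _ => wp_skip ⟨rfl, rfl, h⟩

lemma mp_store {i v : ℤ} (ha : a.val M = i) (he : e.val M = v) (h0 : 0 ≤ i) (hS : i < S)
    (hβ : |v| ≤ β) (h : Q (Function.update M i v)) : MP β S ω (.store a e) Q M := by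
  subst ha he
  exact fun _ _ => wp_store h0 hS hβ ⟨rfl, rfl, h⟩

lemma mp_reg {i v : ℤ} (he : e.val M = v) (hi : 0 ≤ i ∧ i < 25) (hS : 25 ≤ S)
    (hβ : |v| ≤ β) (h : Q (Function.update M i v)) : MP β S ω (.store (.const i) e) Q M :=
  mp_store (i := i) rfl he hi.1 (by have := hi.2; omega) hβ h

lemma mp_seq (h : MP β S ω P (MP β S ω P' Q) M) : MP β S ω (.seq P P') Q M := by
  intro inp k
  refine wp_seq ((h inp k).mono ?_)
  rintro ⟨M', inp', k'⟩ ⟨rfl, rfl, h'⟩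
  exact h' _ _

lemma mp_cond (ht : e.val M ≠ 0 → MP β S ω P Q M) (hf : e.val M = 0 → MP β S ω P' Q M) :
    MP β S ω (.cond e P P') Q M :=
  fun inp k => wp_cond (fun h => ht h inp k) (fun h => hf h inp k)

lemma mp_loop (Inv : (ℤ → ℤ) → Prop) (V : (ℤ → ℤ) → ℕ) (h0 : Inv M)
    (hstep : ∀ M, Inv M → e.val M ≠ 0 → MP β S ω P (fun M' => Inv M' ∧ V M' < V M) M)
    (hend : ∀ M, Inv M → e.val M = 0 → Q M) : MP β S ω (.loop e P) Q M := by
  intro inp k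
  refine wp_loop (fun c => c.input = inp ∧ c.drawn = k ∧ Inv c.mem) (fun c => V c.mem)
    ⟨rfl, rfl, h0⟩ ?_ fun c ⟨h1, h2, h3⟩ he => ⟨h1, h2, hend _ h3 he⟩
  rintro ⟨M', inp', k'⟩ ⟨rfl, rfl, h3⟩ he
  exact (hstep _ h3 he _ _).mono fun c ⟨h4, h5, h6, h7⟩ => ⟨⟨h4, h5, h6⟩, h7⟩

lemma mp_count (Inv : ℕ → (ℤ → ℤ) → Prop) (N : ℕ) (h0 : Inv 0 M)
    (hstep : ∀ i < N, ∀ M, Inv i M → e.val M ≠ 0 ∧ MP β S ω P (Inv (i + 1)) M)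
    (hend : ∀ M, Inv N M → e.val M = 0 ∧ Q M) : MP β S ω (.loop e P) Q M := by
  intro inp k
  refine wp_count (fun i c => c.input = inp ∧ c.drawn = k ∧ Inv i c.mem) N
    ⟨rfl, rfl, h0⟩ ?_ fun c ⟨h1, h2, h3⟩ => ⟨(hend _ h3).1, h1, h2, (hend _ h3).2⟩
  rintro i hi ⟨M', inp', k'⟩ ⟨rfl, rfl, h3⟩
  exact ⟨(hstep i hi _ h3).1, (hstep i hi _ h3).2 _ _⟩

end MP

/-! ### The program -/

/-- Address of coordinate `t` of the `i`-th record. -/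
def adr (d : ℕ) (i t : ℤ) : ℤ := 1 + 24 * ((d : ℤ) + 1) + i * ((d : ℤ) + 1) + t

/-- Cells below `25` serve as registers: `0` number of records, `1` accuracy `E`, `3` stream length,
`4` unit `P`, `5` bit length `Λ`, `6` block size `s`, `7` length of a sampling block, `8` stream
position, `9` random offset, `10` and `11` merge counter and tolerance, `12` test function, `13`
record index, `14` to `16` sums, `17` acceptance flag, `18` number of samples, `19` target of the
compaction. -/
lemma le_adr {d : ℕ} {i t : ℤ} (hi : 0 ≤ i) (ht : 0 ≤ t) : 25 ≤ adr d i t := by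
  unfold adr
  have : 0 ≤ i * ((d : ℤ) + 1) := by positivity
  omega

lemma adr_lt_adr {d : ℕ} {i i' t t' : ℤ} (hi : i < i') (ht : t ≤ d) (ht' : 0 ≤ t') :
    adr d i t < adr d i' t' := by
  unfold adr
  have : (i + 1) * ((d : ℤ) + 1) ≤ i' * ((d : ℤ) + 1) := by gcongr; omega
  linarith

/-- `e ^ k` -/
def powE (e : Expr) : ℕ → Expr
  | 0 => .const 1
  | k + 1 => .mul (powE e k) e

@[simp] lemma val_powE (M : ℤ → ℤ) (e : Expr) (k : ℕ) : (powE e k).val M = e.val M ^ k := by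
  induction k with
  | zero => simp [powE, Expr.val]
  | succ k ih => simp [powE, Expr.val, ih, pow_succ]

/-- Number of values of a coefficient in the net of test functions. -/
def netE (Bc : ℕ) : Expr := .add (.mul (.const (2 * Bc)) (reg 1)) (.const 1)

/-- The `i`-th coefficient of the test function with number `g`. -/
def coef (Bc E : ℕ) (g : ℤ) (i : ℕ) : ℤ :=
  g / (2 * Bc * E + 1) ^ i % (2 * Bc * E + 1) - Bc * E

/-- Integer version of the test function with number `g`. -/
def testFn (d Bc E P : ℕ) (g : ℤ) (z : ℕ → ℤ) : ℤ :=
  max 0 (coef Bc E g d * P - ∑ t ∈ range d, coef Bc E g t * z t)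

/-- There is no remainder operation; the digit is `g / b ^ i - b * (g / b ^ (i + 1))`. -/
def coefE (Bc i : ℕ) : Expr :=
  .sub (.sub (.div (reg 12) (powE (netE Bc) i))
    (.mul (netE Bc) (.div (reg 12) (powE (netE Bc) (i + 1))))) (.mul (.const Bc) (reg 1))

lemma val_coefE {M : ℤ → ℤ} {E : ℕ} {g : ℤ} (h1 : M 1 = E) (h12 : M 12 = g) (Bc i : ℕ) :
    (coefE Bc i).val M = coef Bc E g i := by
  have h0 : (0 : ℤ) ≤ (2 * Bc * E + 1) ^ i := by positivity
  simp only [coefE, coef, Expr.val, netE, val_powE, h1, h12]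
  rw [Int.emod_def, pow_succ, ← Int.ediv_ediv_of_nonneg h0]

/-- Address of the `j`-th of the last `2 * s` records. -/
def recE (d : ℕ) : Expr :=
  .add (.const (1 + 24 * (d + 1)))
    (.mul (.add (.sub (reg 0) (.mul (.const 2) (reg 6))) (reg 13)) (.const (d + 1)))

def dotE (d Bc : ℕ) : ℕ → Expr
  | 0 => .const 0
  | k + 1 => .add (dotE d Bc k) (.mul (coefE Bc k) (.load (.add (recE d) (.const k))))

def affE (d Bc : ℕ) : Expr := .sub (.mul (coefE Bc d) (reg 4)) (dotE d Bc d)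

def testE (d Bc : ℕ) : Expr := .mul (affE d Bc) (.lt (.const 0) (affE d Bc))

/-- Address of the `j`-th digit. -/
def digAdrE (d : ℕ) : Expr :=
  .add (.add (.const (1 + 24 * (d + 1))) (.mul (reg 0) (.const (d + 1)))) (reg 13)

def digE (d : ℕ) : Expr := .load (digAdrE d)

def oldE (d : ℕ) : Expr := .load (.add (recE d) (.const d))

/-- The weight that a digit stands for. -/
def wt (x : ℤ) : ℤ := x - if 0 < x then 1 else 0

def diffE (d : ℕ) : Expr := .sub (.sub (digE d) (.lt (.const 0) (digE d))) (oldE d)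

def twoS : Expr := .mul (.const 2) (reg 6)

def incr (k : ℤ) : Program := .store (.const k) (.add (reg k) (.const 1))

def sumBody (d Bc : ℕ) : Program :=
  .seq (.store (.const 14) (.add (reg 14) (.mul (diffE d) (testE d Bc))))
    (.seq (.store (.const 15) (.add (reg 15) (.lt (.const 0) (digE d))))
      (.seq (.store (.const 16) (.add (reg 16) (diffE d))) (incr 13)))

/-- Besides the tolerance in cell `11` there is an allowance for rounding: each of `s` kept weights
may lose up to `1`, against test functions bounded by `Hc * E * P`. -/
def thresholdE (Hc : ℕ) : Expr :=
  .add (reg 11) (.mul (.mul (.mul (.mul (reg 5) (reg 6)) (.const Hc)) (reg 1)) (reg 4))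

def badE (Hc : ℕ) : Expr :=
  .add (.add (.add (.lt (thresholdE Hc) (.mul (reg 5) (reg 14)))
      (.lt (thresholdE Hc) (.mul (reg 5) (.sub (.const 0) (reg 14)))))
    (.add (.lt (reg 15) (reg 6)) (.lt (reg 6) (reg 15)))) (.lt (.const 0) (reg 16))

def testOne (d Bc Hc : ℕ) : Program :=
  .seq (.store (.const 13) (.const 0)) (.seq (.store (.const 14) (.const 0))
    (.seq (.store (.const 15) (.const 0)) (.seq (.store (.const 16) (.const 0))
      (.seq (.loop (.lt (reg 13) twoS) (sumBody d Bc))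
        (.seq (.cond (badE Hc) (.store (.const 17) (.const 0)) .skip) (incr 12))))))

def check (d Bc Hc : ℕ) : Program :=
  .seq (.store (.const 17) (.const 1)) (.seq (.store (.const 12) (.const 0))
    (.loop (.lt (reg 12) (powE (netE Bc) (d + 1))) (testOne d Bc Hc)))

/-- An odometer in base `v + 2`, least significant digit first. Digit `0` drops a record and digit
`x ≥ 1` keeps it with weight `x - 1`, so that a kept record may have weight `0`. -/
def increment (d : ℕ) : Program :=
  .seq (.store (.const 13) (.const 0))
    (.seq (.loop (.lt (reg 11) (digE d)) (.seq (.store (digAdrE d) (.const 0)) (incr 13)))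
      (.store (digAdrE d) (.add (digE d) (.const 1))))

def clear (d : ℕ) : Program :=
  .seq (.store (.const 13) (.const 0))
    (.loop (.lt (reg 13) twoS) (.seq (.store (digAdrE d) (.const 0)) (incr 13)))

def search (d Bc Hc : ℕ) : Program :=
  .seq (clear d) (.seq (.store (.const 17) (.const 0))
    (.loop (.lt (reg 17) (.const 1)) (.seq (increment d) (check d Bc Hc))))

/-- Address to which the next record that is kept is moved. -/
def dstE (d : ℕ) : Expr :=
  .add (.const (1 + 24 * (d + 1)))
    (.mul (.add (.sub (reg 0) (.mul (.const 2) (reg 6))) (reg 19)) (.const (d + 1)))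

def copyCoords (d : ℕ) : ℕ → Program
  | 0 => .skip
  | k + 1 => .seq (copyCoords d k)
      (.store (.add (dstE d) (.const k)) (.load (.add (recE d) (.const k))))

def compact (d : ℕ) : Program :=
  .seq (.store (.const 13) (.const 0)) (.seq (.store (.const 19) (.const 0))
    (.seq (.loop (.lt (reg 13) twoS)
      (.seq (.cond (.lt (.const 0) (digE d))
        (.seq (copyCoords d d)
          (.seq (.store (.add (dstE d) (.const d)) (.sub (digE d) (.const 1))) (incr 19)))
        .skip) (incr 13)))
      (.store (.const 0) (.sub (reg 0) (reg 6)))))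

/-! ### The reduction step -/

/-- The data of a reduction step: `2 * s` records with coordinates `p` and weights `u`, at the end
of a list of `m` records. -/
structure Red (d : ℕ) where
  (E P Λ s v m : ℕ)
  p : ℕ → ℕ → ℤ
  u : ℕ → ℤ
  le : 2 * s ≤ m

namespace Red

variable {d : ℕ} (X : Red d)

/-- The memory holds the data of the reduction step. -/
structure At (M : ℤ → ℤ) : Prop where
  h0 : M 0 = X.m
  h1 : M 1 = X.E
  h4 : M 4 = X.P
  h5 : M 5 = X.Λ
  h6 : M 6 = X.s
  h11 : M 11 = X.v
  hp : ∀ j < 2 * X.s, ∀ t < d, M (adr d ((X.m - 2 * X.s : ℕ) + (j : ℤ)) t) = X.p j t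
  hu : ∀ j < 2 * X.s, M (adr d ((X.m - 2 * X.s : ℕ) + (j : ℤ)) d) = X.u j

/-- The memory holds the digits `g`. -/
def Dig (g : ℕ → ℤ) (M : ℤ → ℤ) : Prop := ∀ j < 2 * X.s, M (adr d X.m j) = g j

variable {X} {M M' : ℤ → ℤ} {g : ℕ → ℤ}

/-- Frame rule: the working registers from `12` on and the digits behind the last record are free to
change. -/
lemma At.congr (h : X.At M) (hM : ∀ a, (a < 12 ∨ 25 ≤ a ∧ a < adr d X.m 0) → M' a = M a) : X.At M' where
  h0 := by rw [hM 0 (by norm_num), h.h0]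
  h1 := by rw [hM 1 (by norm_num), h.h1]
  h4 := by rw [hM 4 (by norm_num), h.h4]
  h5 := by rw [hM 5 (by norm_num), h.h5]
  h6 := by rw [hM 6 (by norm_num), h.h6]
  h11 := by rw [hM 11 (by norm_num), h.h11]
  hp := fun j hj t ht => by
    have := X.le
    rw [hM _ (Or.inr ⟨le_adr (by omega) (by omega), adr_lt_adr (by omega) (by omega) le_rfl⟩),
      h.hp j hj t ht]
  hu := fun j hj => by
    have := X.le
    rw [hM _ (Or.inr ⟨le_adr (by omega) (by omega), adr_lt_adr (by omega) le_rfl le_rfl⟩), h.hu j hj]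

lemma Dig.congr (h : X.Dig g M) (hM : ∀ a, 25 ≤ a → M' a = M a) : X.Dig g M' := fun j hj => by
  rw [hM _ (le_adr (by omega) (by omega)), h j hj]

lemma At.val_recE (h : X.At M) {j : ℕ} (h13 : M 13 = j) (t : ℤ) :
    (recE d).val M + t = adr d ((X.m - 2 * X.s : ℕ) + (j : ℤ)) t := by
  have := X.le
  simp only [recE, Expr.val, h.h0, h.h6, h13, adr]
  push_cast [this]
  ring

lemma At.val_digAdrE (h : X.At M) {j : ℕ} (h13 : M 13 = j) :
    (digAdrE d).val M = adr d X.m j := by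
  simp only [digAdrE, Expr.val, h.h0, h13, adr]

lemma At.val_digE (h : X.At M) (hg : X.Dig g M) {j : ℕ} (h13 : M 13 = j) (hj : j < 2 * X.s) :
    (digE d).val M = g j := by
  rw [digE, Expr.val, h.val_digAdrE h13, hg j hj]

lemma At.val_oldE (h : X.At M) {j : ℕ} (h13 : M 13 = j) (hj : j < 2 * X.s) :
    (oldE d).val M = X.u j := by
  have : (oldE d).val M = M ((recE d).val M + d) := rfl
  rw [this, h.val_recE h13, h.hu j hj]

lemma At.val_diffE (h : X.At M) (hg : X.Dig g M) {j : ℕ} (h13 : M 13 = j) (hj : j < 2 * X.s) :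
    (diffE d).val M = wt (g j) - X.u j := by
  simp only [diffE, Expr.val, h.val_digE hg h13 hj, h.val_oldE h13 hj, wt]

lemma At.val_testE (h : X.At M) {j : ℕ} (h13 : M 13 = j) (hj : j < 2 * X.s) {k : ℤ}
    (h12 : M 12 = k) (Bc : ℕ) : (testE d Bc).val M = testFn d Bc X.E X.P k (X.p j) := by
  have hdot : ∀ n ≤ d, (dotE d Bc n).val M = ∑ t ∈ range n, coef Bc X.E k t * X.p j t := by
    intro n
    induction n with
    | zero => intro _; rfl
    | succ n ih =>
      intro hn
      have e1 : (dotE d Bc (n + 1)).val M = (dotE d Bc n).val M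
        + (coefE Bc n).val M * M ((recE d).val M + n) := rfl
      rw [e1, ih (by omega), val_coefE h.h1 h12, h.val_recE h13, h.hp j hj n hn, sum_range_succ]
  have haff : (affE d Bc).val M = coef Bc X.E k d * X.P
      - ∑ t ∈ range d, coef Bc X.E k t * X.p j t := by
    simp only [affE, Expr.val, hdot d le_rfl, val_coefE h.h1 h12, h.h4]
  simp only [testE, Expr.val, haff, testFn]
  split_ifs with hlt
  · rw [max_eq_right hlt.le, mul_one]
  · rw [max_eq_left (not_lt.1 hlt), mul_zero]

/-- The acceptance condition for digits `g`. -/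
def Good (X : Red d) (Bc Hc : ℕ) (g : ℕ → ℤ) : Prop :=
  (∀ k < (2 * Bc * X.E + 1) ^ (d + 1),
    X.Λ * |∑ j ∈ range (2 * X.s), (wt (g j) - X.u j) * testFn d Bc X.E X.P k (X.p j)|
      ≤ X.v + X.Λ * X.s * Hc * X.E * X.P) ∧
  ∑ j ∈ range (2 * X.s), (if 0 < g j then 1 else 0) = (X.s : ℤ) ∧
  ∑ j ∈ range (2 * X.s), (wt (g j) - X.u j) ≤ 0

/-- The bounds that guarantee that there is no overflow. -/
structure Bounded (X : Red d) (Bc Hc β S : ℕ) : Prop where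
  hv : X.v + 1 ≤ β
  hs : 2 * X.s ≤ β
  hnet : (2 * Bc * X.E + 1) ^ (d + 1) ≤ β
  hu : ∀ j < 2 * X.s, 0 ≤ X.u j ∧ X.u j ≤ X.v
  hp : ∀ j < 2 * X.s, ∀ t < d, |X.p j t| ≤ β
  hH : ∀ k < (2 * Bc * X.E + 1) ^ (d + 1), ∀ j < 2 * X.s,
    testFn d Bc X.E X.P k (X.p j) ≤ Hc * X.E * X.P
  hacc : 2 * X.s * (X.v * (Hc * X.E * X.P)) ≤ β
  hsum : 2 * X.s * X.v ≤ β
  hm : X.m ≤ β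
  hS : adr d X.m (2 * X.s) ≤ S

lemma testFn_nonneg (d Bc E P : ℕ) (g : ℤ) (z : ℕ → ℤ) : 0 ≤ testFn d Bc E P g z := le_max_left _ _

variable {Bc Hc β S L : ℕ} {ω : Tape L}

lemma Bounded.regs (hb : X.Bounded Bc Hc β S) : 25 ≤ S := by
  have h1 := hb.hS
  have h2 : 25 ≤ adr d X.m (2 * X.s) := le_adr (by omega) (by omega)
  omega

lemma wt_mem {x : ℤ} {v : ℕ} (h0 : 0 ≤ x) (h1 : x ≤ v + 1) : 0 ≤ wt x ∧ wt x ≤ v := by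
  unfold wt
  split_ifs <;> omega

lemma mp_sumLoop (hb : X.Bounded Bc Hc β S) (h : X.At M) (hg : X.Dig g M)
    (hg0 : ∀ j < 2 * X.s, 0 ≤ g j ∧ g j ≤ X.v + 1)
    {k : ℕ} (hk : k < (2 * Bc * X.E + 1) ^ (d + 1)) (h12 : M 12 = k) (h13 : M 13 = 0)
    (h14 : M 14 = 0) (h15 : M 15 = 0) (h16 : M 16 = 0) :
    MP β S ω (.loop (.lt (reg 13) twoS) (sumBody d Bc)) (fun M' =>
      M' 14 = ∑ j ∈ range (2 * X.s), (wt (g j) - X.u j) * testFn d Bc X.E X.P k (X.p j) ∧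
      M' 15 = ∑ j ∈ range (2 * X.s), (if 0 < g j then 1 else 0) ∧
      M' 16 = ∑ j ∈ range (2 * X.s), (wt (g j) - X.u j) ∧
      ∀ a, a < 13 ∨ 16 < a → M' a = M a) M := by
  have hS := hb.regs
  refine mp_count (fun n M' => M' 13 = n ∧
      M' 14 = ∑ j ∈ range n, (wt (g j) - X.u j) * testFn d Bc X.E X.P k (X.p j) ∧
      M' 15 = ∑ j ∈ range n, (if 0 < g j then 1 else 0) ∧
      M' 16 = ∑ j ∈ range n, (wt (g j) - X.u j) ∧
      ∀ a, a < 13 ∨ 16 < a → M' a = M a) (2 * X.s) ⟨by simpa using h13, by simpa using h14,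
        by simpa using h15, by simpa using h16, fun _ _ => rfl⟩ ?_ ?_
  · rintro n hn M' ⟨e13, e14, e15, e16, hfr⟩
    have hat : ∀ M'' : ℤ → ℤ, (∀ a, a < 13 ∨ 16 < a → M'' a = M a) → X.At M'' := fun M'' hM'' =>
      h.congr fun a ha => hM'' a (by omega)
    have hdig : ∀ M'' : ℤ → ℤ, (∀ a, a < 13 ∨ 16 < a → M'' a = M a) → X.Dig g M'' :=
      fun M'' hM'' => hg.congr fun a ha => hM'' a (by omega)
    have habs : ∀ j < 2 * X.s, |wt (g j) - X.u j| ≤ X.v := by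
      intro j hj
      have h1 := wt_mem (hg0 j hj).1 (hg0 j hj).2
      have h2 := hb.hu j hj
      rw [abs_le]; omega
    have habs2 : ∀ j < 2 * X.s, |(wt (g j) - X.u j) * testFn d Bc X.E X.P k (X.p j)|
        ≤ X.v * (Hc * X.E * X.P) := by
      intro j hj
      rw [abs_mul, abs_of_nonneg (testFn_nonneg _ _ _ _ _ _)]
      exact mul_le_mul (habs j hj) (hb.hH k hk j hj) (testFn_nonneg _ _ _ _ _ _) (by positivity)
    -- Cancellation at the end is not enough: the partial sums must fit into words as well, so
    -- absolute values are summed.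
    have hsum : ∀ (f : ℕ → ℤ) (C : ℤ), 0 ≤ C → (∀ j < 2 * X.s, |f j| ≤ C) → 2 * X.s * C ≤ β →
        |∑ j ∈ range n, f j + f n| ≤ β := by
      intro f C hC hf hβ
      rw [← sum_range_succ]
      refine (abs_sum_le_sum_abs _ _).trans ((sum_le_sum fun j hj => hf j ?_).trans ?_)
      · rw [mem_range] at hj; omega
      · rw [sum_const, card_range, nsmul_eq_mul]
        have : ((n + 1 : ℕ) : ℤ) ≤ 2 * X.s := by exact_mod_cast hn
        exact (mul_le_mul_of_nonneg_right this hC).trans hβ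
    have hf1 : ∀ (x y z : ℤ), ∀ a, a < 13 ∨ 16 < a → Function.update (Function.update
        (Function.update M' 14 x) 15 y) 16 z a = M a := by
      intro x y z a ha
      rw [Function.update_of_ne (by omega), Function.update_of_ne (by omega),
        Function.update_of_ne (by omega), hfr a ha]
    have hf2 : ∀ (x y : ℤ), ∀ a, a < 13 ∨ 16 < a → Function.update
        (Function.update M' 14 x) 15 y a = M a := by
      intro x y a ha
      rw [Function.update_of_ne (by omega), Function.update_of_ne (by omega), hfr a ha]
    have hf3 : ∀ (x : ℤ), ∀ a, a < 13 ∨ 16 < a → Function.update M' 14 x a = M a := by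
      intro x a ha
      rw [Function.update_of_ne (by omega), hfr a ha]
    constructor
    · have hn' : (n : ℤ) < 2 * X.s := by exact_mod_cast hn
      simp [Expr.val, twoS, e13, (hat M' hfr).h6, hn']
    · refine mp_seq (mp_reg (v := ∑ j ∈ range n, (wt (g j) - X.u j)
          * testFn d Bc X.E X.P k (X.p j) + (wt (g n) - X.u n) * testFn d Bc X.E X.P k (X.p n))
          ?_ (by norm_num) hS ?_ ?_)
      · simp only [Expr.val, e14, (hat M' hfr).val_diffE (hdig M' hfr) e13 hn,
          (hat M' hfr).val_testE e13 hn (by rw [hfr 12 (by norm_num), h12])]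
      · exact hsum _ (X.v * (Hc * X.E * X.P)) (by positivity) habs2 (by exact_mod_cast hb.hacc)
      set M1 := Function.update M' 14 (∑ j ∈ range n, (wt (g j) - X.u j)
          * testFn d Bc X.E X.P k (X.p j) + (wt (g n) - X.u n) * testFn d Bc X.E X.P k (X.p n))
        with hM1
      have f1 : ∀ a, a < 13 ∨ 16 < a → M1 a = M a := hf3 _
      refine mp_seq (mp_reg (v := ∑ j ∈ range n, (if 0 < g j then 1 else 0)
          + (if 0 < g n then 1 else 0)) ?_ (by norm_num) hS ?_ ?_)
      · simp only [Expr.val, (hat M1 f1).val_digE (hdig M1 f1) (j := n) (by simp [hM1, e13]) hn]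
        simp [hM1, e15]
      · refine hsum _ 1 (by norm_num) (fun j _ => by split_ifs <;> simp) ?_
        rw [mul_one]; exact_mod_cast hb.hs
      set M2 := Function.update M1 15 (∑ j ∈ range n, (if 0 < g j then 1 else 0)
          + (if 0 < g n then 1 else 0)) with hM2
      have f2 : ∀ a, a < 13 ∨ 16 < a → M2 a = M a := hf2 _ _
      refine mp_seq (mp_reg (v := ∑ j ∈ range n, (wt (g j) - X.u j) + (wt (g n) - X.u n))
        ?_ (by norm_num) hS ?_ ?_)
      · simp only [Expr.val, (hat M2 f2).val_diffE (hdig M2 f2) (j := n) (by simp [hM2, hM1, e13]) hn]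
        simp [hM2, hM1, e16]
      · exact hsum _ X.v (by positivity) habs (by exact_mod_cast hb.hsum)
      refine mp_reg (v := (n : ℤ) + 1) ?_ (by norm_num) hS ?_ ?_
      · simp [Expr.val, hM2, hM1, e13]
      · have := hb.hs
        rw [abs_of_nonneg (by positivity)]
        omega
      refine ⟨by simp, ?_, ?_, ?_, fun a ha => ?_⟩
      · simp [hM2, hM1, sum_range_succ]
      · rw [sum_range_succ]; simp [hM2]
      · rw [sum_range_succ]; simp
      · rw [Function.update_of_ne (by omega)]
        exact hf1 _ _ _ a ha
  · rintro M' ⟨e13, e14, e15, e16, hfr⟩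
    refine ⟨?_, e14, e15, e16, hfr⟩
    simp [Expr.val, twoS, e13, hfr 6, h.h6]

end Red

/-- Digits of a number in base `b`. -/
def digit (b N j : ℕ) : ℕ := N / b ^ j % b

lemma digit_lt {b : ℕ} (hb : 0 < b) (N j : ℕ) : digit b N j < b := Nat.mod_lt _ hb

/-- The quotient by `b ^ j` grows by one as long as all lower digits are maximal; from `k + 1` on it
is unchanged. -/
lemma digit_succ {b N k : ℕ} (hb : 2 ≤ b) (hlt : ∀ j < k, digit b N j = b - 1)
    (hk : digit b N k ≠ b - 1) (j : ℕ) :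
    digit b (N + 1) j = if j < k then 0 else if j = k then digit b N k + 1 else digit b N j := by
  have key : ∀ x : ℕ, (x % b = b - 1 → (x + 1) / b = x / b + 1 ∧ (x + 1) % b = 0) ∧
      (x % b ≠ b - 1 → (x + 1) / b = x / b ∧ (x + 1) % b = x % b + 1) := by
    intro x
    have h1 := Nat.div_add_mod x b
    have h2 := Nat.mod_lt x (show 0 < b by omega)
    constructor
    · intro hx
      have h3 : x + 1 = b * (x / b + 1) := by rw [mul_add]; omega
      rw [h3, Nat.mul_div_cancel_left _ (by omega)]
      simp
    · intro hx
      have h3 : x + 1 = (x % b + 1) + b * (x / b) := by omega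
      have h4 : x % b + 1 < b := by omega
      refine ⟨?_, ?_⟩
      · conv_lhs => rw [h3]
        rw [Nat.add_mul_div_left _ _ (by omega), Nat.div_eq_of_lt h4, zero_add]
      · conv_lhs => rw [h3]
        rw [Nat.add_mul_mod_self_left, Nat.mod_eq_of_lt h4]
  have hle : ∀ j ≤ k, (N + 1) / b ^ j = N / b ^ j + 1 := by
    intro j
    induction j with
    | zero => simp
    | succ j ih =>
      intro hj
      rw [pow_succ, ← Nat.div_div_eq_div_mul, ih (by omega), ← Nat.div_div_eq_div_mul]
      exact ((key _).1 (hlt j (by omega))).1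
  have hgt : ∀ i, (N + 1) / b ^ (k + 1 + i) = N / b ^ (k + 1 + i) := by
    intro i
    rw [pow_add, pow_succ, ← Nat.div_div_eq_div_mul, ← Nat.div_div_eq_div_mul, hle k le_rfl,
      ((key _).2 hk).1, Nat.div_div_eq_div_mul, Nat.div_div_eq_div_mul, mul_assoc]
  unfold digit
  split_ifs with h1 h2
  · rw [hle j h1.le]
    exact ((key _).1 (hlt j h1)).2
  · subst h2
    rw [hle j le_rfl]
    exact ((key _).2 hk).2
  · obtain ⟨i, rfl⟩ : ∃ i, j = k + 1 + i := ⟨j - (k + 1), by omega⟩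
    rw [hgt]

/-- If all digits were maximal, `N` would be `b ^ n - 1`. Thus the carry in `increment` stops inside
the digit area. -/
lemma exists_digit_ne {b N n : ℕ} (hb : 2 ≤ b) (hN : N + 1 < b ^ n) :
    ∃ k < n, (∀ j < k, digit b N j = b - 1) ∧ digit b N k ≠ b - 1 := by
  have hex : ∃ k, k < n ∧ digit b N k ≠ b - 1 := by
    by_contra! hcon
    have : ∀ m ≤ n, N % b ^ m = b ^ m - 1 := by
      intro m
      induction m with
      | zero => simp [Nat.mod_one]
      | succ m ih =>
        intro hm
        have h2 := hcon m (by omega)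
        unfold digit at h2
        rw [Nat.mod_pow_succ, ih (by omega), h2, pow_succ]
        have h1 : 1 ≤ b ^ m := Nat.one_le_pow _ _ (by omega)
        have h3 : b ^ m * (b - 1) = b ^ m * b - b ^ m := by rw [Nat.mul_sub, mul_one]
        have h4 : b ^ m * 1 ≤ b ^ m * b := Nat.mul_le_mul_left _ (by omega)
        omega
    have h1 := this n le_rfl
    rw [Nat.mod_eq_of_lt (by omega)] at h1
    omega
  refine ⟨Nat.find hex, (Nat.find_spec hex).1, fun j hj => ?_, (Nat.find_spec hex).2⟩
  have := Nat.find_min hex hj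
  have h2 := (Nat.find_spec hex).1
  by_contra hcon
  exact this ⟨by omega, hcon⟩

lemma exists_digits {b n : ℕ} (g : ℕ → ℕ) (hg : ∀ j < n, g j < b) :
    ∃ N < b ^ n, ∀ j < n, digit b N j = g j := by
  let f : Fin n → Fin b := fun j => ⟨g j, hg j j.2⟩
  refine ⟨finFunctionFinEquiv f, (finFunctionFinEquiv f).2, fun j hj => ?_⟩
  have h1 := finFunctionFinEquiv_symm_apply_val (finFunctionFinEquiv f) ⟨j, hj⟩
  rw [Equiv.symm_apply_apply] at h1
  exact h1.symm

/-! ### Exhaustive search for an acceptable vector of digits -/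

namespace Red

variable {d : ℕ} {X : Red d} {M M' : ℤ → ℤ} {g g' : ℕ → ℤ} {Bc Hc β S L : ℕ} {ω : Tape L}

/-- The acceptance condition for a single test function. -/
def GoodAt (X : Red d) (Bc Hc : ℕ) (g : ℕ → ℤ) (k : ℕ) : Prop :=
  (X.Λ * |∑ j ∈ range (2 * X.s), (wt (g j) - X.u j) * testFn d Bc X.E X.P k (X.p j)|
      ≤ X.v + X.Λ * X.s * Hc * X.E * X.P) ∧
  ∑ j ∈ range (2 * X.s), (if 0 < g j then 1 else 0) = (X.s : ℤ) ∧
  ∑ j ∈ range (2 * X.s), (wt (g j) - X.u j) ≤ 0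

/-- The program tests the two conditions that do not involve `k` together with every test function.
Since there is at least one test function, they are tested at all. -/
lemma good_iff : X.Good Bc Hc g ↔ ∀ k < (2 * Bc * X.E + 1) ^ (d + 1), X.GoodAt Bc Hc g k := by
  constructor
  · rintro ⟨h1, h2, h3⟩ k hk
    exact ⟨h1 k hk, h2, h3⟩
  · intro h
    have h0 := h 0 (by positivity)
    exact ⟨fun k hk => (h k hk).1, h0.2.1, h0.2.2⟩

lemma Good.congr (h : X.Good Bc Hc g) (hg : ∀ j < 2 * X.s, g' j = g j) : X.Good Bc Hc g' := by
  unfold Good at h ⊢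
  have e : ∀ f : ℕ → ℤ → ℤ, ∑ j ∈ range (2 * X.s), f j (g' j) = ∑ j ∈ range (2 * X.s), f j (g j) :=
    fun f => sum_congr rfl fun j hj => by rw [hg j (mem_range.1 hj)]
  rw [e fun j x => if 0 < x then 1 else 0, e fun j x => wt x - X.u j]
  refine ⟨fun k hk => ?_, h.2⟩
  rw [e fun j x => (wt x - X.u j) * testFn d Bc X.E X.P k (X.p j)]
  exact h.1 k hk

lemma mp_testOne (hb : X.Bounded Bc Hc β S) (h : X.At M) (hg : X.Dig g M)
    (hg0 : ∀ j < 2 * X.s, 0 ≤ g j ∧ g j ≤ X.v + 1)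
    {k : ℕ} (hk : k < (2 * Bc * X.E + 1) ^ (d + 1)) (h12 : M 12 = k) :
    MP β S ω (testOne d Bc Hc) (fun M' => M' 12 = k + 1 ∧
      (X.GoodAt Bc Hc g k → M' 17 = M 17) ∧ (¬ X.GoodAt Bc Hc g k → M' 17 = 0) ∧
      ∀ a, a < 12 ∨ 17 < a → M' a = M a) M := by
  have hS := hb.regs
  refine mp_seq (mp_reg (v := 0) rfl (by norm_num) hS (by simp) ?_)
  refine mp_seq (mp_reg (v := 0) rfl (by norm_num) hS (by simp) ?_)
  refine mp_seq (mp_reg (v := 0) rfl (by norm_num) hS (by simp) ?_)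
  refine mp_seq (mp_reg (v := 0) rfl (by norm_num) hS (by simp) ?_)
  set M1 := Function.update (Function.update (Function.update (Function.update M 13 0) 14 0) 15 0)
    16 0 with hM1
  have f1 : ∀ a, a < 13 ∨ 16 < a → M1 a = M a := by
    intro a ha
    rw [hM1, Function.update_of_ne (by omega), Function.update_of_ne (by omega),
      Function.update_of_ne (by omega), Function.update_of_ne (by omega)]
  have h1 : X.At M1 := h.congr fun a ha => f1 a (by omega)
  have hg1 : X.Dig g M1 := hg.congr fun a ha => f1 a (by omega)
  refine mp_seq ((mp_sumLoop hb h1 hg1 hg0 hk (by rw [f1 12 (by norm_num), h12])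
    (by simp [hM1]) (by simp [hM1]) (by simp [hM1]) (by simp [hM1])).mono ?_)
  rintro M2 ⟨e14, e15, e16, f2⟩
  have h2 : X.At M2 := h1.congr fun a ha => f2 a (by omega)
  have f2' : ∀ a, a < 13 ∨ 16 < a → M2 a = M a := fun a ha => by rw [f2 a ha, f1 a ha]
  have hbad : (badE Hc).val M2 = 0 ↔ X.GoodAt Bc Hc g k := by
    have hite : ∀ p : Prop, ∀ [Decidable p], (0 : ℤ) ≤ if p then 1 else 0 := fun p _ => by
      split_ifs <;> simp
    simp only [badE, thresholdE, Expr.val, h2.h11, h2.h5, h2.h6, h2.h1, h2.h4, e14, e15, e16,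
      GoodAt]
    rw [add_eq_zero_iff_of_nonneg (add_nonneg (add_nonneg (hite _) (hite _))
        (add_nonneg (hite _) (hite _))) (hite _),
      add_eq_zero_iff_of_nonneg (add_nonneg (hite _) (hite _)) (add_nonneg (hite _) (hite _)),
      add_eq_zero_iff_of_nonneg (hite _) (hite _), add_eq_zero_iff_of_nonneg (hite _) (hite _)]
    simp only [ite_eq_right_iff, one_ne_zero, imp_false, not_lt, zero_sub]
    have e1 : ∀ x y z : ℤ, 0 ≤ x → (x * |y| ≤ z ↔ x * y ≤ z ∧ x * -y ≤ z) := by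
      intro x y z hx
      rw [← abs_of_nonneg hx, ← abs_mul, abs_of_nonneg hx, abs_le', mul_neg]
    rw [e1 _ _ _ (by positivity), le_antisymm_iff]
    tauto
  have hend : ∀ M3 : ℤ → ℤ, (∀ a, a ≠ 17 → M3 a = M2 a) →
      (X.GoodAt Bc Hc g k → M3 17 = M 17) → (¬ X.GoodAt Bc Hc g k → M3 17 = 0) →
      MP β S ω (incr 12) (fun M' => M' 12 = k + 1 ∧
        (X.GoodAt Bc Hc g k → M' 17 = M 17) ∧ (¬ X.GoodAt Bc Hc g k → M' 17 = 0) ∧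
        ∀ a, a < 12 ∨ 17 < a → M' a = M a) M3 := by
    intro M3 f3 ha hb'
    have e12 : M3 12 = k := by rw [f3 12 (by norm_num), f2' 12 (by norm_num), h12]
    refine mp_reg (v := k + 1) (by simp [Expr.val, e12]) (by norm_num) hS ?_ ?_
    · have := hb.hnet
      rw [abs_of_nonneg (by positivity)]
      omega
    · refine ⟨by simp, fun h => ?_, fun h => ?_, fun a ha => ?_⟩
      · rw [Function.update_of_ne (by norm_num), ha h]
      · rw [Function.update_of_ne (by norm_num), hb' h]
      · rw [Function.update_of_ne (by omega), f3 a (by omega), f2' a (by omega)]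
  refine mp_seq (mp_cond (fun hne => ?_) (fun he => ?_))
  · refine mp_reg (v := 0) rfl (by norm_num) hS (by simp) ?_
    refine hend _ (fun a ha => Function.update_of_ne ha _ _) (fun hgood => ?_) (fun _ => by simp)
    exact absurd (hbad.2 hgood) hne
  · refine mp_skip (hend _ (fun _ _ => rfl) (fun _ => f2' 17 (by norm_num)) fun hng => ?_)
    exact absurd (hbad.1 he) hng

lemma mp_check (hb : X.Bounded Bc Hc β S) (hβ : 1 ≤ β) (h : X.At M) (hg : X.Dig g M)
    (hg0 : ∀ j < 2 * X.s, 0 ≤ g j ∧ g j ≤ X.v + 1) :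
    MP β S ω (check d Bc Hc) (fun M' =>
      (X.Good Bc Hc g → M' 17 = 1) ∧ (¬ X.Good Bc Hc g → M' 17 = 0) ∧
      ∀ a, a < 12 ∨ 17 < a → M' a = M a) M := by
  have hS := hb.regs
  refine mp_seq (mp_reg (v := 1) rfl (by norm_num) hS (by simpa using hβ) ?_)
  refine mp_seq (mp_reg (v := 0) rfl (by norm_num) hS (by simp) ?_)
  have hcond : ∀ M' : ℤ → ℤ, M' 1 = X.E → (powE (netE Bc) (d + 1)).val M'
      = ((2 * Bc * X.E + 1) ^ (d + 1) : ℕ) := by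
    intro M' hM'
    simp [netE, Expr.val, hM']
  refine mp_count (fun i M' => M' 12 = i ∧ ((∀ k < i, X.GoodAt Bc Hc g k) → M' 17 = 1) ∧
    ((¬ ∀ k < i, X.GoodAt Bc Hc g k) → M' 17 = 0) ∧ ∀ a, a < 12 ∨ 17 < a → M' a = M a)
    ((2 * Bc * X.E + 1) ^ (d + 1)) ⟨by simp, by simp, by simp, fun a ha => ?_⟩ ?_ ?_
  · rw [Function.update_of_ne (by omega), Function.update_of_ne (by omega)]
  · rintro i hi M' ⟨e12, e1, e2, f⟩
    have h' : X.At M' := h.congr fun a ha => f a (by have := le_adr (d := d) (i := X.m) (t := 0) (by omega) le_rfl; omega)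
    have hg' : X.Dig g M' := hg.congr fun a ha => f a (by omega)
    constructor
    · have h1 := hcond M' h'.h1
      have h2 : (i : ℤ) < ((2 * Bc * X.E + 1) ^ (d + 1) : ℕ) := by exact_mod_cast hi
      rw [Expr.val, h1]
      simp only [Expr.val, e12, if_pos h2]
      norm_num
    · refine (mp_testOne hb h' hg' hg0 hi e12).mono ?_
      rintro M'' ⟨e12', e3, e4, f'⟩
      refine ⟨by simpa using e12', fun hall => ?_, fun hnall => ?_, fun a ha => by
        rw [f' a ha, f a ha]⟩
      · rw [e3 (hall i (by omega)), e1 fun k hk => hall k (by omega)]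
      · by_cases hgi : X.GoodAt Bc Hc g i
        · rw [e3 hgi, e2 fun hall => hnall fun k hk => ?_]
          rcases Nat.lt_succ_iff_lt_or_eq.1 hk with hk' | rfl
          · exact hall k hk'
          · exact hgi
        · exact e4 hgi
  · rintro M' ⟨e12, e1, e2, f⟩
    refine ⟨?_, fun hG => e1 (good_iff.1 hG), fun hG => e2 fun hall => hG (good_iff.2 hall), f⟩
    rw [Expr.val, hcond M' (by rw [f 1 (by norm_num), h.h1])]
    simp only [Expr.val, e12, lt_irrefl, if_false]

lemma mp_clear (hb : X.Bounded Bc Hc β S) (h : X.At M) :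
    MP β S ω (clear d) (fun M' => X.Dig (fun _ => 0) M' ∧
      ∀ a, a ≠ 13 → a < adr d X.m 0 → M' a = M a) M := by
  have hS := hb.regs
  have h25 := le_adr (d := d) (i := X.m) (t := 0) (by omega) le_rfl
  refine mp_seq (mp_reg (v := 0) rfl (by norm_num) hS (by simp) ?_)
  refine mp_count (fun i M' => M' 13 = i ∧ (∀ j < i, M' (adr d X.m j) = 0) ∧
    ∀ a, a ≠ 13 → a < adr d X.m 0 → M' a = M a) (2 * X.s) ⟨by simp, by simp, fun a ha _ => ?_⟩ ?_ ?_
  · rw [Function.update_of_ne ha]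
  · rintro i hi M' ⟨e13, hz, f⟩
    have h' : X.At M' := h.congr fun a ha => f a (by omega) (by omega)
    constructor
    · have : (i : ℤ) < 2 * X.s := by exact_mod_cast hi
      simp [Expr.val, twoS, e13, h'.h6, this]
    · have hi' : 25 ≤ adr d X.m i := le_adr (by omega) (by omega)
      refine mp_seq (mp_store (h'.val_digAdrE e13) (v := 0) rfl (by omega) ?_ (by simp) ?_)
      · have := hb.hS
        unfold adr at this ⊢
        omega
      · refine mp_reg (v := i + 1) ?_ (by norm_num) hS ?_ ⟨by simp, fun j hj => ?_, fun a ha ha' => ?_⟩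
        · rw [Expr.val]
          simp only [Expr.val]
          rw [Function.update_of_ne (by omega), e13]
        · have := hb.hs
          rw [abs_of_nonneg (by positivity)]
          omega
        · rw [Function.update_of_ne (by have := le_adr (d := d) (i := X.m) (t := j) (by omega) (by omega); omega)]
          rcases Nat.lt_succ_iff_lt_or_eq.1 hj with hj' | rfl
          · rw [Function.update_of_ne (by unfold adr; omega), hz j hj']
          · rw [Function.update_self]
        · rw [Function.update_of_ne ha, Function.update_of_ne (by unfold adr at ha' ⊢; omega), f a ha ha']
  · rintro M' ⟨e13, hz, f⟩
    refine ⟨?_, fun j hj => hz j hj, f⟩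
    simp [Expr.val, twoS, e13, f 6 (by norm_num) (by omega), h.h6]

lemma mp_increment (hb : X.Bounded Bc Hc β S) (h : X.At M) {N : ℕ}
    (hN : N + 1 < (X.v + 2) ^ (2 * X.s)) (hg : X.Dig (fun j => digit (X.v + 2) N j) M) :
    MP β S ω (increment d) (fun M' => X.Dig (fun j => digit (X.v + 2) (N + 1) j) M' ∧
      ∀ a, a ≠ 13 → a < adr d X.m 0 → M' a = M a) M := by
  have hS := hb.regs
  have h25 := le_adr (d := d) (i := X.m) (t := 0) (by omega) le_rfl
  obtain ⟨k, hk, hlt, hne⟩ := exists_digit_ne (by omega) hN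
  have hsucc := digit_succ (by omega) hlt hne
  have hadr : ∀ j, j < 2 * X.s → 25 ≤ adr d X.m j ∧ adr d X.m j < S := fun j hj => by
    have := hb.hS
    refine ⟨le_adr (by omega) (by omega), ?_⟩
    unfold adr at this ⊢
    omega
  have hval : ∀ M' : ℤ → ℤ, X.At M' → ∀ i < 2 * X.s, M' 13 = i → M' (adr d X.m i) = digit (X.v + 2) N i →
      (digE d).val M' = digit (X.v + 2) N i := by
    intro M' h' i hi e13 hd
    rw [digE, Expr.val, h'.val_digAdrE e13, hd]
  refine mp_seq (mp_reg (v := 0) rfl (by norm_num) hS (by simp) ?_)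
  refine mp_seq (mp_count (fun i M' => M' 13 = i ∧ (∀ j < i, M' (adr d X.m j) = 0) ∧
    (∀ j < 2 * X.s, i ≤ j → M' (adr d X.m j) = digit (X.v + 2) N j) ∧
    ∀ a, a ≠ 13 → a < adr d X.m 0 → M' a = M a) k ⟨by simp, by simp, fun j hj _ => ?_, fun a ha _ => ?_⟩ ?_ ?_)
  · rw [Function.update_of_ne (by have := hadr j hj; omega), hg j hj]
  · rw [Function.update_of_ne ha]
  · rintro i hi M' ⟨e13, hz, hrest, f⟩
    have h' : X.At M' := h.congr fun a ha => f a (by omega) (by omega)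
    have hi' := hadr i (by omega)
    constructor
    · have h1 := hval M' h' i (by omega) e13 (hrest i (by omega) le_rfl)
      rw [Expr.val, h1, hlt i hi]
      have : (X.v : ℤ) < ((X.v + 2 - 1 : ℕ) : ℤ) := by omega
      simp only [Expr.val, h'.h11, if_pos this]
      norm_num
    · refine mp_seq (mp_store (h'.val_digAdrE e13) (v := 0) rfl (by omega) hi'.2 (by simp) ?_)
      refine mp_reg (v := i + 1) ?_ (by norm_num) hS ?_ ⟨by simp, fun j hj => ?_, fun j hj hij => ?_,
        fun a ha ha' => ?_⟩
      · simp only [Expr.val]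
        rw [Function.update_of_ne (by omega), e13]
      · have := hb.hs
        rw [abs_of_nonneg (by positivity)]
        omega
      · rw [Function.update_of_ne (by have := hadr j (by omega); omega)]
        rcases Nat.lt_succ_iff_lt_or_eq.1 hj with hj' | rfl
        · rw [Function.update_of_ne (by unfold adr; omega), hz j hj']
        · rw [Function.update_self]
      · rw [Function.update_of_ne (by have := hadr j (by omega); omega),
          Function.update_of_ne (by unfold adr; omega), hrest j hj (by omega)]
      · rw [Function.update_of_ne ha, Function.update_of_ne (by unfold adr at ha' ⊢; omega), f a ha ha']
  · rintro M' ⟨e13, hz, hrest, f⟩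
    have h' : X.At M' := h.congr fun a ha => f a (by omega) (by omega)
    have hk' := hadr k hk
    have h1 := hval M' h' k hk e13 (hrest k hk le_rfl)
    have h2 : digit (X.v + 2) N k < X.v + 2 := digit_lt (by omega) _ _
    refine ⟨?_, mp_store (h'.val_digAdrE e13) (v := digit (X.v + 2) N k + 1) ?_ (by omega) hk'.2 ?_ ?_⟩
    · rw [Expr.val, h1]
      simp only [Expr.val, h'.h11]
      rw [if_neg (by omega)]
    · rw [Expr.val, h1]; rfl
    · have := hb.hv
      rw [abs_of_nonneg (by positivity)]
      omega
    · refine ⟨fun j hj => ?_, fun a ha ha' => ?_⟩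
      · simp only [hsucc]
        rcases lt_trichotomy j k with hjk | rfl | hjk
        · rw [Function.update_of_ne (by unfold adr; omega), hz j hjk, if_pos hjk]; rfl
        · simp
        · rw [Function.update_of_ne (by unfold adr; omega), hrest j hj hjk.le, if_neg (by omega),
            if_neg (by omega)]
      · rw [Function.update_of_ne (by unfold adr at ha' ⊢; omega), f a ha ha']

lemma mp_search (hb : X.Bounded Bc Hc β S) (hs : 1 ≤ X.s) (h : X.At M)
    (hex : ∃ g : ℕ → ℕ, (∀ j < 2 * X.s, g j ≤ X.v + 1) ∧ X.Good Bc Hc fun j => g j) :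
    MP β S ω (search d Bc Hc) (fun M' => ∃ g : ℕ → ℕ, (∀ j < 2 * X.s, g j ≤ X.v + 1) ∧
      X.Good Bc Hc (fun j => g j) ∧ X.Dig (fun j => g j) M' ∧
      ∀ a, a < 12 ∨ 17 < a → a < adr d X.m 0 → M' a = M a) M := by
  have hS := hb.regs
  have hβ : 1 ≤ β := by have := hb.hs; omega
  have h25 := le_adr (d := d) (i := X.m) (t := 0) (by omega) le_rfl
  obtain ⟨N₁, hN₁, hG₁⟩ : ∃ N < (X.v + 2) ^ (2 * X.s),
      X.Good Bc Hc fun j => digit (X.v + 2) N j := by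
    obtain ⟨g, hg, hG⟩ := hex
    obtain ⟨N, hN, hd⟩ := exists_digits (b := X.v + 2) (n := 2 * X.s) g
      fun j hj => by have := hg j hj; omega
    exact ⟨N, hN, hG.congr fun j hj => by rw [hd j hj]⟩
  classical
  have hex' : ∃ N, X.Good Bc Hc fun j => digit (X.v + 2) N j := ⟨N₁, hG₁⟩
  -- The loop runs exactly `N₀` rounds. An acceptable vector with digits at most `v + 1` exists, so
  -- the odometer does not overflow before reaching it.
  set N₀ := Nat.find hex' with hN₀
  have hN₀lt : N₀ < (X.v + 2) ^ (2 * X.s) := lt_of_le_of_lt (Nat.find_min' hex' hG₁) hN₁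
  -- The program increments before it checks, so the zero vector is never tested; it keeps no record
  -- and cannot be acceptable as `1 ≤ s`.
  have hN₀pos : 0 < N₀ := by
    rw [Nat.pos_iff_ne_zero]
    intro h0
    have h1 : X.Good Bc Hc fun j => digit (X.v + 2) N₀ j := Nat.find_spec hex'
    rw [h0] at h1
    have h2 := h1.2.1
    simp [digit] at h2
    omega
  refine mp_seq ((mp_clear hb h).mono ?_)
  rintro M1 ⟨hd1, f1⟩
  refine mp_seq (mp_reg (v := 0) rfl (by norm_num) hS (by simp) ?_)
  refine mp_count (fun i M' => (i < N₀ → M' 17 = 0) ∧ (i = N₀ → M' 17 = 1) ∧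
    X.Dig (fun j => digit (X.v + 2) i j) M' ∧
    ∀ a, a < 12 ∨ 17 < a → a < adr d X.m 0 → M' a = M a) N₀ ⟨by simp, by omega, fun j hj => ?_,
      fun a ha ha' => ?_⟩ ?_ ?_
  · rw [Function.update_of_ne (by have := le_adr (d := d) (i := X.m) (t := j) (by omega) (by omega); omega), hd1 j hj]
    simp [digit]
  · rw [Function.update_of_ne (by omega), f1 a (by omega) ha']
  · rintro i hi M' ⟨e0, -, hd, f⟩
    have h' : X.At M' := h.congr fun a ha => f a (by omega) (by omega)
    constructor
    · simp [Expr.val, e0 hi]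
    refine mp_seq ((mp_increment hb h' (by omega) hd).mono ?_)
    rintro M2 ⟨hd2, f2⟩
    have h2 : X.At M2 := h'.congr fun a ha => f2 a (by omega) (by omega)
    refine (mp_check hb hβ h2 hd2 fun j hj => ?_).mono ?_
    · have := digit_lt (b := X.v + 2) (by omega) (i + 1) j
      omega
    rintro M3 ⟨hy, hn, f3⟩
    refine ⟨fun hlt => hn (Nat.find_min hex' hlt), fun heq => hy ?_, hd2.congr fun a ha => f3 a (by omega),
      fun a ha ha' => by rw [f3 a ha, f2 a (by omega) ha', f a ha ha']⟩
    rw [heq]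
    exact Nat.find_spec hex'
  · rintro M' ⟨-, e1, hd, f⟩
    refine ⟨by simp [Expr.val, e1 rfl], fun j => digit (X.v + 2) N₀ j, fun j hj => ?_,
      Nat.find_spec hex', hd, f⟩
    exact Nat.lt_succ_iff.1 (digit_lt (b := X.v + 2) (by omega) N₀ j)

end Red

/-! ### Compaction of the records that are kept -/

namespace Red

variable {d : ℕ} {X : Red d} {M M' : ℤ → ℤ} {g : ℕ → ℕ} {Bc Hc β S L : ℕ} {ω : Tape L}

/-- The positions of the records that are kept. -/
def kept (g : ℕ → ℕ) (n : ℕ) : List ℕ := (List.range n).filter fun j => 0 < g j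

lemma kept_succ (g : ℕ → ℕ) (n : ℕ) :
    kept g (n + 1) = if 0 < g n then kept g n ++ [n] else kept g n := by
  unfold kept
  rw [List.range_succ, List.filter_append]
  split_ifs with h <;> simp [h]

lemma length_kept_le (g : ℕ → ℕ) (n : ℕ) : (kept g n).length ≤ n := by
  have := List.length_filter_le (fun j => decide (0 < g j)) (List.range n)
  simpa [kept] using this

lemma sum_kept (g : ℕ → ℕ) (f : ℕ → ℤ) (n : ℕ) :
    ((kept g n).map f).sum = ∑ j ∈ range n, if 0 < g j then f j else 0 := by
  induction n with
  | zero => simp [kept]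
  | succ n ih =>
    rw [kept_succ, sum_range_succ, ← ih]
    split_ifs <;> simp

lemma length_kept (g : ℕ → ℕ) (n : ℕ) :
    ((kept g n).length : ℤ) = ∑ j ∈ range n, if 0 < g j then 1 else 0 := by
  have := sum_kept g (fun _ => 1) n
  simpa using this

/-- The memory holds a record with coordinates `z` and weight `x` at position `i`. -/
def Cell (d : ℕ) (M : ℤ → ℤ) (i : ℤ) (z : ℕ → ℤ) (x : ℤ) : Prop :=
  (∀ t < d, M (adr d i t) = z t) ∧ M (adr d i d) = x

lemma Cell.congr {i x : ℤ} {z : ℕ → ℤ} (h : Cell d M i z x)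
    (hM : ∀ t : ℕ, t ≤ d → M' (adr d i t) = M (adr d i t)) : Cell d M' i z x :=
  ⟨fun t ht => by rw [hM t ht.le, h.1 t ht], by rw [hM d le_rfl, h.2]⟩

/-- Copying in place is safe because the target never overtakes the source: among the first `j`
records at most `j` are kept (`length_kept_le`), and for `i = j` each coordinate is overwritten by
itself. -/
lemma mp_copyCoords (hb : X.Bounded Bc Hc β S) (h0 : M 0 = X.m) (h6 : M 6 = X.s) {i j : ℕ} (hij : i ≤ j)
    (hj : j < 2 * X.s) (h13 : M 13 = j) (h19 : M 19 = i) (k : ℕ) (hk : k ≤ d)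
    (hz : ∀ t < d, M (adr d (((X.m - 2 * X.s : ℕ) : ℤ) + j) t) = X.p j t) :
    MP β S ω (copyCoords d k) (fun M' =>
      (∀ t < k, M' (adr d (((X.m - 2 * X.s : ℕ) : ℤ) + i) t) = X.p j t) ∧
      (∀ t < d, M' (adr d (((X.m - 2 * X.s : ℕ) : ℤ) + j) t) = X.p j t) ∧
      ∀ a, (a < adr d (((X.m - 2 * X.s : ℕ) : ℤ) + i) 0 ∨
        adr d (((X.m - 2 * X.s : ℕ) : ℤ) + i) d ≤ a) → M' a = M a) M := by
  have hle := X.le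
  set o : ℤ := ((X.m - 2 * X.s : ℕ) : ℤ) with ho
  have ho' : o = X.m - 2 * X.s := by rw [ho]; push_cast [hle]; ring
  have ho0 : 0 ≤ o := by omega
  have h25 : 25 ≤ adr d (o + i) 0 := le_adr (by omega) le_rfl
  induction k with
  | zero => exact mp_skip ⟨by simp, hz, fun _ _ => rfl⟩
  | succ k ih =>
    refine mp_seq ((ih (by omega)).mono ?_)
    rintro M1 ⟨e1, e2, f⟩
    have hreg : ∀ a, a < 25 → M1 a = M a := fun a ha => f a (by omega)
    have hsrc : (recE d).val M1 + k = adr d (o + j) k := by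
      simp only [recE, Expr.val, hreg 0 (by norm_num), hreg 6 (by norm_num), hreg 13 (by norm_num),
        h0, h6, h13, adr, ho']
    have hdst : (dstE d).val M1 + k = adr d (o + i) k := by
      simp only [dstE, Expr.val, hreg 0 (by norm_num), hreg 6 (by norm_num), hreg 19 (by norm_num),
        h0, h6, h19, adr, ho']
    refine mp_store (i := adr d (o + i) k) (v := X.p j k) hdst ?_ ?_ ?_ (hb.hp j hj k hk) ?_
    · have : Expr.val M1 (.load (.add (recE d) (.const k))) = M1 ((recE d).val M1 + k) := rfl
      rw [this, hsrc, e2 k hk]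
    · have := le_adr (d := d) (i := o + i) (t := k) (by omega) (by omega); omega
    · have h1 := hb.hS
      have h2 : adr d (o + i) k < adr d X.m 0 := adr_lt_adr (by omega) (by omega) le_rfl
      have h3 : adr d X.m 0 ≤ adr d X.m (2 * X.s) := by unfold adr; omega
      omega
    · refine ⟨fun t ht => ?_, fun t ht => ?_, fun a ha => ?_⟩
      · rcases Nat.lt_succ_iff_lt_or_eq.1 ht with ht' | rfl
        · rw [Function.update_of_ne (by unfold adr; omega), e1 t ht']
        · rw [Function.update_self]
      · rcases hij.eq_or_lt with rfl | hlt
        · by_cases htk : t = k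
          · rw [htk, Function.update_self]
          · rw [Function.update_of_ne (by unfold adr; omega), e2 t ht]
        · have : adr d (o + i) k < adr d (o + j) t := adr_lt_adr (by omega) (by omega) (by omega)
          rw [Function.update_of_ne (by omega), e2 t ht]
      · rw [Function.update_of_ne (by unfold adr at ha ⊢; omega), f a ha]

lemma mp_compact (hb : X.Bounded Bc Hc β S) (h : X.At M)
    (hg0 : ∀ j < 2 * X.s, g j ≤ X.v + 1) (hg : X.Dig (fun j => g j) M) :
    MP β S ω (compact d) (fun M' => M' 0 = X.m - X.s ∧
      (∀ i j : ℕ, (kept g (2 * X.s))[i]? = some j →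
        Cell d M' (((X.m - 2 * X.s : ℕ) : ℤ) + i) (X.p j) (g j - 1)) ∧
      ∀ a, a ≠ 0 → a ≠ 13 → a ≠ 19 → a < adr d ((X.m - 2 * X.s : ℕ) : ℤ) 0 → M' a = M a) M := by
  have hS := hb.regs
  have hle := X.le
  set o : ℤ := ((X.m - 2 * X.s : ℕ) : ℤ) with ho
  have ho' : o = X.m - 2 * X.s := by rw [ho]; push_cast [hle]; ring
  have ho0 : 0 ≤ o := by omega
  have hm0 : adr d o 0 ≤ adr d X.m 0 := by
    unfold adr
    have : o * ((d : ℤ) + 1) ≤ X.m * ((d : ℤ) + 1) := by gcongr; omega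
    omega
  have h25 : 25 ≤ adr d o 0 := le_adr (by omega) le_rfl
  have hoi : ∀ i : ℕ, adr d o 0 ≤ adr d (o + i) 0 := fun i => by
    unfold adr
    have : o * ((d : ℤ) + 1) ≤ (o + i) * ((d : ℤ) + 1) := by gcongr; omega
    omega
  refine mp_seq (mp_reg (v := 0) rfl (by norm_num) hS (by simp) ?_)
  refine mp_seq (mp_reg (v := 0) rfl (by norm_num) hS (by simp) ?_)
  refine mp_seq (mp_count (fun n M' => M' 13 = n ∧ M' 19 = (kept g n).length ∧
      (∀ i j : ℕ, (kept g n)[i]? = some j → Cell d M' (o + (i : ℤ)) (X.p j) (g j - 1)) ∧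
      (∀ j < 2 * X.s, n ≤ j → Cell d M' (o + (j : ℤ)) (X.p j) (X.u j)) ∧
      ∀ a, a ≠ 13 → a ≠ 19 → a < adr d o 0 ∨ adr d X.m 0 ≤ a → M' a = M a) (2 * X.s) ?_ ?_ ?_)
  · have e1 : ∀ a, a ≠ 13 → a ≠ 19 → Function.update (Function.update M 13 0) 19 0 a = M a :=
      fun a h1 h2 => by rw [Function.update_of_ne h2, Function.update_of_ne h1]
    refine ⟨by simp, by simp [kept], by simp [kept], fun j hj _ => ?_, fun a h1 h2 _ => e1 a h1 h2⟩
    refine Cell.congr (M := M) ⟨fun t ht => h.hp j hj t ht, h.hu j hj⟩ fun t ht => ?_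
    have := le_adr (d := d) (i := o + j) (t := t) (by omega) (by omega)
    exact e1 _ (by omega) (by omega)
  · rintro n hn M' ⟨e13, e19, hk, hr, f⟩
    have hlen := length_kept_le g n
    have hreg : ∀ a, a < 25 → a ≠ 13 → a ≠ 19 → M' a = M a := fun a h1 h2 h3 => f a h2 h3 (by omega)
    have h0 : M' 0 = X.m := by rw [hreg 0 (by norm_num) (by norm_num) (by norm_num), h.h0]
    have h6 : M' 6 = X.s := by rw [hreg 6 (by norm_num) (by norm_num) (by norm_num), h.h6]
    have hn' : (n : ℤ) < 2 * X.s := by exact_mod_cast hn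
    have hsβ := hb.hs
    have hdv : (digE d).val M' = g n := by
      have : (digE d).val M' = M' (adr d X.m n) := by
        simp only [digE, digAdrE, Expr.val, h0, e13, adr]
      have h2 : adr d X.m 0 ≤ adr d X.m n := by unfold adr; omega
      rw [this, f _ (by omega) (by omega) (Or.inr h2), hg n hn]
    have hincr : ∀ M'' : ℤ → ℤ, M'' 13 = n → M'' 19 = (kept g (n + 1)).length →
      (∀ i j : ℕ, (kept g (n + 1))[i]? = some j → Cell d M'' (o + (i : ℤ)) (X.p j) (g j - 1)) →
      (∀ j < 2 * X.s, n + 1 ≤ j → Cell d M'' (o + (j : ℤ)) (X.p j) (X.u j)) →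
      (∀ a, a ≠ 13 → a ≠ 19 → a < adr d o 0 ∨ adr d X.m 0 ≤ a → M'' a = M a) →
      MP β S ω (incr 13) (fun M' => M' 13 = (n + 1 : ℕ) ∧ M' 19 = (kept g (n + 1)).length ∧
        (∀ i j : ℕ, (kept g (n + 1))[i]? = some j → Cell d M' (o + (i : ℤ)) (X.p j) (g j - 1)) ∧
        (∀ j < 2 * X.s, n + 1 ≤ j → Cell d M' (o + (j : ℤ)) (X.p j) (X.u j)) ∧
        ∀ a, a ≠ 13 → a ≠ 19 → a < adr d o 0 ∨ adr d X.m 0 ≤ a → M' a = M a) M'' := by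
      intro M'' i13 i19 ik ir fr
      refine mp_reg (v := n + 1) (by simp [Expr.val, i13]) (by norm_num) hS ?_ ⟨by simp, ?_, ?_, ?_, ?_⟩
      · rw [abs_of_nonneg (by positivity)]; omega
      · rw [Function.update_of_ne (by norm_num), i19]
      · intro i j hij
        refine (ik i j hij).congr fun t ht => Function.update_of_ne ?_ _ _
        have := le_adr (d := d) (i := o + i) (t := t) (by omega) (by omega); omega
      · intro j hj hnj
        refine (ir j hj hnj).congr fun t ht => Function.update_of_ne ?_ _ _
        have := le_adr (d := d) (i := o + j) (t := t) (by omega) (by omega); omega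
      · intro a h1 h2 h3
        rw [Function.update_of_ne h1, fr a h1 h2 h3]
    constructor
    · simp [Expr.val, twoS, e13, h6, hn']
    · refine mp_seq (mp_cond (fun hne => ?_) (fun he => ?_))
      · have hpos : 0 < g n := by
          by_contra hcon
          have : g n = 0 := by omega
          simp [Expr.val, hdv, this] at hne
        have hks : kept g (n + 1) = kept g n ++ [n] := by rw [kept_succ, if_pos hpos]
        set c := (kept g n).length with hc
        have hlt1 : adr d (o + c) d < adr d X.m 0 := adr_lt_adr (by omega) le_rfl le_rfl
        have hgt1 := hoi c
        refine mp_seq ((mp_copyCoords hb h0 h6 hlen hn e13 e19 d le_rfl (hr n hn le_rfl).1).mono ?_)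
        rintro M1 ⟨a1, -, f1⟩
        rw [← ho] at a1 f1
        have hreg1 : ∀ a, a < 25 → M1 a = M' a := fun a ha => f1 a (Or.inl (by omega))
        have hdig1 : (digE d).val M1 = g n := by
          have e1 : (digE d).val M1 = M1 (adr d X.m n) := by
            simp only [digE, digAdrE, Expr.val, hreg1 0 (by norm_num), hreg1 13 (by norm_num), h0,
              e13, adr]
          have e2 : (digE d).val M' = M' (adr d X.m n) := by
            simp only [digE, digAdrE, Expr.val, h0, e13, adr]
          have h2 : adr d X.m 0 ≤ adr d X.m n := by unfold adr; omega
          rw [e1, f1 _ (Or.inr (by omega)), ← e2, hdv]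
        refine mp_seq (mp_store (i := adr d (o + c) d) (v := g n - 1) ?_ ?_
          (by have := le_adr (d := d) (i := o + c) (t := d) (by omega) (by omega); omega) ?_ ?_ ?_)
        · simp only [dstE, Expr.val, hreg1 0 (by norm_num), hreg1 6 (by norm_num),
            hreg1 19 (by norm_num), h0, h6, e19, adr, ho']
        · simp only [Expr.val, hdig1]
        · have h1 := hb.hS
          have h3 : adr d X.m 0 ≤ adr d X.m (2 * X.s) := by unfold adr; omega
          omega
        · have h1 := hb.hv
          have h2 := hg0 n hn
          rw [abs_of_nonneg (by omega)]
          omega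
        set M2 := Function.update M1 (adr d (o + c) d) (g n - 1) with hM2
        have f2 : ∀ a, a < adr d (o + c) 0 ∨ adr d (o + c) d < a → M2 a = M' a := by
          intro a ha
          have : adr d (o + c) 0 ≤ adr d (o + c) d := by unfold adr; omega
          rw [hM2, Function.update_of_ne (by omega), f1 a (by omega)]
        have hc2 : Cell d M2 (o + c) (X.p n) (g n - 1) := by
          refine ⟨fun t ht => ?_, by rw [hM2, Function.update_self]⟩
          rw [hM2, Function.update_of_ne (by unfold adr; omega), a1 t ht]
        refine mp_reg (v := c + 1) (by simp [Expr.val, f2 19 (by omega), e19]) (by norm_num) hS ?_ ?_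
        · rw [abs_of_nonneg (by positivity)]; omega
        have f3 : ∀ a, a ≠ 19 → a < adr d (o + c) 0 ∨ adr d (o + c) d < a →
            Function.update M2 19 ((c : ℤ) + 1) a = M' a := by
          intro a h1 h2
          rw [Function.update_of_ne h1, f2 a h2]
        refine hincr _ (by rw [f3 13 (by norm_num) (by omega), e13]) (by simp [hks, hc]) ?_ ?_ ?_
        · intro i j hij
          rw [hks, List.getElem?_append] at hij
          split_ifs at hij with hi
          · refine (hk i j hij).congr fun t ht => ?_
            have h1 := le_adr (d := d) (i := o + i) (t := t) (by omega) (by omega)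
            have h2 : adr d (o + i) t < adr d (o + c) 0 := adr_lt_adr (by omega) (by omega) le_rfl
            exact f3 _ (by omega) (Or.inl h2)
          · obtain ⟨rfl, rfl⟩ : i = c ∧ n = j := by
              rcases Nat.eq_zero_or_pos (i - c) with h1 | h1
              · rw [← hc, h1] at hij
                simp at hij
                exact ⟨by omega, hij⟩
              · rw [← hc, List.getElem?_eq_none (by simp only [List.length_singleton]; omega)] at hij
                simp at hij
            refine hc2.congr fun t ht => Function.update_of_ne ?_ _ _
            have := le_adr (d := d) (i := o + c) (t := t) (by omega) (by omega)
            omega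
        · intro j hj hnj
          refine (hr j hj (by omega)).congr fun t ht => ?_
          have h1 := le_adr (d := d) (i := o + j) (t := t) (by omega) (by omega)
          have h2 : adr d (o + c) d < adr d (o + j) t := adr_lt_adr (by omega) le_rfl (by omega)
          exact f3 _ (by omega) (Or.inr h2)
        · intro a h1 h2 h3
          rw [f3 a h2 (by omega), f a h1 h2 h3]
      · have hz : ¬ 0 < g n := by
          intro hcon
          simp [Expr.val, hdv, hcon] at he
        have hks : kept g (n + 1) = kept g n := by rw [kept_succ, if_neg hz]
        refine mp_skip (hincr M' e13 (by rw [hks, e19]) (by rwa [hks])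
          (fun j hj hnj => hr j hj (by omega)) f)
  · rintro M' ⟨e13, e19, hk, hr, f⟩
    have h0 : M' 0 = X.m := by rw [f 0 (by norm_num) (by norm_num) (by omega), h.h0]
    have h6 : M' 6 = X.s := by rw [f 6 (by norm_num) (by norm_num) (by omega), h.h6]
    refine ⟨by simp [Expr.val, twoS, e13, h6], ?_⟩
    refine mp_reg (v := X.m - X.s) (by simp [Expr.val, h0, h6]) (by norm_num) hS ?_ ⟨by simp, ?_, ?_⟩
    · have := hb.hm
      rw [abs_of_nonneg (by omega)]
      omega
    · intro i j hij
      refine (hk i j hij).congr fun t ht => Function.update_of_ne ?_ _ _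
      have := le_adr (d := d) (i := o + i) (t := t) (by omega) (by omega); omega
    · intro a h1 h2 h3 h4
      rw [Function.update_of_ne h1, f a h2 h3 (Or.inl h4)]

end Red

/-- Reduce the last `2 * s` records to `s` records. -/
def reduce (d Bc Hc : ℕ) : Program := .seq (search d Bc Hc) (compact d)

def halveLoop (d Bc Hc : ℕ) : Program :=
  .loop (.lt (.sub (reg 10) (.mul twoS (.div (reg 10) twoS))) (.const 1))
    (.seq (reduce d Bc Hc) (.seq (.store (.const 10) (.div (reg 10) (.const 2)))
      (.store (.const 11) (.mul (reg 11) (.const 2)))))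

/-- Merge and reduce blocks of equal rank as long as there are two of them. -/
def cascade (d Bc Hc : ℕ) : Program :=
  .seq (.store (.const 10) (reg 18))
    (.seq (.store (.const 11) (.mul (.mul (.mul twoS (reg 7)) (reg 4)) (reg 4)))
      (halveLoop d Bc Hc))

/-- The parameters of a computation: constants of the program, contents of the registers, bounds
for numbers and addresses, and the points of the stream. -/
structure Env where
  (d Bc Hc E P Λ s len n Vmax mmax β S : ℕ)
  Z : ℕ → ℕ → ℤ

/-! ### The reduction step in terms of lists of records -/

namespace Env

variable (X : Env)

/-- The `k`-th test function at the `i`-th point. -/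
def fn (k i : ℕ) : ℤ := testFn X.d X.Bc X.E X.P k (X.Z i)

/-- Number of test functions. -/
def N : ℕ := (2 * X.Bc * X.E + 1) ^ (X.d + 1)

/-- Weighted sum of values of a test function over a list of records. -/
def wsum (k : ℕ) (R : List (ℕ × ℤ)) : ℤ := (R.map fun r => r.2 * X.fn k r.1).sum

/-- Allowance for rounding in a single reduction. -/
def rnd : ℕ := X.Λ * X.s * X.Hc * X.E * X.P

/-- Tolerance in a reduction of lowest rank. -/
def v0 : ℕ := 2 * X.s * X.len * X.P * X.P

/-- Numbers stay below `β` and addresses below `S`. -/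
structure Bounds : Prop where
  hs1 : 1 ≤ X.s
  hP : 1 ≤ X.P
  hlen : 1 ≤ X.len
  hV : X.Vmax + 1 ≤ X.β
  hs : 2 * X.s ≤ X.β
  hN : X.N ≤ X.β
  hp : ∀ i < X.n, ∀ t < X.d, |X.Z i t| ≤ X.β
  hH : ∀ k < X.N, ∀ i < X.n, X.fn k i ≤ X.Hc * X.E * X.P
  hacc : 2 * X.s * (X.Vmax * (X.Hc * X.E * X.P)) ≤ X.β
  hsum : 2 * X.s * X.Vmax ≤ X.β
  hm : X.mmax ≤ X.β
  hS : adr X.d X.mmax (2 * X.s) ≤ X.S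

/-- A list of records represents another one for all test functions. -/
structure Reduces (v : ℕ) (R R' : List (ℕ × ℤ)) : Prop where
  len : R'.length = X.s
  sub : (R'.map Prod.fst).Sublist (R.map Prod.fst)
  nonneg : ∀ r ∈ R', 0 ≤ r.2
  sum : (R'.map Prod.snd).sum ≤ (R.map Prod.snd).sum
  err : ∀ k < X.N, X.Λ * |X.wsum k R' - X.wsum k R| ≤ v + X.rnd

/-- The reduction step for a list of records. -/
def red (R : List (ℕ × ℤ)) (v m : ℕ) (h : 2 * X.s ≤ m) : Red X.d where
  E := X.E
  P := X.P
  Λ := X.Λ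
  s := X.s
  v := v
  m := m
  p j := X.Z (R.getD j (0, 0)).1
  u j := (R.getD j (0, 0)).2
  le := h

/-- Every list of `2 * s` records admits a reduction. -/
def HasReductions : Prop := ∀ (R : List (ℕ × ℤ)), R.length = 2 * X.s →
  (∀ r ∈ R, 0 ≤ r.2 ∧ r.1 < X.n) → ∀ v : ℕ, (R.map Prod.snd).sum * X.P ≤ v →
  ∀ m hm, ∃ g : ℕ → ℕ, (∀ j < 2 * X.s, g j ≤ v + 1) ∧ (X.red R v m hm).Good X.Bc X.Hc fun j => g j

/-- The memory holds a list of records from position `o` on. -/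
def Holds (M : ℤ → ℤ) (o : ℤ) (R : List (ℕ × ℤ)) : Prop :=
  ∀ (i : ℕ) r, R[i]? = some r → Red.Cell X.d M (o + i) (X.Z r.1) r.2

variable {X} {M M' : ℤ → ℤ} {L : ℕ} {ω : Tape L} {R R₁ R₂ : List (ℕ × ℤ)}

lemma Holds.congr {o : ℤ} (h : X.Holds M o R)
    (hM : ∀ a, adr X.d o 0 ≤ a → a < adr X.d (o + R.length) 0 → M' a = M a) : X.Holds M' o R := by
  intro i r hr
  refine (h i r hr).congr fun t ht => hM _ ?_ ?_
  · unfold adr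
    have : o * ((X.d : ℤ) + 1) ≤ (o + i) * ((X.d : ℤ) + 1) := by gcongr; omega
    omega
  · have hi : i < R.length := (List.getElem?_eq_some_iff.1 hr).1
    exact adr_lt_adr (by omega) (by omega) le_rfl

lemma holds_append {o : ℤ} :
    X.Holds M o (R₁ ++ R₂) ↔ X.Holds M o R₁ ∧ X.Holds M (o + R₁.length) R₂ := by
  constructor
  · intro h
    constructor
    · intro i r hr
      have hi : i < R₁.length := (List.getElem?_eq_some_iff.1 hr).1
      exact h i r (by rw [List.getElem?_append_left hi, hr])
    · intro i r hr
      have := h (R₁.length + i) r (by rw [List.getElem?_append_right (by omega)]; simpa using hr)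
      push_cast at this
      rwa [← add_assoc] at this
  · rintro ⟨h1, h2⟩ i r hr
    rw [List.getElem?_append] at hr
    split_ifs at hr with hi
    · exact h1 i r hr
    · have := h2 _ r hr
      have e : o + (R₁.length : ℤ) + ((i - R₁.length : ℕ) : ℤ) = o + i := by omega
      rwa [e] at this

lemma sum_getD (f : ℕ × ℤ → ℤ) (R : List (ℕ × ℤ)) (n : ℕ) (hn : R.length = n) :
    ∑ j ∈ range n, f (R.getD j (0, 0)) = (R.map f).sum := by
  subst hn
  rw [Finset.sum_range, ← List.sum_ofFn]
  congr 1
  refine List.ext_getElem (by simp) fun i h1 h2 => ?_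
  simp at h1
  simp

lemma mp_reduce (hX : X.Bounds) (hred : X.HasReductions) {v : ℕ} (hv : v ≤ X.Vmax)
    (hR₂ : R₂.length = 2 * X.s) (hR₂' : ∀ r ∈ R₂, 0 ≤ r.2 ∧ r.1 < X.n)
    (hsum : (R₂.map Prod.snd).sum * X.P ≤ v) (hm : R₁.length + 2 * X.s ≤ X.mmax)
    (hold : X.Holds M 0 (R₁ ++ R₂)) (h0 : M 0 = (R₁.length + 2 * X.s : ℕ)) (h1 : M 1 = X.E)
    (h4 : M 4 = X.P) (h5 : M 5 = X.Λ) (h6 : M 6 = X.s) (h11 : M 11 = v) :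
    MP X.β X.S ω (reduce X.d X.Bc X.Hc) (fun M' => ∃ R₃, X.Reduces v R₂ R₃ ∧
      X.Holds M' 0 (R₁ ++ R₃) ∧ M' 0 = (R₁.length + X.s : ℕ) ∧
      ∀ a, 0 < a → a < 25 → (a < 12 ∨ 17 < a) → a ≠ 19 → M' a = M a) M := by
  set Y := X.red R₂ v (R₁.length + 2 * X.s) (by omega) with hY
  have hget : ∀ j < 2 * X.s, R₂.getD j (0, 0) ∈ R₂ := fun j hj => by
    rw [List.getD_eq_getElem _ _ (by omega)]
    exact List.getElem_mem _
  have hget' : ∀ j < 2 * X.s, R₂[j]? = some (R₂.getD j (0, 0)) := fun j hj => by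
    rw [List.getD_eq_getElem _ _ (by omega), List.getElem?_eq_getElem (by omega)]
  have hole := (holds_append.1 hold).2
  have ho : ((R₁.length + 2 * X.s - 2 * X.s : ℕ) : ℤ) = R₁.length := by simp
  have hsnd : ∑ j ∈ range (2 * X.s), (R₂.getD j (0, 0)).2 = (R₂.map Prod.snd).sum :=
    sum_getD Prod.snd R₂ _ hR₂
  have hP := hX.hP
  -- The number `v` is the tolerance and also bounds each single weight, hence the digits, because
  -- the weights are nonnegative and `1 ≤ P`.
  have hsum' : (R₂.map Prod.snd).sum ≤ v := by
    have h0 : 0 ≤ (R₂.map Prod.snd).sum := by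
      rw [← hsnd]
      exact sum_nonneg fun j hj => (hR₂' _ (hget j (mem_range.1 hj))).1
    nlinarith
  have hb : Y.Bounded X.Bc X.Hc X.β X.S := {
    hv := by have := hX.hV; change v + 1 ≤ X.β; omega
    hs := hX.hs
    hnet := hX.hN
    hu := fun j hj => by
      refine ⟨(hR₂' _ (hget j hj)).1, le_trans ?_ hsum'⟩
      rw [← hsnd]
      exact single_le_sum (f := fun j => (R₂.getD j (0, 0)).2)
        (fun j hj => (hR₂' _ (hget j (mem_range.1 hj))).1) (mem_range.2 hj)
    hp := fun j hj => hX.hp _ (hR₂' _ (hget j hj)).2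
    hH := fun k hk j hj => hX.hH k hk _ (hR₂' _ (hget j hj)).2
    hacc := le_trans (by change 2 * X.s * (v * (X.Hc * X.E * X.P)) ≤ _; gcongr) hX.hacc
    hsum := le_trans (by change 2 * X.s * v ≤ _; gcongr) hX.hsum
    hm := hm.trans hX.hm
    hS := le_trans (by
      change adr X.d ((R₁.length + 2 * X.s : ℕ) : ℤ) (2 * X.s) ≤ _
      unfold adr; gcongr) hX.hS }
  have hat : Y.At M := {
    h0 := h0
    h1 := h1
    h4 := h4
    h5 := h5
    h6 := h6
    h11 := h11
    hp := fun j hj t ht => by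
      have := (hole j _ (hget' j hj)).1 t ht
      rw [zero_add] at this
      change M (adr X.d (((R₁.length + 2 * X.s - 2 * X.s : ℕ) : ℤ) + j) t) = _
      rw [ho, this]; rfl
    hu := fun j hj => by
      have := (hole j _ (hget' j hj)).2
      rw [zero_add] at this
      change M (adr X.d (((R₁.length + 2 * X.s - 2 * X.s : ℕ) : ℤ) + j) X.d) = _
      rw [ho, this]; rfl }
  have h25 : 25 ≤ adr X.d (R₁.length : ℤ) 0 := le_adr (by omega) le_rfl
  have hlt : adr X.d (R₁.length : ℤ) 0 ≤ adr X.d Y.m 0 := by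
    change _ ≤ adr X.d ((R₁.length + 2 * X.s : ℕ) : ℤ) 0
    unfold adr; gcongr; omega
  refine mp_seq ((Red.mp_search hb hX.hs1 hat (hred R₂ hR₂ hR₂' v hsum _ _)).mono ?_)
  rintro M1 ⟨g, hg, hG, hd, f⟩
  have hat1 : Y.At M1 := hat.congr fun a ha => f a (by omega) (by omega)
  refine (Red.mp_compact hb hat1 hg hd).mono ?_
  rintro M2 ⟨e0, hcells, f2⟩
  have hkl : ((Red.kept g (2 * X.s)).length : ℤ) = X.s := by
    refine (Red.length_kept _ _).trans (Eq.trans ?_ hG.2.1)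
    exact sum_congr rfl fun j _ => by simp only [Nat.cast_pos]
  have hmem : ∀ j ∈ Red.kept g (2 * X.s), j < 2 * X.s ∧ 0 < g j := fun j hj => by
    simpa [Red.kept] using hj
  set R₃ := (Red.kept g (2 * X.s)).map fun j => ((R₂.getD j (0, 0)).1, (g j : ℤ) - 1) with hR₃
  have hf2 : ∀ a, a ≠ 0 → a ≠ 13 → a ≠ 19 → a < adr X.d (R₁.length : ℤ) 0 → M2 a = M1 a := by
    intro a b1 b2 b3 b4
    refine f2 a b1 b2 b3 ?_
    change a < adr X.d ((R₁.length + 2 * X.s - 2 * X.s : ℕ) : ℤ) 0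
    rwa [ho]
  have hksum : ∀ F : ℕ → ℤ → ℤ, ((Red.kept g (2 * X.s)).map fun j => F j ((g j : ℤ) - 1)).sum
      = ∑ j ∈ range (2 * X.s), if 0 < g j then F j (wt (g j)) else 0 := by
    intro F
    rw [Red.sum_kept]
    refine sum_congr rfl fun j _ => ?_
    split_ifs with h
    · rw [wt, if_pos (by exact_mod_cast h)]
    · rfl
  have hwt0 : ∀ j, ¬ 0 < g j → wt (g j) = 0 := fun j hj => by
    have : g j = 0 := by omega
    simp [wt, this]
  refine ⟨R₃, ⟨?_, ?_, ?_, ?_, ?_⟩, ?_, ?_, ?_⟩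
  · rw [hR₃, List.length_map]; exact_mod_cast hkl
  · have e1 : R₃.map Prod.fst = (Red.kept g (2 * X.s)).map fun j => (R₂.getD j (0, 0)).1 := by
      rw [hR₃, List.map_map]; rfl
    have e2 : R₂.map Prod.fst = (List.range (2 * X.s)).map fun j => (R₂.getD j (0, 0)).1 := by
      refine List.ext_getElem (by simp [hR₂]) fun i h1 h2 => ?_
      simp only [List.getElem_map, List.getElem_range]
      rw [List.getD_eq_getElem _ _ (by simpa using h1)]
    rw [e1, e2]
    exact List.filter_sublist.map _
  · intro r hr
    obtain ⟨j, hj, rfl⟩ := List.mem_map.1 hr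
    have := (hmem j hj).2
    simp only
    omega
  · have e1 : (R₃.map Prod.snd).sum = ∑ j ∈ range (2 * X.s), wt (g j) := by
      rw [hR₃, List.map_map]
      refine (hksum fun _ x => x).trans (sum_congr rfl fun j _ => ?_)
      split_ifs with h
      · rfl
      · rw [hwt0 j h]
    have := hG.2.2
    rw [sum_sub_distrib] at this
    rw [e1, ← hsnd]
    exact sub_nonpos.1 this
  · intro k hk
    have e1 : X.wsum k R₃ = ∑ j ∈ range (2 * X.s), wt (g j) * X.fn k (R₂.getD j (0, 0)).1 := by
      rw [wsum, hR₃, List.map_map]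
      refine (hksum fun j x => x * X.fn k (R₂.getD j (0, 0)).1).trans (sum_congr rfl fun j _ => ?_)
      split_ifs with h
      · rfl
      · rw [hwt0 j h, zero_mul]
    have e2 : X.wsum k R₂ = ∑ j ∈ range (2 * X.s), (R₂.getD j (0, 0)).2 * X.fn k (R₂.getD j (0, 0)).1 :=
      (sum_getD (fun r => r.2 * X.fn k r.1) R₂ _ hR₂).symm
    rw [e1, e2, ← sum_sub_distrib]
    have := hG.1 k hk
    simp only [← sub_mul]
    rw [rnd]
    push_cast
    exact this
  · rw [holds_append]
    constructor
    · refine (holds_append.1 hold).1.congr fun a ha ha' => ?_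
      have := le_adr (d := X.d) (i := 0) (t := 0) le_rfl le_rfl
      rw [zero_add] at ha'
      rw [hf2 a (by omega) (by omega) (by omega) ha', f a (by omega) (by omega)]
    · intro i r hr
      rw [hR₃, List.getElem?_map, Option.map_eq_some_iff] at hr
      obtain ⟨j, hj, rfl⟩ := hr
      have := hcells i j hj
      rw [zero_add]
      change Red.Cell X.d M2 (((R₁.length + 2 * X.s - 2 * X.s : ℕ) : ℤ) + i) _ _ at this
      rw [ho] at this
      exact this
  · rw [e0]
    change ((R₁.length + 2 * X.s : ℕ) : ℤ) - X.s = _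
    push_cast; ring
  · intro a b1 b2 b3 b4
    rw [hf2 a (by omega) (by omega) b4 (by omega), f a (by omega) (by omega)]

end Env

/-! ### Merge-and-reduce as a binary counter -/

namespace Env

variable (X : Env)

/-- The contribution of the sampled points `S` to the sum of a test function. -/
def ssum (k : ℕ) (S : List ℕ) : ℤ := (S.map fun i => (X.len * X.P : ℤ) * X.fn k i).sum

/-- The records `R` represent a block of `2 ^ l * s` sampled points. -/
structure Bucket (l : ℕ) (S : List ℕ) (R : List (ℕ × ℤ)) : Prop where
  hR : R.length = X.s
  hS : S.length = 2 ^ l * X.s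
  sub : (R.map Prod.fst).Sublist S
  nonneg : ∀ r ∈ R, 0 ≤ r.2
  sum : (R.map Prod.snd).sum ≤ 2 ^ l * X.s * (X.len * X.P)
  err : ∀ k < X.N, X.Λ * |X.wsum k R - X.ssum k S| ≤ l * 2 ^ l * X.v0 + (2 ^ l - 1) * X.rnd

/-- Blocks of ranks `≥ l`, as many as `q` has binary digits `1`. -/
inductive Stack : ℕ → ℕ → List ℕ → List (ℕ × ℤ) → Prop where
  | zero (l : ℕ) : Stack l 0 [] []
  | even {l q : ℕ} {S : List ℕ} {R : List (ℕ × ℤ)} : Stack (l + 1) q S R → Stack l (2 * q) S R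
  | odd {l q : ℕ} {S S' : List ℕ} {R R' : List (ℕ × ℤ)} : Stack (l + 1) q S R →
      X.Bucket l S' R' → Stack l (2 * q + 1) (S ++ S') (R ++ R')

variable {X} {S S' S₁ S₂ : List ℕ} {R R' R₁ R₂ R₃ : List (ℕ × ℤ)} {l q : ℕ} {M : ℤ → ℤ} {L : ℕ}
  {ω : Tape L}

lemma wsum_append (k : ℕ) : X.wsum k (R₁ ++ R₂) = X.wsum k R₁ + X.wsum k R₂ := by simp [wsum]

lemma ssum_append (k : ℕ) : X.ssum k (S₁ ++ S₂) = X.ssum k S₁ + X.ssum k S₂ := by simp [ssum]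

/-- Records of points that have just been sampled. -/
def fresh (X : Env) (S : List ℕ) : List (ℕ × ℤ) := S.map fun i => (i, (X.len * X.P : ℤ))

lemma wsum_fresh (k : ℕ) : X.wsum k (X.fresh S) = X.ssum k S := by
  simp [wsum, ssum, fresh, List.map_map, Function.comp_def]

lemma bucket_fresh (hS : S.length = X.s) : X.Bucket 0 S (X.fresh S) where
  hR := by simp [fresh, hS]
  hS := by simp [hS]
  sub := by simp [fresh, List.map_map, Function.comp_def]
  nonneg := fun r hr => by
    obtain ⟨i, -, rfl⟩ := List.mem_map.1 hr
    positivity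
  sum := by simp [fresh, List.map_map, Function.comp_def, hS]
  err := fun k _ => by simp [wsum_fresh]

/-- The errors of the two halves and of the reduction add up to `2 (l 2^l v0 + (2^l - 1) rnd) + 2^l
v0 + rnd`, which leaves `2^l v0` to spare. A reduction never increases the total weight, so a
tolerance that doubles with the rank stays proportional to it. -/
lemma Bucket.merge (h₁ : X.Bucket l S₁ R₁) (h₂ : X.Bucket l S₂ R₂)
    (h : X.Reduces (X.v0 * 2 ^ l) (R₁ ++ R₂) R₃) : X.Bucket (l + 1) (S₁ ++ S₂) R₃ where
  hR := h.len
  hS := by rw [List.length_append, h₁.hS, h₂.hS]; ring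
  sub := h.sub.trans (by rw [List.map_append]; exact h₁.sub.append h₂.sub)
  nonneg := h.nonneg
  sum := by
    have := h.sum
    rw [List.map_append, List.sum_append] at this
    have e1 := h₁.sum
    have e2 := h₂.sum
    rw [pow_succ]
    linarith
  err := fun k hk => by
    have e1 := h₁.err k hk
    have e2 := h₂.err k hk
    have e3 := h.err k hk
    rw [wsum_append] at e3
    rw [ssum_append]
    have tri : |X.wsum k R₃ - (X.ssum k S₁ + X.ssum k S₂)|
        ≤ |X.wsum k R₃ - (X.wsum k R₁ + X.wsum k R₂)| + |X.wsum k R₁ - X.ssum k S₁|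
          + |X.wsum k R₂ - X.ssum k S₂| := by
      have : X.wsum k R₃ - (X.ssum k S₁ + X.ssum k S₂)
        = (X.wsum k R₃ - (X.wsum k R₁ + X.wsum k R₂)) + (X.wsum k R₁ - X.ssum k S₁)
          + (X.wsum k R₂ - X.ssum k S₂) := by ring
      rw [this]
      exact (abs_add_le _ _).trans (add_le_add_left (abs_add_le _ _) _)
    have h4 := mul_le_mul_of_nonneg_left tri (show (0 : ℤ) ≤ X.Λ by positivity)
    push_cast at e3 ⊢
    have h5 : (0 : ℤ) ≤ 2 ^ l * X.v0 := by positivity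
    rw [pow_succ]
    linarith

lemma Stack.inv (h : X.Stack l q S R) : (∀ r, q = 2 * r → X.Stack (l + 1) r S R) ∧
    (∀ r, q = 2 * r + 1 → ∃ S₁ R₁ S₂ R₂, S = S₁ ++ S₂ ∧ R = R₁ ++ R₂ ∧ X.Stack (l + 1) r S₁ R₁ ∧
      X.Bucket l S₂ R₂) := by
  cases h with
  | zero =>
    refine ⟨fun r hr => ?_, fun r hr => by omega⟩
    obtain rfl : r = 0 := by omega
    exact .zero _
  | even h =>
    refine ⟨fun r hr => ?_, fun r hr => by omega⟩
    obtain rfl : _ = r := Nat.mul_left_cancel (by norm_num) hr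
    exact h
  | odd h h' =>
    refine ⟨fun r hr => by omega, fun r hr => ?_⟩
    obtain rfl : _ = r := by
      have := Nat.succ_injective hr
      exact Nat.mul_left_cancel (by norm_num) this
    exact ⟨_, _, _, _, rfl, rfl, h, h'⟩

/-- After `l` carries the `l` lowest ranks are empty. -/
lemma Stack.lift (h : X.Stack l q S R) : X.Stack 0 (2 ^ l * q) S R := by
  induction l generalizing q with
  | zero => simpa using h
  | succ l ih =>
    have := ih h.even
    rwa [← mul_assoc, ← pow_succ] at this

lemma Stack.length (h : X.Stack l q S R) : S.length = 2 ^ l * q * X.s := by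
  induction h with
  | zero => simp
  | even h ih => rw [ih]; ring
  | odd h h' ih => rw [List.length_append, ih, h'.hS]; ring

lemma size_two_mul_add_one (q : ℕ) : (2 * q + 1).size = q.size + 1 := by
  have := Nat.size_bit (b := true) (n := q) (by simp [Nat.bit])
  simpa [Nat.bit] using this

lemma size_two_mul (q : ℕ) : q.size ≤ (2 * q).size := Nat.size_le_size (by omega)

lemma Stack.length_le (h : X.Stack l q S R) : R.length ≤ X.s * q.size := by
  induction h with
  | zero => simp
  | even h ih => exact ih.trans (Nat.mul_le_mul_left _ (size_two_mul _))
  | odd h h' ih => rw [List.length_append, h'.hR, size_two_mul_add_one, mul_add]; omega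

lemma Stack.sub (h : X.Stack l q S R) : (R.map Prod.fst).Sublist S := by
  induction h with
  | zero => simp
  | even h ih => exact ih
  | odd h h' ih => rw [List.map_append]; exact ih.append h'.sub

lemma Stack.nonneg (h : X.Stack l q S R) : ∀ r ∈ R, 0 ≤ r.2 := by
  induction h with
  | zero => simp
  | even h ih => exact ih
  | odd h h' ih =>
    intro r hr
    rcases List.mem_append.1 hr with hr | hr
    · exact ih r hr
    · exact h'.nonneg r hr

lemma Stack.sum_le (h : X.Stack l q S R) :
    (R.map Prod.snd).sum ≤ 2 ^ l * q * X.s * (X.len * X.P) := by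
  induction h with
  | zero => simp
  | even h ih => refine ih.trans (le_of_eq ?_); push_cast; ring
  | odd h h' ih =>
    rw [List.map_append, List.sum_append]
    refine (add_le_add ih h'.sum).trans (le_of_eq ?_)
    push_cast; ring

/-- The error per sampled block is at most the rank times `v0`, plus `rnd`; ranks stay below `l +
q.size`, and the block sizes `2 ^ rank` add up to `q * 2 ^ l`. -/
lemma Stack.err (h : X.Stack l q S R) {k : ℕ} (hk : k < X.N) :
    X.Λ * |X.wsum k R - X.ssum k S| ≤ q * 2 ^ l * ((l + q.size : ℕ) * X.v0 + X.rnd) := by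
  induction h with
  | zero => simp [wsum, ssum]
  | @even l q S R h ih =>
    refine ih.trans ?_
    rcases Nat.eq_zero_or_pos q with rfl | hq
    · simp
    · have h1 : (2 * q).size = q.size + 1 := by
        have := Nat.size_bit (b := false) (n := q) (by simp [Nat.bit]; omega)
        simpa [Nat.bit] using this
      rw [h1]
      refine le_of_eq ?_
      push_cast; ring
  | @odd l q S S' R R' h h' ih =>
    have e := h'.err k hk
    rw [wsum_append, ssum_append]
    have tri : |X.wsum k R + X.wsum k R' - (X.ssum k S + X.ssum k S')|
        ≤ |X.wsum k R - X.ssum k S| + |X.wsum k R' - X.ssum k S'| := by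
      rw [add_sub_add_comm]; exact abs_add_le _ _
    have h4 := mul_le_mul_of_nonneg_left tri (show (0 : ℤ) ≤ X.Λ by positivity)
    rw [size_two_mul_add_one]
    have h5 : (0 : ℤ) ≤ 2 ^ l * ((q.size + 1) * X.v0) := by positivity
    have h6 : (0 : ℤ) ≤ X.rnd := by positivity
    rw [pow_succ] at ih
    push_cast at ih ⊢
    linarith

/-- The records `R` are what is kept after the points `S` have been sampled. -/
def Kept (X : Env) (S : List ℕ) (R : List (ℕ × ℤ)) : Prop :=
  ∃ q S₁ R₁ S₂, X.Stack 0 q S₁ R₁ ∧ S = S₁ ++ S₂ ∧ R = R₁ ++ X.fresh S₂ ∧ S₂.length < X.s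

/-- Carry propagation. With a new block of rank `l` on top of a stack for `q`, cell `10` holds `s *
(q + 1)`. It is divisible by `2 * s` exactly if `q` is odd, that is, if the stack ends with a block
of the same rank `l`. A merge halves cell `10` and doubles the tolerance in cell `11`; `s * (q + 1)
* 2 ^ l` remains the number `T` of samples. -/
lemma mp_halveLoop (hX : X.Bounds) (hred : X.HasReductions) {T : ℕ} (hV : X.v0 * T ≤ X.Vmax)
    (hm : X.s * (T.size + 2) ≤ X.mmax) (hSn : ∀ i ∈ S, i < X.n)
    (h : ∃ S₁ R₁ S₂ R₂, X.Stack l q S₁ R₁ ∧ X.Bucket l S₂ R₂ ∧ S = S₁ ++ S₂ ∧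
      X.Holds M 0 (R₁ ++ R₂) ∧ M 0 = (R₁ ++ R₂).length)
    (hT : X.s * (q + 1) * 2 ^ l = T) (h10 : M 10 = (X.s * (q + 1) : ℕ))
    (h11 : M 11 = (X.v0 * 2 ^ l : ℕ)) (h1 : M 1 = X.E) (h4 : M 4 = X.P) (h5 : M 5 = X.Λ)
    (h6 : M 6 = X.s) :
    MP X.β X.S ω (halveLoop X.d X.Bc X.Hc) (fun M' => ∃ R q, X.Stack 0 q S R ∧
      X.Holds M' 0 R ∧ M' 0 = R.length ∧ ∀ a, 0 < a ∧ a < 10 ∨ a = 18 → M' a = M a) M := by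
  have hs1 := hX.hs1
  refine mp_loop (fun M' => ∃ l q, (∃ S₁ R₁ S₂ R₂, X.Stack l q S₁ R₁ ∧ X.Bucket l S₂ R₂ ∧
      S = S₁ ++ S₂ ∧ X.Holds M' 0 (R₁ ++ R₂) ∧ M' 0 = (R₁ ++ R₂).length) ∧
      X.s * (q + 1) * 2 ^ l = T ∧ M' 10 = (X.s * (q + 1) : ℕ) ∧ M' 11 = (X.v0 * 2 ^ l : ℕ) ∧
      ∀ a, 0 < a ∧ a < 10 ∨ a = 18 → M' a = M a) (fun M' => (M' 10).toNat)
    ⟨l, q, h, hT, h10, h11, fun _ _ => rfl⟩ ?_ ?_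
  · rintro M1 ⟨l, q, ⟨S₁, R₁, S₂, R₂, hst, hbk, rfl, hold, e0⟩, hT, e10, e11, f⟩ hne
    have e6 : M1 6 = X.s := by rw [f 6 (by norm_num), h6]
    obtain ⟨r, rfl⟩ : ∃ r, q = 2 * r + 1 := by
      rcases Nat.even_or_odd' q with ⟨r, rfl | rfl⟩
      · exfalso
        apply hne
        simp only [Expr.val, twoS, e10, e6]
        rw [if_neg]
        have e : ((X.s * (2 * r + 1) : ℕ) : ℤ) = X.s + 2 * X.s * r := by push_cast; ring
        rw [e, Int.add_mul_ediv_left _ _ (by omega), Int.ediv_eq_zero_of_lt (by omega) (by omega)]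
        have : 2 * (X.s : ℤ) * (0 + r) = 2 * X.s * r := by ring
        omega
      · exact ⟨r, rfl⟩
    obtain ⟨S₀, R₀, S₁', R₁', rfl, rfl, hst', hbk'⟩ := hst.inv.2 r rfl
    have hTle : 2 ^ (l + 1) ≤ T := by
      rw [← hT, pow_succ, mul_comm]
      have : 2 ≤ X.s * (2 * r + 1 + 1) := by nlinarith
      exact Nat.mul_le_mul_right _ this
    have hq : 2 * r + 1 ≤ T := by
      rw [← hT]
      have : 1 ≤ 2 ^ l := Nat.one_le_two_pow
      calc 2 * r + 1 ≤ 1 * (2 * r + 1 + 1) * 1 := by omega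
        _ ≤ _ := by gcongr
    have hlen1 := hst.length_le
    have hsz := Nat.size_le_size hq
    have hcap : (R₀ ++ R₁').length + X.s ≤ X.mmax := by
      refine le_trans ?_ hm
      have : X.s * (2 * r + 1).size ≤ X.s * T.size := Nat.mul_le_mul_left _ hsz
      rw [mul_add]; omega
    rw [List.length_append, hbk'.hR] at hcap
    have hlen2 : (R₁' ++ R₂).length = 2 * X.s := by
      rw [List.length_append, hbk'.hR, hbk.hR]; ring
    have hvle : X.v0 * 2 ^ l * 2 ≤ X.Vmax := by
      refine le_trans ?_ hV
      rw [mul_assoc, ← pow_succ]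
      exact Nat.mul_le_mul_left _ hTle
    refine mp_seq ((mp_reduce hX hred (R₁ := R₀) (R₂ := R₁' ++ R₂) (v := X.v0 * 2 ^ l)
      (by omega) hlen2 (fun p hp => ?_) ?_ (by omega) (by rwa [← List.append_assoc]) ?_
      (by rw [f 1 (by norm_num), h1]) (by rw [f 4 (by norm_num), h4])
      (by rw [f 5 (by norm_num), h5]) e6 e11).mono ?_)
    · rcases List.mem_append.1 hp with hp | hp
      · exact ⟨hbk'.nonneg p hp, hSn _ (by
          have := hbk'.sub.subset (List.mem_map_of_mem hp); simp [this])⟩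
      · exact ⟨hbk.nonneg p hp, hSn _ (by
          have := hbk.sub.subset (List.mem_map_of_mem hp); simp [this])⟩
    · have a1 := hbk'.sum
      have a2 := hbk.sum
      rw [List.map_append, List.sum_append]
      have a3 := mul_le_mul_of_nonneg_right (add_le_add a1 a2) (show (0 : ℤ) ≤ X.P by positivity)
      refine a3.trans (le_of_eq ?_)
      rw [v0]; push_cast; ring
    · rw [e0, List.append_assoc, List.length_append, hlen2]
    rintro M2 ⟨R₃, hR₃, hold2, e0', f2⟩
    have hbk3 := hbk'.merge hbk hR₃
    have g10 : M2 10 = (X.s * (2 * r + 1 + 1) : ℕ) := by rw [f2 10 (by norm_num) (by norm_num) (by norm_num) (by norm_num), e10]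
    have g11 : M2 11 = (X.v0 * 2 ^ l : ℕ) := by rw [f2 11 (by norm_num) (by norm_num) (by norm_num) (by norm_num), e11]
    have hS := hX.hS
    have h25 : 25 ≤ X.S := by
      have := le_adr (d := X.d) (i := X.mmax) (t := 2 * X.s) (by omega) (by omega)
      omega
    have hsrβ : X.s * (r + 1) ≤ X.β := by
      have e1 : X.s * (r + 1) ≤ T := by
        rw [← hT]
        have : 1 ≤ 2 ^ l := Nat.one_le_two_pow
        calc X.s * (r + 1) = X.s * (r + 1) * 1 := by ring
          _ ≤ X.s * (2 * r + 1 + 1) * 2 ^ l := by gcongr; omega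
      have e2 : 1 * T ≤ X.v0 * T := by
        refine Nat.mul_le_mul_right _ ?_
        have := hX.hP; have := hX.hlen
        rw [v0]
        exact Nat.mul_pos (Nat.mul_pos (Nat.mul_pos (by omega) (by omega)) (by omega)) (by omega)
      have := hX.hV
      omega
    refine mp_seq (mp_reg (v := (X.s * (r + 1) : ℕ)) ?_ (by norm_num) h25 ?_ ?_)
    · simp only [Expr.val, g10]
      have : ((X.s * (2 * r + 1 + 1) : ℕ) : ℤ) = (X.s * (r + 1) : ℕ) * 2 := by push_cast; ring
      rw [this, Int.mul_ediv_cancel _ (by norm_num)]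
    · rw [abs_of_nonneg (by positivity)]; exact_mod_cast hsrβ
    refine mp_reg (v := (X.v0 * 2 ^ (l + 1) : ℕ)) ?_ (by norm_num) h25 ?_ ?_
    · simp only [Expr.val]
      rw [Function.update_of_ne (by norm_num), g11]
      push_cast; ring
    · rw [abs_of_nonneg (by positivity)]
      have := hX.hV
      have e : X.v0 * 2 ^ (l + 1) = X.v0 * 2 ^ l * 2 := by ring
      rw [e]
      have : X.v0 * 2 ^ l * 2 ≤ X.β := by omega
      exact_mod_cast this
    · have fr : ∀ a, a ≠ 10 → a ≠ 11 → Function.update (Function.update M2 10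
          ((X.s * (r + 1) : ℕ) : ℤ)) 11 ((X.v0 * 2 ^ (l + 1) : ℕ) : ℤ) a = M2 a := fun a b1 b2 => by
        rw [Function.update_of_ne b2, Function.update_of_ne b1]
      refine ⟨⟨l + 1, r, ⟨S₀, R₀, S₁' ++ S₂, R₃, hst', hbk3, by simp, ?_, ?_⟩, ?_, ?_, by simp, ?_⟩, ?_⟩
      · refine hold2.congr fun a ha _ => fr a ?_ ?_ <;>
        · have := le_adr (d := X.d) (i := 0) (t := 0) le_rfl le_rfl
          omega
      · rw [fr 0 (by norm_num) (by norm_num), e0', List.length_append, hbk3.hR]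
      · rw [← hT]; ring
      · simp
      · intro a ha
        rw [fr a (by omega) (by omega), f2 a (by omega) (by omega) (by omega) (by omega), f a ha]
      · rw [e10, Function.update_of_ne (by norm_num), Function.update_self]
        simp only [Int.toNat_natCast]
        have : X.s * (2 * r + 1 + 1) = X.s * (r + 1) + X.s * (r + 1) := by ring
        have : 1 ≤ X.s * (r + 1) := Nat.mul_pos hs1 (by omega)
        omega
  · rintro M1 ⟨l, q, ⟨S₁, R₁, S₂, R₂, hst, hbk, rfl, hold, e0⟩, hT, e10, e11, f⟩ he
    have e6 : M1 6 = X.s := by rw [f 6 (by norm_num), h6]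
    obtain ⟨r, rfl⟩ : ∃ r, q = 2 * r := by
      rcases Nat.even_or_odd' q with ⟨r, rfl | rfl⟩
      · exact ⟨r, rfl⟩
      · exfalso
        revert he
        simp only [Expr.val, twoS, e10, e6]
        have e : ((X.s * (2 * r + 1 + 1) : ℕ) : ℤ) = 2 * X.s * (r + 1) := by push_cast; ring
        rw [e, Int.mul_ediv_cancel_left _ (by omega)]
        simp
    exact ⟨R₁ ++ R₂, _, ((hst.inv.1 r rfl).odd hbk).lift, hold, e0, f⟩

lemma mp_cascade (hX : X.Bounds) (hred : X.HasReductions) {i : ℕ}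
    (hV : X.v0 * (S.length + 1) ≤ X.Vmax) (hm : X.s * ((S.length + 1).size + 2) ≤ X.mmax)
    (hSn : ∀ j ∈ S ++ [i], j < X.n) (hK : X.Kept S R) (hold : X.Holds M 0 (R ++ X.fresh [i]))
    (h0 : M 0 = (R.length + 1 : ℕ)) (h18 : M 18 = (S.length + 1 : ℕ)) (h7 : M 7 = X.len)
    (h1 : M 1 = X.E) (h4 : M 4 = X.P) (h5 : M 5 = X.Λ) (h6 : M 6 = X.s) :
    MP X.β X.S ω (cascade X.d X.Bc X.Hc) (fun M' => ∃ R, X.Kept (S ++ [i]) R ∧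
      X.Holds M' 0 R ∧ M' 0 = R.length ∧ ∀ a, 0 < a ∧ a < 10 ∨ a = 18 → M' a = M a) M := by
  have hs1 := hX.hs1
  have h25 : 25 ≤ X.S := by
    have := le_adr (d := X.d) (i := X.mmax) (t := 2 * X.s) (by omega) (by omega)
    have := hX.hS
    omega
  have hv0 : 1 ≤ X.v0 := by
    have := hX.hP; have := hX.hlen
    rw [v0]
    exact Nat.mul_pos (Nat.mul_pos (Nat.mul_pos (by omega) (by omega)) (by omega)) (by omega)
  have hVβ := hX.hV
  obtain ⟨q, S₁, R₁, S₂, hst, rfl, rfl, hlt⟩ := hK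
  set T := (S₁ ++ S₂).length + 1 with hT
  have hTβ : T ≤ X.β := by nlinarith
  have hvβ : X.v0 ≤ X.β := by nlinarith
  refine mp_seq (mp_reg (v := (T : ℕ)) h18 (by norm_num) h25 ?_ ?_)
  · rw [abs_of_nonneg (by positivity)]; exact_mod_cast hTβ
  refine mp_seq (mp_reg (v := (X.v0 : ℕ)) ?_ (by norm_num) h25 ?_ ?_)
  · simp [Expr.val, twoS, h6, h7, h4, v0]
  · rw [abs_of_nonneg (by positivity)]; exact_mod_cast hvβ
  set M1 := Function.update (Function.update M 10 (T : ℤ)) 11 (X.v0 : ℤ) with hM1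
  have f1 : ∀ a, a ≠ 10 → a ≠ 11 → M1 a = M a := fun a b1 b2 => by
    rw [hM1, Function.update_of_ne b2, Function.update_of_ne b1]
  have hold1 : X.Holds M1 0 (R₁ ++ X.fresh S₂ ++ X.fresh [i]) := by
    refine hold.congr fun a ha _ => f1 a ?_ ?_ <;>
    · have := le_adr (d := X.d) (i := 0) (t := 0) le_rfl le_rfl
      omega
  have hfr : X.fresh S₂ ++ X.fresh [i] = X.fresh (S₂ ++ [i]) := by simp [fresh]
  rw [List.append_assoc, hfr] at hold1
  have hlen0 : M1 0 = (R₁ ++ X.fresh (S₂ ++ [i])).length := by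
    rw [f1 0 (by norm_num) (by norm_num), h0]
    simp [fresh]
    ring
  have hS₁ := hst.length
  rw [pow_zero, one_mul] at hS₁
  have hTeq : T = q * X.s + S₂.length + 1 := by rw [hT, List.length_append, hS₁]
  rcases (Nat.succ_le_of_lt hlt).eq_or_lt with heq | hlt'
  · have hTeq' : X.s * (q + 1) = T := by rw [hTeq, add_assoc, show S₂.length + 1 = X.s from heq]; ring
    refine (mp_halveLoop (S := S₁ ++ S₂ ++ [i]) (l := 0) (q := q) hX hred hV hm hSn
      ⟨S₁, R₁, S₂ ++ [i], X.fresh (S₂ ++ [i]), hst, bucket_fresh (by simpa using heq), by simp,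
        hold1, hlen0⟩ (by rw [pow_zero, mul_one, hTeq']) ?_ ?_
      (by rw [f1 1 (by norm_num) (by norm_num), h1]) (by rw [f1 4 (by norm_num) (by norm_num), h4])
      (by rw [f1 5 (by norm_num) (by norm_num), h5])
      (by rw [f1 6 (by norm_num) (by norm_num), h6])).mono ?_
    · rw [hTeq']; simp [hM1]
    · simp [hM1]
    · rintro M2 ⟨R', q', hst', hold2, e0, f2⟩
      refine ⟨R', ⟨q', _, R', [], hst', by simp, by simp [fresh], by simpa using Nat.lt_of_lt_of_le Nat.zero_lt_one hs1⟩, hold2, e0,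
        fun a ha => ?_⟩
      rw [f2 a ha, f1 a (by omega) (by omega)]
  -- The new sample does not complete a block of `s` points, so `T` is not a multiple of `s` and the
  -- loop ends at once.
  · refine mp_loop (fun M' => M' = M1) (fun _ => 0) rfl ?_ ?_
    · rintro M2 rfl hne
      exfalso
      apply hne
      simp only [Expr.val, twoS, f1 6 (by norm_num) (by norm_num), h6]
      have e10 : M1 10 = (T : ℤ) := by simp [hM1]
      rw [e10, if_neg]
      have hmod : 1 ≤ T % (2 * X.s) := by
        by_contra hcon
        have h0 : T % (2 * X.s) = 0 := by omega
        have h2 : T % X.s = 0 := Nat.mod_eq_zero_of_dvd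
          ((Dvd.intro_left 2 rfl).trans (Nat.dvd_of_mod_eq_zero h0))
        rw [hTeq, add_assoc, Nat.mul_add_mod_self_right, Nat.mod_eq_of_lt hlt'] at h2
        omega
      have hcast : (T : ℤ) - 2 * X.s * (T / (2 * X.s)) = ((T % (2 * X.s) : ℕ) : ℤ) := by
        push_cast
        rw [Int.emod_def]
      rw [hcast]
      omega
    · rintro M2 rfl -
      refine ⟨_, ⟨q, S₁, R₁, S₂ ++ [i], hst, by simp, rfl, by simpa using hlt'⟩, hold1, hlen0,
        fun a ha => f1 a (by omega) (by omega)⟩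

end Env

/-! ### Reading the stream -/

/-- Address of the first free record. -/
def slotE (d : ℕ) : Expr := .add (.const (1 + 24 * (d + 1))) (.mul (reg 0) (.const (d + 1)))

def readCoords (d : ℕ) : ℕ → Program
  | 0 => .skip
  | k + 1 => .seq (readCoords d k) (.read (.add (slotE d) (.const k)))

/-- Position of the current point in its block. -/
def posE : Expr := .sub (reg 8) (.mul (reg 7) (.div (reg 8) (reg 7)))

/-- Keep the point that has just been read. -/
def push (d Bc Hc : ℕ) : Program :=
  .seq (.store (.add (slotE d) (.const d)) (.mul (reg 7) (reg 4)))
    (.seq (incr 0) (.seq (incr 18) (cascade d Bc Hc)))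

/-- One random word is drawn at the first position of each block. Every point is read into the first
free slot; keeping it means advancing the number of records, otherwise the next point overwrites it.
-/
def processPoint (d Bc Hc : ℕ) : Program :=
  .seq (.cond (.lt posE (.const 1)) drawMod .skip)
    (.seq (readCoords d d) (.seq (.cond (.sub posE (reg 9)) .skip (push d Bc Hc)) (incr 8)))

def mainLoop (d Bc Hc : ℕ) : Program := .loop (.lt (reg 8) (reg 3)) (processPoint d Bc Hc)

lemma IExec.bounded {β S L : ℕ} {ω : Tape L} {P : Program} {c c' : Config}
    (h : IExec β S ω P c c') (hM : ∀ a, |c.mem a| ≤ β) : ∀ a, |c'.mem a| ≤ β := by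
  induction h with
  | skip c => exact hM
  | store a e c h0 hS hβ => exact abs_update_le hM hβ
  | read a c h0 hS hβ => exact abs_update_le hM hβ
  | drawMod c k hk hS =>
    refine abs_update_le hM ?_
    have h7 := hM 7
    have hp : 0 < c.mem 7 := by rw [hk]; positivity
    rw [abs_of_pos hp] at h7
    rw [abs_of_nonneg (Int.emod_nonneg _ hp.ne')]
    exact (Int.emod_lt_of_pos _ hp).le.trans h7
  | seq _ _ ih1 ih2 => exact ih2 (ih1 hM)
  | cond_true _ _ ih => exact ih hM
  | cond_false _ _ ih => exact ih hM
  | loop_true _ _ _ ih1 ih2 => exact ih2 (ih1 hM)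
  | loop_false _ => exact hM

namespace Env

variable (X : Env)

/-- Coordinates of the `i`-th point. -/
def row (i : ℕ) : List ℤ := (List.range X.d).map (X.Z i)

/-- What remains of the stream after `i` points. -/
def rest (i : ℕ) : List ℤ := ((List.range X.n).drop i).flatMap X.row

/-- The points among the first `i` ones that are sampled. -/
def sampled {L : ℕ} (ω : Tape L) (i : ℕ) : List ℕ :=
  (List.range i).filter fun j => j % X.len = (ω (j / X.len) : ℕ) % X.len

/-- Contents of the registers that do not change while the stream is read. -/
structure Regs (M : ℤ → ℤ) : Prop where
  h1 : M 1 = X.E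
  h3 : M 3 = X.n
  h4 : M 4 = X.P
  h5 : M 5 = X.Λ
  h6 : M 6 = X.s
  h7 : M 7 = X.len

/-- The state of the computation before the `i`-th point. -/
structure Inv {L : ℕ} (ω : Tape L) (i : ℕ) (c : Config) : Prop where
  regs : X.Regs c.mem
  h8 : c.mem 8 = i
  h18 : c.mem 18 = (X.sampled ω i).length
  input : c.input = X.rest i
  drawn : c.drawn = if i % X.len = 0 then i / X.len else i / X.len + 1
  h9 : i % X.len ≠ 0 → c.mem 9 = ((ω (i / X.len) : ℕ) : ℤ) % X.len
  kept : ∃ R, X.Kept (X.sampled ω i) R ∧ X.Holds c.mem 0 R ∧ c.mem 0 = R.length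

variable {X} {M M' : ℤ → ℤ} {L : ℕ} {ω : Tape L} {R : List (ℕ × ℤ)} {c : Config} {i : ℕ}

lemma Regs.congr (h : X.Regs M) (hM : ∀ a, 0 < a → a < 8 → M' a = M a) : X.Regs M' where
  h1 := by rw [hM 1 (by norm_num) (by norm_num), h.h1]
  h3 := by rw [hM 3 (by norm_num) (by norm_num), h.h3]
  h4 := by rw [hM 4 (by norm_num) (by norm_num), h.h4]
  h5 := by rw [hM 5 (by norm_num) (by norm_num), h.h5]
  h6 := by rw [hM 6 (by norm_num) (by norm_num), h.h6]
  h7 := by rw [hM 7 (by norm_num) (by norm_num), h.h7]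

lemma rest_eq (hi : i < X.n) : X.rest i = X.row i ++ X.rest (i + 1) := by
  unfold rest
  rw [List.drop_eq_getElem_cons (by simpa using hi)]
  simp

lemma wp_readCoords (hX : X.Bounds) (hi : i < X.n) {m : ℕ} (h0 : c.mem 0 = m) (hm : m < X.mmax)
    (hin : c.input = X.rest i) (k : ℕ) (hk : k ≤ X.d) :
    WP X.β X.S ω (readCoords X.d k) (fun c' => c'.drawn = c.drawn ∧
      c'.input = (X.row i).drop k ++ X.rest (i + 1) ∧ (∀ t < k, c'.mem (adr X.d m t) = X.Z i t) ∧
      ∀ a, a < adr X.d m 0 → c'.mem a = c.mem a) c := by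
  induction k with
  | zero => exact wp_skip ⟨rfl, by rw [hin, rest_eq hi]; simp, by simp, fun _ _ => rfl⟩
  | succ k ih =>
    refine wp_seq ((ih (by omega)).mono ?_)
    rintro c1 ⟨hd, hin1, hz, f⟩
    have h25 := le_adr (d := X.d) (i := m) (t := 0) (by omega) le_rfl
    have hadr : Expr.val c1.mem (.add (slotE X.d) (.const k)) = adr X.d m k := by
      simp only [Expr.val, slotE, f 0 (by omega), h0, adr]
    have hrow : (X.row i).drop k = X.Z i k :: (X.row i).drop (k + 1) := by
      rw [List.drop_eq_getElem_cons (by simp [row]; omega)]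
      simp [row]
    have hhead : c1.input.headD 0 = X.Z i k := by rw [hin1, hrow]; rfl
    have htail : c1.input.tail = (X.row i).drop (k + 1) ++ X.rest (i + 1) := by
      rw [hin1, hrow]; rfl
    have hkn : 25 ≤ adr X.d m k := le_adr (by omega) (by omega)
    refine wp_read (by rw [hadr]; omega) ?_ (by rw [hhead]; exact hX.hp i hi k hk) ?_
    · rw [hadr]
      have h1 := hX.hS
      have h2 : adr X.d m k < adr X.d X.mmax 0 := adr_lt_adr (by omega) (by omega) le_rfl
      unfold adr at h1 h2 ⊢
      omega
    · rw [hadr, hhead]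
      refine ⟨hd, htail, fun t ht => ?_, fun a ha => ?_⟩
      · simp only
        rcases Nat.lt_succ_iff_lt_or_eq.1 ht with ht' | rfl
        · rw [Function.update_of_ne (by unfold adr; omega), hz t ht']
        · rw [Function.update_self]
      · simp only
        rw [Function.update_of_ne (by unfold adr at ha ⊢; omega), f a ha]

lemma sampled_succ : X.sampled ω (i + 1) = X.sampled ω i ++
    if i % X.len = (ω (i / X.len) : ℕ) % X.len then [i] else [] := by
  unfold sampled
  rw [List.range_succ, List.filter_append]
  simp [List.filter_cons]

lemma nodup_sampled : (X.sampled ω i).Nodup := List.nodup_range.filter _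

lemma lt_of_mem_sampled {j : ℕ} (h : j ∈ X.sampled ω i) : j < i := by
  simpa using (List.mem_filter.1 h).1

/-- A block contributes at most one position, so `j ↦ j / len` is injective on the sample. -/
lemma length_sampled_le : (X.sampled ω (i + 1)).length ≤ i / X.len + 1 := by
  have hinj : ((X.sampled ω (i + 1)).map fun j => j / X.len).Nodup := by
    refine nodup_sampled.map_on fun j hj j' hj' he => ?_
    have h1 : j % X.len = (ω (j / X.len) : ℕ) % X.len := by simpa using (List.mem_filter.1 hj).2
    have h2 : j' % X.len = (ω (j' / X.len) : ℕ) % X.len := by simpa using (List.mem_filter.1 hj').2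
    rw [← Nat.div_add_mod j X.len, ← Nat.div_add_mod j' X.len, h1, h2, he]
  have hsub : ((X.sampled ω (i + 1)).map fun j => j / X.len).toFinset ⊆ range (i / X.len + 1) := by
    intro x hx
    obtain ⟨j, hj, rfl⟩ := List.mem_map.1 (List.mem_toFinset.1 hx)
    have := lt_of_mem_sampled hj
    exact mem_range.2 (Nat.lt_succ_of_le (Nat.div_le_div_right (by omega)))
  have := card_le_card hsub
  rwa [List.toFinset_card_of_nodup hinj, List.length_map, card_range] at this

/-- Room for the records. -/
structure Room (X : Env) : Prop where
  hlen : ∃ κ, X.len = 2 ^ κ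
  hn : X.n ≤ X.β
  hV : X.v0 * (X.n / X.len + 1) ≤ X.Vmax
  hm : X.s * ((X.n / X.len + 1).size + 2) ≤ X.mmax

/-- The memory holds at most one block of `s` records for each binary digit of the counter, and
fewer than `s` fresh records. -/
lemma Kept.length_lt (hX : X.Bounds) (hr : X.Room) {S : List ℕ} (hK : X.Kept S R)
    (hS : S.length ≤ X.n / X.len + 1) : R.length < X.mmax := by
  obtain ⟨q, S₁, R₁, S₂, hst, rfl, rfl, hlt⟩ := hK
  have h1 := hst.length
  have h2 := hst.length_le
  rw [pow_zero, one_mul] at h1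
  have h3 : q ≤ X.n / X.len + 1 := by
    rw [List.length_append] at hS
    have := Nat.le_mul_of_pos_right q hX.hs1
    omega
  have h4 := Nat.mul_le_mul_left X.s (Nat.size_le_size h3)
  have h5 := hr.hm
  rw [mul_add] at h5
  rw [List.length_append, fresh, List.length_map]
  omega

lemma WP.of_mp {P : Program} {β S : ℕ} {Q : (ℤ → ℤ) → Prop}
    (h : MP β S ω P Q c.mem) :
    WP β S ω P (fun c' => c'.input = c.input ∧ c'.drawn = c.drawn ∧ Q c'.mem) c := h _ _

lemma val_posE {M : ℤ → ℤ} {i l : ℕ} (h7 : M 7 = l) (h8 : M 8 = i) :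
    posE.val M = ((i % l : ℕ) : ℤ) := by
  simp only [posE, Expr.val, h7, h8]
  push_cast
  rw [Int.emod_def]

lemma wp_processPoint (hX : X.Bounds) (hr : X.Room) (hred : X.HasReductions) (hi : i < X.n)
    (hc : X.Inv ω i c) :
    WP X.β X.S ω (processPoint X.d X.Bc X.Hc) (X.Inv ω (i + 1)) c := by
  obtain ⟨R, hK, hold, h0⟩ := hc.kept
  have h25 : 25 ≤ X.S := by
    have := le_adr (d := X.d) (i := X.mmax) (t := 2 * X.s) (by omega) (by omega)
    have := hX.hS
    omega
  have hlen := hX.hlen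
  have hlen1 : (X.sampled ω i).length ≤ X.n / X.len + 1 := by
    have h1 := length_sampled_le (X := X) (ω := ω) (i := i)
    rw [sampled_succ, List.length_append] at h1
    have := Nat.div_le_div_right (c := X.len) hi.le
    omega
  have hRm := hK.length_lt hX hr hlen1
  have hmβ := hX.hm
  refine wp_seq (WP.mono (Q := fun c1 => (∀ a, a ≠ 9 → c1.mem a = c.mem a) ∧
    c1.mem 9 = ((ω (i / X.len) : ℕ) : ℤ) % X.len ∧ c1.drawn = i / X.len + 1 ∧
    c1.input = c.input) (wp_cond ?_ ?_) ?_)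
  · intro hne
    have hmod : i % X.len = 0 := by
      by_contra hcon
      apply hne
      simp only [Expr.val, val_posE hc.regs.h7 hc.h8]
      rw [if_neg]; omega
    obtain ⟨κ, hκ⟩ := hr.hlen
    have hd : c.drawn = i / X.len := by rw [hc.drawn, if_pos hmod]
    refine ⟨_, .drawMod c κ (by rw [hc.regs.h7, hκ]; push_cast; rfl) (by omega),
      fun a ha => Function.update_of_ne ha _ _, ?_, ?_, rfl⟩
    · simp only [Function.update_self, hc.regs.h7, hd]
    · simp only [hd]
  · intro he
    have hmod : i % X.len ≠ 0 := by
      intro hcon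
      simp [Expr.val, val_posE hc.regs.h7 hc.h8, hcon] at he
    exact wp_skip ⟨fun _ _ => rfl, hc.h9 hmod, by rw [hc.drawn, if_neg hmod], rfl⟩
  rintro c1 ⟨f1, e9, ed, ein⟩
  have hR0 : X.Regs c1.mem := hc.regs.congr fun a _ ha => f1 a (by omega)
  refine wp_seq ((wp_readCoords hX hi (c := c1) (m := R.length) (by rw [f1 0 (by norm_num), h0]) hRm
    (by rw [ein, hc.input]) X.d le_rfl).mono ?_)
  rintro c2 ⟨ed2, ein2, hz, f2⟩
  have hrow : (X.row i).drop X.d = [] := List.drop_eq_nil_of_le (by simp [row])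
  rw [hrow, List.nil_append] at ein2
  have hadr25 : 25 ≤ adr X.d R.length 0 := le_adr (by omega) le_rfl
  have g2 : ∀ a, a < adr X.d R.length 0 → a ≠ 9 → c2.mem a = c.mem a := fun a h1 h2 => by
    rw [f2 a h1, f1 a h2]
  have hR2 : X.Regs c2.mem := hc.regs.congr fun a _ ha => g2 a (by omega) (by omega)
  have e82 : c2.mem 8 = i := by rw [g2 8 (by omega) (by norm_num), hc.h8]
  have e92 : c2.mem 9 = (((ω (i / X.len) : ℕ) % X.len : ℕ) : ℤ) := by
    rw [f2 9 (by omega), e9]; push_cast; rfl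
  have e02 : c2.mem 0 = R.length := by rw [g2 0 (by omega) (by norm_num), h0]
  have e182 : c2.mem 18 = (X.sampled ω i).length := by
    rw [g2 18 (by omega) (by norm_num), hc.h18]
  have hold2 : X.Holds c2.mem 0 R := hold.congr fun a h1 h2 => by
    have := le_adr (d := X.d) (i := 0) (t := 0) le_rfl le_rfl
    rw [zero_add] at h2
    exact g2 a h2 (by omega)
  refine wp_seq (WP.mono (Q := fun c3 => c3.input = X.rest (i + 1) ∧ c3.drawn = i / X.len + 1 ∧
    (∀ a, 0 < a → a < 10 → c3.mem a = c2.mem a) ∧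
    c3.mem 18 = (X.sampled ω (i + 1)).length ∧
    ∃ R, X.Kept (X.sampled ω (i + 1)) R ∧ X.Holds c3.mem 0 R ∧ c3.mem 0 = R.length)
    (wp_cond ?_ ?_) ?_)
  · intro hne
    have hns : ¬ i % X.len = (ω (i / X.len) : ℕ) % X.len := by
      intro hcon
      apply hne
      have : Expr.val c2.mem (.sub posE (reg 9)) = posE.val c2.mem - c2.mem 9 := rfl
      rw [this, val_posE hR2.h7 e82, e92, hcon, sub_self]
    have hS' : X.sampled ω (i + 1) = X.sampled ω i := by rw [sampled_succ, if_neg hns, List.append_nil]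
    rw [hS']
    exact wp_skip ⟨ein2, by rw [ed2, ed], fun _ _ _ => rfl, e182, R, hK, hold2, e02⟩
  · intro he
    have hs : i % X.len = (ω (i / X.len) : ℕ) % X.len := by
      have : Expr.val c2.mem (.sub posE (reg 9)) = posE.val c2.mem - c2.mem 9 := rfl
      rw [this, val_posE hR2.h7 e82, e92] at he
      omega
    have hS' : X.sampled ω (i + 1) = X.sampled ω i ++ [i] := by rw [sampled_succ, if_pos hs]
    have hT : (X.sampled ω i).length + 1 ≤ X.n / X.len + 1 := by
      have h1 := length_sampled_le (X := X) (ω := ω) (i := i)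
      rw [hS', List.length_append, List.length_singleton] at h1
      have := Nat.div_le_div_right (c := X.len) hi.le
      omega
    rw [hS']
    have hVβ := hX.hV
    have hP := hX.hP
    have hs1 := hX.hs1
    have hv := hr.hV
    have hv0 : X.len * X.P ≤ X.v0 := by
      rw [v0]
      calc X.len * X.P = 1 * X.len * X.P * 1 := by ring
        _ ≤ 2 * X.s * X.len * X.P * X.P := by gcongr; omega
    have hv1 : X.v0 ≤ X.v0 * (X.n / X.len + 1) := Nat.le_mul_of_pos_right _ (by omega)
    have hTβ : X.n / X.len + 1 ≤ X.v0 * (X.n / X.len + 1) := by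
      have : 1 ≤ X.len * X.P := Nat.mul_pos hlen hP
      exact Nat.le_mul_of_pos_left _ (by omega)
    have hadr : Expr.val c2.mem (.add (slotE X.d) (.const X.d)) = adr X.d R.length X.d := by
      simp only [Expr.val, slotE, e02, adr]
    have hadrS : adr X.d R.length X.d < X.S := by
      have h1 := hX.hS
      have h2 : adr X.d R.length X.d < adr X.d X.mmax 0 := adr_lt_adr (by omega) le_rfl le_rfl
      unfold adr at h1 h2 ⊢
      omega
    have h25d : 25 ≤ adr X.d R.length X.d := le_adr (by omega) (by omega)
    refine (WP.of_mp (Q := fun M' => ∃ R, X.Kept (X.sampled ω i ++ [i]) R ∧ X.Holds M' 0 R ∧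
      M' 0 = R.length ∧ (∀ a, 0 < a → a < 10 → M' a = c2.mem a) ∧
      M' 18 = (X.sampled ω i ++ [i]).length) ?_).mono ?_
    · refine mp_seq (mp_store (v := X.len * X.P) hadr ?_ (by omega) hadrS ?_ ?_)
      · simp only [Expr.val, hR2.h7, hR2.h4]
      · rw [abs_of_nonneg (by positivity)]
        have : X.len * X.P ≤ X.β := by omega
        exact_mod_cast this
      set M3 := Function.update c2.mem (adr X.d R.length X.d) (X.len * X.P : ℤ) with hM3
      have f3 : ∀ a, a ≠ adr X.d R.length X.d → M3 a = c2.mem a :=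
        fun a ha => Function.update_of_ne ha _ _
      refine mp_seq (mp_reg (v := (R.length + 1 : ℕ)) ?_ (by norm_num) h25 ?_ ?_)
      · simp [Expr.val, f3 0 (by omega), e02]
      · rw [abs_of_nonneg (by positivity)]
        have : R.length + 1 ≤ X.β := by omega
        exact_mod_cast this
      refine mp_seq (mp_reg (v := ((X.sampled ω i).length + 1 : ℕ)) ?_ (by norm_num) h25 ?_ ?_)
      · simp [Expr.val, f3 18 (by omega), e182]
      · rw [abs_of_nonneg (by positivity)]
        have : (X.sampled ω i).length + 1 ≤ X.β := by omega
        exact_mod_cast this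
      set M4 := Function.update (Function.update M3 0 ((R.length + 1 : ℕ) : ℤ)) 18
        (((X.sampled ω i).length + 1 : ℕ) : ℤ) with hM4
      have f4 : ∀ a, a ≠ 0 → a ≠ 18 → M4 a = M3 a := fun a b1 b2 => by
        rw [hM4, Function.update_of_ne b2, Function.update_of_ne b1]
      have f43 : ∀ a, a ≠ 0 → a ≠ 18 → a ≠ adr X.d R.length X.d → M4 a = c2.mem a :=
        fun a b1 b2 b3 => by rw [f4 a b1 b2, f3 a b3]
      have hR4 : X.Regs M4 := hR2.congr fun a b1 b2 => f43 a (by omega) (by omega) (by omega)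
      have hold4 : X.Holds M4 0 (R ++ X.fresh [i]) := by
        rw [holds_append]
        constructor
        · refine hold2.congr fun a b1 b2 => f43 a ?_ ?_ ?_
          · have := le_adr (d := X.d) (i := 0) (t := 0) le_rfl le_rfl
            omega
          · have := le_adr (d := X.d) (i := 0) (t := 0) le_rfl le_rfl
            omega
          · rw [zero_add] at b2
            unfold adr at b2 ⊢
            omega
        · intro j r hj
          obtain ⟨rfl, rfl⟩ : j = 0 ∧ r = (i, (X.len * X.P : ℤ)) := by
            have : j < 1 := by simpa [fresh] using (List.getElem?_eq_some_iff.1 hj).1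
            obtain rfl : j = 0 := by omega
            exact ⟨rfl, by simpa [fresh] using hj.symm⟩
          have ez : (0 : ℤ) + R.length + ((0 : ℕ) : ℤ) = R.length := by simp
          rw [ez]
          constructor
          · intro t ht
            have := le_adr (d := X.d) (i := R.length) (t := t) (by omega) (by omega)
            rw [f43 _ (by omega) (by omega) (by unfold adr; omega), hz t ht]
          · rw [f4 _ (by omega) (by omega), hM3, Function.update_self]
      refine (mp_cascade hX hred (S := X.sampled ω i) (R := R) (i := i)
        (le_trans (Nat.mul_le_mul_left _ hT) hv)
        (le_trans (Nat.mul_le_mul_left _ (Nat.add_le_add_right (Nat.size_le_size hT) 2)) hr.hm)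
        (fun j hj => ?_) hK hold4 (by simp [hM4]) (by simp [hM4]) hR4.h7 hR4.h1 hR4.h4 hR4.h5
        hR4.h6).mono ?_
      · rcases List.mem_append.1 hj with hj | hj
        · exact (lt_of_mem_sampled hj).trans hi
        · rw [List.mem_singleton.1 hj]; exact hi
      · rintro M5 ⟨R', hK', hold', e0', f5⟩
        refine ⟨R', hK', hold', e0', fun a b1 b2 => ?_, ?_⟩
        · rw [f5 a (Or.inl ⟨b1, b2⟩), f43 a (by omega) (by omega) (by omega)]
        · rw [f5 18 (Or.inr rfl), List.length_append, List.length_singleton]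
          simp [hM4]
    · rintro c3 ⟨a1, a2, R', a3, a4, a5, a6, a7⟩
      exact ⟨by rw [a1, ein2], by rw [a2, ed2, ed], a6, a7, R', a3, a4, a5⟩
  · rintro c3 ⟨a1, a2, a3, a4, R', a5, a6, a7⟩
    have hnβ := hr.hn
    refine (WP.of_mp (Q := fun M' => M' = Function.update c3.mem 8 ((i + 1 : ℕ) : ℤ)) ?_).mono ?_
    · refine mp_reg (v := (i + 1 : ℕ)) ?_ (by norm_num) h25 ?_ rfl
      · simp [Expr.val, a3 8, e82]
      · rw [abs_of_nonneg (by positivity)]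
        have : i + 1 ≤ X.β := by omega
        exact_mod_cast this
    · rintro c4 ⟨b1, b2, b3⟩
      have f4 : ∀ a, a ≠ 8 → c4.mem a = c3.mem a := fun a ha => by
        rw [b3, Function.update_of_ne ha]
      have hdvd : (i + 1) / X.len = i / X.len + if (i + 1) % X.len = 0 then 1 else 0 := by
        rw [Nat.succ_div]
        simp only [Nat.dvd_iff_mod_eq_zero]
      exact {
        regs := hR2.congr fun a c1 c2 => by rw [f4 a (by omega), a3 a c1 (by omega)]
        h8 := by rw [b3, Function.update_self]
        h18 := by rw [f4 18 (by norm_num), a4]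
        input := by rw [b1, a1]
        drawn := by rw [b2, a2, hdvd]; split_ifs <;> rfl
        h9 := fun hne => by
          rw [hdvd, if_neg hne, add_zero, f4 9 (by norm_num), a3 9 (by norm_num) (by norm_num), e92]
          push_cast; rfl
        kept := ⟨R', a5, a6.congr fun a c1 c2 => f4 a (by
          have := le_adr (d := X.d) (i := 0) (t := 0) le_rfl le_rfl
          omega), by rw [f4 0 (by norm_num), a7]⟩ }

lemma wp_mainLoop (hX : X.Bounds) (hr : X.Room) (hred : X.HasReductions) (hc : X.Inv ω 0 c) :
    WP X.β X.S ω (mainLoop X.d X.Bc X.Hc) (X.Inv ω X.n) c := by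
  refine wp_count (X.Inv ω) X.n hc (fun i hi c hc => ⟨?_, wp_processPoint hX hr hred hi hc⟩)
    fun c hc => ⟨?_, hc⟩
  · simp [Expr.val, hc.h8, hc.regs.h3, hi]
  · simp [Expr.val, hc.h8, hc.regs.h3]

end Env

/-! ### Start and end of the computation -/

/-- Set the registers: `P = 2 ^ w`, the bit length of `E`, the size of the blocks in a reduction
and the length of the blocks in the sampling. -/
def initProgram (d c₄ cM p : ℕ) : Program :=
  .seq (.store (.const 3) (reg 0)) (.seq (.store (.const 0) (.const 0))
    (.seq (.store (.const 4) (.const 1))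
      (.seq (.loop (.lt (.const 0) (reg 2))
          (.seq (.store (.const 4) (.mul (reg 4) (.const 2)))
            (.store (.const 2) (.sub (reg 2) (.const 1)))))
        (.seq (.store (.const 9) (reg 1))
          (.seq (.loop (.lt (.const 0) (reg 9))
              (.seq (.store (.const 9) (.div (reg 9) (.const 2))) (incr 5)))
            (.seq (.store (.const 6) (.const 1))
              (.seq (.loop (.lt (powE (reg 6) (d + 3)) (.mul (powE (reg 1) 2) (powE (reg 5) 4)))
                  (incr 6))
                (.seq (.store (.const 6) (.mul (.const c₄) (powE (reg 6) d)))
                  (.seq (.store (.const 7) (.const 1))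
                    (.loop (.lt (.mul (reg 7) (.mul (.const cM) (powE (reg 1) p))) (reg 3))
                      (.store (.const 7) (.mul (reg 7) (.const 2)))))))))))))

/-- Move the records to the place where they are expected. -/
def finalProgram (d : ℕ) : Program :=
  .seq (.store (slotE d) (.const 1))
    (.loop (.lt (.load (slotE d)) (.add (.mul (reg 0) (.const (d + 1))) (.const 1)))
      (.seq (.store (.load (slotE d)) (.load (.add (.load (slotE d)) (.const (24 * (d + 1))))))
        (.store (slotE d) (.add (.load (slotE d)) (.const 1)))))

/-- The whole program. -/
def program (d Bc Hc c₄ cM p : ℕ) : Program :=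
  .seq (initProgram d c₄ cM p) (.seq (mainLoop d Bc Hc) (finalProgram d))

lemma exists_rate (d E : ℕ) : ∃ r, E ^ 2 * E.size ^ 4 ≤ r ^ (d + 3) :=
  ⟨_, Nat.le_self_pow (by omega) _⟩

/-- The least `r` with `E² Λ⁴ ≤ r ^ (d + 3)`, where `Λ` is the bit length of `E`. -/
def rate (d E : ℕ) : ℕ := Nat.find (exists_rate d E)

lemma le_rate_pow (d E : ℕ) : E ^ 2 * E.size ^ 4 ≤ rate d E ^ (d + 3) :=
  Nat.find_spec (exists_rate d E)

lemma pow_lt_of_lt_rate {d E r : ℕ} (h : r < rate d E) : r ^ (d + 3) < E ^ 2 * E.size ^ 4 :=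
  not_le.1 (Nat.find_min (exists_rate d E) h)

lemma one_le_rate (d : ℕ) {E : ℕ} (hE : 1 ≤ E) : 1 ≤ rate d E := by
  by_contra hcon
  have h0 : rate d E = 0 := by omega
  have h1 := le_rate_pow d E
  have h2 : 0 < E.size := Nat.size_pos.2 hE
  rw [h0, zero_pow (by omega)] at h1
  have : 0 < E ^ 2 * E.size ^ 4 := by positivity
  omega

/-- The guard `1 ≤ M` inside makes `Nat.find` available for every `M`. -/
lemma exists_logLen (n M : ℕ) : ∃ κ, 1 ≤ M → n ≤ 2 ^ κ * M :=
  ⟨n, fun hM => n.lt_two_pow_self.le.trans (Nat.le_mul_of_pos_right _ hM)⟩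

/-- The least `κ` with `n ≤ 2 ^ κ * M`. -/
def logLen (n M : ℕ) : ℕ := Nat.find (exists_logLen n M)

lemma le_two_pow_logLen (n : ℕ) {M : ℕ} (hM : 1 ≤ M) : n ≤ 2 ^ logLen n M * M :=
  Nat.find_spec (exists_logLen n M) hM

lemma lt_of_lt_logLen {n M κ : ℕ} (h : κ < logLen n M) : 2 ^ κ * M < n := by
  have := Nat.find_min (exists_logLen n M) h
  push Not at this
  exact this.2

section

variable {β S L : ℕ} {ω : Tape L} {M : ℤ → ℤ}

lemma mp_init {d c₄ cM p n E w : ℕ} (hE : 1 ≤ E) (hcM : 1 ≤ cM) (h25 : 25 ≤ S) (hn : n ≤ β)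
    (hw : 2 ^ w ≤ β) (hEβ : E ≤ β) (hr : rate d E ≤ β) (hs : c₄ * rate d E ^ d ≤ β)
    (hl : 2 ^ logLen n (cM * E ^ p) ≤ β) (h0 : M 0 = n) (h1 : M 1 = E) (h2 : M 2 = w)
    (hM : ∀ a, 2 < a → M a = 0) :
    MP β S ω (initProgram d c₄ cM p) (fun M' => M' 0 = 0 ∧ M' 1 = E ∧ M' 3 = n ∧
      M' 4 = (2 ^ w : ℕ) ∧ M' 5 = E.size ∧ M' 6 = (c₄ * rate d E ^ d : ℕ) ∧
      M' 7 = (2 ^ logLen n (cM * E ^ p) : ℕ) ∧ M' 8 = 0 ∧ M' 18 = 0) M := by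
  have hβ : ∀ {x : ℕ}, x ≤ β → |(x : ℤ)| ≤ β := fun {x} h => by
    rw [abs_of_nonneg (by positivity)]; exact_mod_cast h
  have hβ1 : 1 ≤ β := hE.trans hEβ
  have hwβ : w ≤ β := w.lt_two_pow_self.le.trans hw
  have hsize : E.size ≤ E := by
    rw [Nat.size_le]; exact E.lt_two_pow_self
  refine mp_seq (mp_reg (v := (n : ℕ)) (by simp [Expr.val, h0]) (by norm_num) h25 (hβ hn) ?_)
  refine mp_seq (mp_reg (v := 0) rfl (by norm_num) h25 (by simp) ?_)
  refine mp_seq (mp_reg (v := 1) rfl (by norm_num) h25 (by simpa using hβ1) ?_)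
  refine mp_seq ((mp_count (fun k M' => k ≤ w ∧ M' 4 = (2 ^ k : ℕ) ∧ M' 2 = (w : ℤ) - k ∧
    M' 0 = 0 ∧ M' 1 = E ∧ M' 3 = n ∧ M' 5 = 0 ∧ M' 8 = 0 ∧ M' 18 = 0) w
    (Q := fun M' => M' 4 = (2 ^ w : ℕ) ∧ M' 0 = 0 ∧ M' 1 = E ∧ M' 3 = n ∧ M' 5 = 0 ∧ M' 8 = 0 ∧
      M' 18 = 0) ?_ ?_ ?_).mono ?_)
  · simp [h1, h2, hM]
  · rintro k hk M' ⟨-, e4, e2, e0, e1, e3, e5, e8, e18⟩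
    refine ⟨by simp [Expr.val, e2]; omega, ?_⟩
    have hk2 : 2 ^ (k + 1) ≤ β := (Nat.pow_le_pow_right (by norm_num) hk).trans hw
    refine mp_seq (mp_reg (v := (2 ^ (k + 1) : ℕ)) ?_ (by norm_num) h25 (hβ hk2) ?_)
    · simp [Expr.val, e4, pow_succ]
    refine mp_reg (v := (w : ℤ) - (k + 1 : ℕ)) ?_ (by norm_num) h25 ?_ ?_
    · simp [Expr.val, e2]; ring
    · rw [abs_le]; omega
    · refine ⟨hk, by simp, by simp, ?_⟩
      simp [e0, e1, e3, e5, e8, e18]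
  · rintro M' ⟨-, e4, e2, e0, e1, e3, e5, e8, e18⟩
    exact ⟨by simp [Expr.val, e2], e4, e0, e1, e3, e5, e8, e18⟩
  rintro M1 ⟨e4, e0, e1, e3, e5, e8, e18⟩
  refine mp_seq (mp_reg (v := (E : ℕ)) (by simp [Expr.val, e1]) (by norm_num) h25 (hβ hEβ) ?_)
  refine mp_seq ((mp_count (fun k M' => M' 9 = (E / 2 ^ k : ℕ) ∧ M' 5 = k ∧ M' 4 = (2 ^ w : ℕ) ∧
    M' 0 = 0 ∧ M' 1 = E ∧ M' 3 = n ∧ M' 8 = 0 ∧ M' 18 = 0) E.size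
    (Q := fun M' => M' 5 = E.size ∧ M' 4 = (2 ^ w : ℕ) ∧ M' 0 = 0 ∧ M' 1 = E ∧ M' 3 = n ∧
      M' 8 = 0 ∧ M' 18 = 0) ?_ ?_ ?_).mono ?_)
  · simp [e0, e1, e3, e4, e5, e8, e18]
  · rintro k hk M' ⟨e9, e5, e4, e0, e1, e3, e8, e18⟩
    have hk' : 0 < E / 2 ^ k := Nat.div_pos (Nat.lt_size.1 hk) (by positivity)
    refine ⟨by simp only [Expr.val, e9]; rw [if_pos (by exact_mod_cast hk')]; norm_num, ?_⟩
    refine mp_seq (mp_reg (v := (E / 2 ^ (k + 1) : ℕ)) ?_ (by norm_num) h25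
      (hβ ((Nat.div_le_self _ _).trans hEβ)) ?_)
    · simp only [Expr.val, e9, pow_succ, ← Nat.div_div_eq_div_mul]
      push_cast; rfl
    refine mp_reg (v := (k + 1 : ℕ)) ?_ (by norm_num) h25 (hβ (by omega)) ?_
    · simp [Expr.val, e5]
    · simp [e0, e1, e3, e4, e8, e18]
  · rintro M' ⟨e9, e5, e4, e0, e1, e3, e8, e18⟩
    have : E / 2 ^ E.size = 0 := Nat.div_eq_of_lt (Nat.lt_size_self E)
    rw [this] at e9
    exact ⟨by simp [Expr.val, e9], e5, e4, e0, e1, e3, e8, e18⟩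
  rintro M2 ⟨e5, e4, e0, e1, e3, e8, e18⟩
  have hr1 := one_le_rate d hE
  refine mp_seq (mp_reg (v := 1) rfl (by norm_num) h25 (by simpa using hβ1) ?_)
  refine mp_seq ((mp_count (fun k M' => M' 6 = (k + 1 : ℕ) ∧ M' 5 = E.size ∧ M' 4 = (2 ^ w : ℕ) ∧
    M' 0 = 0 ∧ M' 1 = E ∧ M' 3 = n ∧ M' 8 = 0 ∧ M' 18 = 0) (rate d E - 1)
    (Q := fun M' => M' 6 = rate d E ∧ M' 5 = E.size ∧ M' 4 = (2 ^ w : ℕ) ∧ M' 0 = 0 ∧ M' 1 = E ∧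
      M' 3 = n ∧ M' 8 = 0 ∧ M' 18 = 0) ?_ ?_ ?_).mono ?_)
  · simp [e0, e1, e3, e4, e5, e8, e18]
  · rintro k hk M' ⟨e6, e5, e4, e0, e1, e3, e8, e18⟩
    have hlt := pow_lt_of_lt_rate (d := d) (E := E) (r := k + 1) (by omega)
    constructor
    · simp only [Expr.val, val_powE, e6, e1, e5]
      rw [if_pos (by exact_mod_cast hlt)]; norm_num
    refine mp_reg (v := (k + 1 + 1 : ℕ)) ?_ (by norm_num) h25 (hβ (by omega)) ?_
    · simp [Expr.val, e6]
    · simp [e0, e1, e3, e4, e5, e8, e18]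
  · rintro M' ⟨e6, e5, e4, e0, e1, e3, e8, e18⟩
    rw [Nat.sub_add_cancel hr1] at e6
    refine ⟨?_, e6, e5, e4, e0, e1, e3, e8, e18⟩
    simp only [Expr.val, val_powE, e6, e1, e5]
    rw [if_neg (not_lt.2 (by exact_mod_cast le_rate_pow d E))]
  rintro M3 ⟨e6, e5, e4, e0, e1, e3, e8, e18⟩
  refine mp_seq (mp_reg (v := (c₄ * rate d E ^ d : ℕ)) ?_ (by norm_num) h25 (hβ hs) ?_)
  · simp [Expr.val, e6]
  refine mp_seq (mp_reg (v := 1) rfl (by norm_num) h25 (by simpa using hβ1) ?_)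
  have hM1 : 1 ≤ cM * E ^ p := Nat.mul_pos hcM (Nat.pow_pos hE)
  refine mp_count (fun k M' => M' 7 = (2 ^ k : ℕ) ∧ M' 6 = (c₄ * rate d E ^ d : ℕ) ∧
    M' 5 = E.size ∧ M' 4 = (2 ^ w : ℕ) ∧ M' 0 = 0 ∧ M' 1 = E ∧ M' 3 = n ∧ M' 8 = 0 ∧ M' 18 = 0)
    (logLen n (cM * E ^ p)) ?_ ?_ ?_
  · simp [e0, e1, e3, e4, e5, e8, e18]
  · rintro k hk M' ⟨e7, e6, e5, e4, e0, e1, e3, e8, e18⟩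
    have hlt := lt_of_lt_logLen hk
    constructor
    · simp only [Expr.val, val_powE, e7, e1, e3]
      rw [if_pos (by exact_mod_cast hlt)]; norm_num
    have hk2 : 2 ^ (k + 1) ≤ β := (Nat.pow_le_pow_right (by norm_num) hk).trans hl
    refine mp_reg (v := (2 ^ (k + 1) : ℕ)) ?_ (by norm_num) h25 (hβ hk2) ?_
    · simp [Expr.val, e7, pow_succ]
    · refine ⟨by simp, by rw [Function.update_of_ne (by norm_num), e6], ?_⟩
      simp [e0, e1, e3, e4, e5, e8, e18]
  · rintro M' ⟨e7, e6, e5, e4, e0, e1, e3, e8, e18⟩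
    refine ⟨?_, e0, e1, e3, e4, e5, e6, e7, e8, e18⟩
    simp only [Expr.val, val_powE, e7, e1, e3]
    rw [if_neg (not_lt.2 (by exact_mod_cast le_two_pow_logLen n hM1))]

/-- The records move down over the registers, so the loop variable is kept in the first free cell
behind them. Cells are filled in ascending order and sources lie above targets, hence nothing is
overwritten too early. -/
lemma mp_final {d m : ℕ} (hM : ∀ a, |M a| ≤ β) (h0 : M 0 = m) (hS : adr d m 0 < S)
    (hβ : m * (d + 1) + 1 ≤ β) :
    MP β S ω (finalProgram d) (fun M' => M' 0 = m ∧
      ∀ a : ℤ, 1 ≤ a → a ≤ m * (d + 1) → M' a = M (a + 24 * (d + 1))) M := by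
  have h25 : 25 ≤ adr d m 0 := le_adr (by omega) le_rfl
  have hslot : ∀ {M' : ℤ → ℤ}, M' 0 = m → (slotE d).val M' = adr d m 0 := fun {M'} h => by
    simp only [slotE, Expr.val, h, adr, add_zero]
  have hadr : adr d m 0 = 1 + 24 * ((d : ℤ) + 1) + m * (d + 1) := by rw [adr, add_zero]
  refine mp_seq (mp_store (v := 1) (hslot h0) rfl (by omega) hS (by rw [abs_one]; omega) ?_)
  refine mp_count (fun k M' => M' (adr d m 0) = (k + 1 : ℕ) ∧ M' 0 = m ∧
    (∀ a : ℤ, 1 ≤ a → a ≤ k → M' a = M (a + 24 * (d + 1))) ∧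
    ∀ a : ℤ, k < a → a < adr d m 0 → M' a = M a) (m * (d + 1)) ?_ ?_ ?_
  · refine ⟨by simp, by rw [Function.update_of_ne (by omega), h0], fun a b1 b2 => ?_,
      fun a b1 b2 => Function.update_of_ne (by omega) _ _⟩
    push_cast at b2; omega
  · rintro k hk M' ⟨e1, e0, hc, hf⟩
    have hk' : (k : ℤ) < m * (d + 1) := by exact_mod_cast hk
    constructor
    · simp only [Expr.val, hslot e0, e1, e0]
      rw [if_pos (by push_cast; omega)]; norm_num
    have hd0 : (0 : ℤ) ≤ d := by positivity
    refine mp_seq (mp_store (i := (k + 1 : ℕ)) (v := M ((k + 1 : ℕ) + 24 * (d + 1))) ?_ ?_ (by omega)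
      (by push_cast; omega) (hM _) ?_)
    · simp only [Expr.val, hslot e0, e1]
    · simp only [Expr.val, hslot e0, e1]
      refine hf _ ?_ ?_ <;> push_cast <;> omega
    refine mp_store (i := adr d m 0) (v := (k + 1 + 1 : ℕ)) ?_ ?_ (by omega) hS ?_ ?_
    · exact hslot (by rw [Function.update_of_ne (by omega), e0])
    · have h' : ∀ M'' : ℤ → ℤ, M'' 0 = m → M'' (adr d m 0) = (k + 1 : ℕ) →
          Expr.val M'' (.add (.load (slotE d)) (.const 1)) = (k + 1 + 1 : ℕ) := fun M'' b1 b2 => by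
        simp only [Expr.val, hslot b1, b2]; push_cast; rfl
      exact h' _ (by rw [Function.update_of_ne (by omega), e0])
        (by rw [Function.update_of_ne (by push_cast; omega), e1])
    · rw [abs_of_nonneg (by positivity)]; push_cast;
      have : ((m * (d + 1) + 1 : ℕ) : ℤ) ≤ β := by exact_mod_cast hβ
      push_cast at this
      omega
    refine ⟨by rw [Function.update_self], ?_, fun a b1 b2 => ?_, fun a b1 b2 => ?_⟩
    · rw [Function.update_of_ne (by omega), Function.update_of_ne (by omega), e0]
    · push_cast at b2
      rw [Function.update_of_ne (by omega)]
      rcases eq_or_ne a (k + 1 : ℕ) with rfl | hne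
      · rw [Function.update_self]
      · rw [Function.update_of_ne hne, hc a b1 (by push_cast at hne; omega)]
    · push_cast at b1
      rw [Function.update_of_ne (by omega), Function.update_of_ne (by push_cast; omega),
        hf a (by omega) b2]
  · rintro M' ⟨e1, e0, hc, hf⟩
    refine ⟨?_, e0, fun a b1 b2 => hc a b1 (by push_cast; exact b2)⟩
    simp only [Expr.val, hslot e0, e1, e0]
    rw [if_neg (by push_cast; omega)]

end

namespace Env

variable {X : Env} {L : ℕ} {ω : Tape L} {c : Config} {S : List ℕ} {R : List (ℕ × ℤ)}

lemma Kept.err (hK : X.Kept S R) (hs : 1 ≤ X.s) {T : ℕ} (hS : S.length ≤ T) {k : ℕ} (hk : k < X.N) :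
    X.Λ * |X.wsum k R - X.ssum k S|
      ≤ T * (T.size * (2 * X.len * X.P * X.P) + X.Λ * X.Hc * X.E * X.P) := by
  obtain ⟨q, S₁, R₁, S₂, hst, rfl, rfl, hlt⟩ := hK
  have h1 := hst.length
  rw [pow_zero, one_mul] at h1
  have h2 : q * X.s ≤ T := by rw [List.length_append] at hS; omega
  have h3 : q ≤ T := (Nat.le_mul_of_pos_right q hs).trans h2
  have h4 : q.size ≤ T.size := Nat.size_le_size h3
  have h5 := hst.err hk
  rw [wsum_append, ssum_append, wsum_fresh, add_sub_add_right_eq_sub]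
  refine h5.trans ?_
  have h6 : q * 2 ^ 0 * ((0 + q.size) * X.v0 + X.rnd)
      ≤ T * (T.size * (2 * X.len * X.P * X.P) + X.Λ * X.Hc * X.E * X.P) := by
    calc q * 2 ^ 0 * ((0 + q.size) * X.v0 + X.rnd)
        = (q * X.s) * (q.size * (2 * X.len * X.P * X.P) + X.Λ * X.Hc * X.E * X.P) := by
          rw [v0, rnd]; ring
      _ ≤ _ := by gcongr
  exact_mod_cast h6

lemma Kept.sub (hK : X.Kept S R) : (R.map Prod.fst).Sublist S := by
  obtain ⟨q, S₁, R₁, S₂, hst, rfl, rfl, hlt⟩ := hK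
  rw [List.map_append]
  refine hst.sub.append ?_
  simp [fresh, Function.comp_def]

/-- The configuration holds the result of the computation. -/
def Output (X : Env) {L : ℕ} (ω : Tape L) (c : Config) : Prop :=
  ∃ R, X.Kept (X.sampled ω X.n) R ∧ R.length < X.mmax ∧ c.mem 0 = R.length ∧
    ∀ (j : ℕ) r, R[j]? = some r → (∀ t < X.d, c.mem (1 + j * (X.d + 1) + t) = X.Z r.1 t) ∧
      c.mem (1 + j * (X.d + 1) + X.d) = r.2

lemma length_sampled_le' (n : ℕ) : (X.sampled ω n).length ≤ n / X.len + 1 := by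
  have h1 := length_sampled_le (X := X) (ω := ω) (i := n)
  rw [sampled_succ, List.length_append] at h1
  omega

theorem wp_program {c₄ cM p w : ℕ} (hX : X.Bounds) (hr : X.Room) (hred : X.HasReductions)
    (hE : 1 ≤ X.E) (hcM : 1 ≤ cM) (hP : X.P = 2 ^ w) (hΛ : X.Λ = X.E.size)
    (hs : X.s = c₄ * rate X.d X.E ^ X.d) (hlen : X.len = 2 ^ logLen X.n (cM * X.E ^ p))
    (hrβ : rate X.d X.E ≤ X.β) (hPβ : X.P ≤ X.β) (hEβ : X.E ≤ X.β)
    (hlβ : X.len ≤ X.β) (hmβ : X.mmax * (X.d + 1) + 1 ≤ X.β) (hM : ∀ a, |c.mem a| ≤ X.β)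
    (h0 : c.mem 0 = X.n) (h1 : c.mem 1 = X.E) (h2 : c.mem 2 = w) (h3 : ∀ a, 2 < a → c.mem a = 0)
    (hin : c.input = X.rest 0) (hd : c.drawn = 0) :
    WP X.β X.S ω (program X.d X.Bc X.Hc c₄ cM p) (X.Output ω) c := by
  have h25 : 25 ≤ X.S := by
    have := le_adr (d := X.d) (i := X.mmax) (t := 2 * X.s) (by omega) (by omega)
    have := hX.hS
    omega
  have hsβ : X.s ≤ X.β := by have := hX.hs; omega
  obtain ⟨c1, hc1, ein, ed, e0, e1, e3, e4, e5, e6, e7, e8, e18⟩ := WP.of_mp (ω := ω) (mp_init (ω := ω)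
    (S := X.S) (β := X.β) (p := p) hE hcM h25 hr.hn (hP ▸ hPβ) hEβ hrβ (hs ▸ hsβ) (hlen ▸ hlβ)
    h0 h1 h2 h3)
  have hs1 := hX.hs1
  obtain ⟨c2, hc2, hI⟩ := wp_mainLoop (ω := ω) (c := c1) hX hr hred {
    regs := ⟨e1, e3, by rw [e4, hP], by rw [e5, hΛ], by rw [e6, hs], by rw [e7, hlen]⟩
    h8 := by simpa using e8
    h18 := by simpa [sampled] using e18
    input := by rw [ein, hin]
    drawn := by rw [ed, hd]; simp
    h9 := fun h => by simp at h
    kept := ⟨[], ⟨0, [], [], [], .zero _, by simp [sampled], by simp [fresh], Nat.pos_of_ne_zero (by omega)⟩,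
      fun i r h => by simp at h, by simpa using e0⟩ }
  obtain ⟨R, hK, hold, e20⟩ := hI.kept
  have hRm := hK.length_lt hX hr (length_sampled_le' _)
  obtain ⟨c3, hc3, -, -, e30, hcp⟩ := WP.of_mp (ω := ω) (mp_final (ω := ω) (S := X.S) (d := X.d)
    (hc2.bounded (hc1.bounded hM)) e20 (by
      have h1 := hX.hS
      have h2 : adr X.d R.length 0 < adr X.d X.mmax 0 := adr_lt_adr (by omega) (by omega) le_rfl
      unfold adr at h1 h2 ⊢
      omega) (le_trans (by gcongr) hmβ))
  refine ⟨c3, .seq hc1 (.seq hc2 hc3), R, hK, hRm, e30, fun j r hj => ?_⟩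
  have hjR : j < R.length := (List.getElem?_eq_some_iff.1 hj).1
  have hcell := hold j r hj
  rw [zero_add] at hcell
  have hle : ((j : ℤ) + 1) * (X.d + 1) ≤ R.length * (X.d + 1) := by gcongr; omega
  have hj0 : (0 : ℤ) ≤ j * (X.d + 1) := by positivity
  rw [add_mul, one_mul] at hle
  constructor
  · intro t ht
    rw [hcp _ (by omega) (by omega), ← hcell.1 t ht, adr]
    congr 1; ring
  · rw [hcp _ (by omega) (by omega), ← hcell.2, adr]
    congr 1; ring

end Env

/-! ### One random element per block: mean, variance, Chebyshev -/

section Sampling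

open MeasureTheory ProbabilityTheory

variable {L κ n : ℕ} {f : ℕ → ℝ} {H : ℝ}

/-- The contribution of block `j` to the estimate of `∑ i < n, f i`, if `a` is drawn. -/
def blockSum (κ n : ℕ) (f : ℕ → ℝ) (j a : ℕ) : ℝ :=
  ∑ i ∈ range n with i / 2 ^ κ = j, if i % 2 ^ κ = a % 2 ^ κ then 2 ^ κ * f i else 0

lemma blockSum_mem (hf : ∀ i < n, 0 ≤ f i ∧ f i ≤ H) (hH : 0 ≤ H) (j a : ℕ) :
    blockSum κ n f j a ∈ Set.Icc 0 (2 ^ κ * H) := by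
  unfold blockSum
  rw [← sum_filter, filter_filter]
  have hterm : ∀ i ∈ (range n).filter (fun i => i / 2 ^ κ = j ∧ i % 2 ^ κ = a % 2 ^ κ),
      0 ≤ 2 ^ κ * f i ∧ 2 ^ κ * f i ≤ 2 ^ κ * H := fun i hi => by
    obtain ⟨h1, h2⟩ := hf i (mem_range.1 (mem_filter.1 hi).1)
    exact ⟨by positivity, by gcongr⟩
  refine ⟨sum_nonneg fun i hi => (hterm i hi).1,
    (sum_le_card_nsmul _ _ _ fun i hi => (hterm i hi).2).trans ?_⟩
  have hcard : ((range n).filter (fun i => i / 2 ^ κ = j ∧ i % 2 ^ κ = a % 2 ^ κ)).card ≤ 1 := by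
    refine card_le_one.2 fun i hi i' hi' => ?_
    obtain ⟨h1, h2⟩ := (mem_filter.1 hi).2
    obtain ⟨h3, h4⟩ := (mem_filter.1 hi').2
    rw [← Nat.div_add_mod i (2 ^ κ), ← Nat.div_add_mod i' (2 ^ κ), h1, h2, h3, h4]
  rw [nsmul_eq_mul]
  exact mul_le_of_le_one_left (by positivity) (by exact_mod_cast hcard)

lemma sum_blockSum (ω : ℕ → ℕ) : ∑ j ∈ range (n / 2 ^ κ + 1), blockSum κ n f j (ω j)
    = ∑ i ∈ range n with i % 2 ^ κ = ω (i / 2 ^ κ) % 2 ^ κ, 2 ^ κ * f i := by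
  rw [sum_filter, ← sum_fiberwise_of_maps_to (s := range n) (t := range (n / 2 ^ κ + 1))
    (g := fun i => i / 2 ^ κ)]
  · refine sum_congr rfl fun j _ => sum_congr rfl fun i hi => ?_
    rw [(mem_filter.1 hi).2]
  · intro i hi
    exact mem_range.2 (Nat.lt_succ_of_le (Nat.div_le_div_right (mem_range.1 hi).le))

/-- As `2 ^ κ` divides `2 ^ L`, a uniform word is uniform modulo the block length. -/
lemma card_mod_eq (hκ : κ ≤ L) (i : ℕ) :
    ∑ a : Fin (2 ^ L), (if i % 2 ^ κ = (a : ℕ) % 2 ^ κ then (1 : ℝ) else 0) = 2 ^ L / 2 ^ κ := by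
  rw [← Finset.sum_range fun a => if i % 2 ^ κ = a % 2 ^ κ then (1 : ℝ) else 0, sum_boole]
  have h1 := Nat.count_modEq_card (2 ^ L) (r := 2 ^ κ) (by positivity) i
  rw [Nat.count_eq_card_filter_range, Nat.mod_eq_zero_of_dvd (pow_dvd_pow 2 hκ),
    if_neg (by omega), add_zero, Nat.pow_div hκ (by norm_num)] at h1
  have : (range (2 ^ L)).filter (fun a => i % 2 ^ κ = a % 2 ^ κ)
      = (range (2 ^ L)).filter (fun a => a ≡ i [MOD 2 ^ κ]) :=
    filter_congr fun a _ => ⟨fun h => h.symm, fun h => h.symm⟩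
  rw [this, h1, eq_div_iff (by positivity), ← pow_sub_mul_pow 2 hκ]
  push_cast; rfl

instance (L : ℕ) : IsProbabilityMeasure (tapeLaw L) := by unfold tapeLaw; infer_instance

lemma integral_tape (g : Fin (2 ^ L) → ℝ) (j : ℕ) :
    ∫ ω, g (ω j) ∂tapeLaw L = (∑ a, g a) / 2 ^ L := by
  have h := integral_map (μ := tapeLaw L) (φ := fun ω : Tape L => ω j) (f := g)
    (measurable_pi_apply j).aemeasurable
    (by exact (Measurable.of_discrete).aestronglyMeasurable)
  rw [← h]
  unfold tapeLaw
  rw [Measure.infinitePi_map_eval, PMF.integral_eq_sum, sum_div]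
  refine sum_congr rfl fun a _ => ?_
  simp [div_eq_inv_mul]

/-- Each index is chosen with probability `2 ^ (-κ)` and counted with the factor `2 ^ κ`. The
estimate is therefore unbiased even for an incomplete last block. -/
lemma integral_blockSum (hκ : κ ≤ L) (j : ℕ) :
    ∫ ω, blockSum κ n f j (ω j : ℕ) ∂tapeLaw L = ∑ i ∈ range n with i / 2 ^ κ = j, f i := by
  rw [integral_tape (fun a => blockSum κ n f j a)]
  unfold blockSum
  rw [sum_comm, sum_div]
  refine sum_congr rfl fun i _ => ?_
  have : ∑ a : Fin (2 ^ L), (if i % 2 ^ κ = (a : ℕ) % 2 ^ κ then 2 ^ κ * f i else 0)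
      = (∑ a : Fin (2 ^ L), if i % 2 ^ κ = (a : ℕ) % 2 ^ κ then (1 : ℝ) else 0) * (2 ^ κ * f i) := by
    rw [sum_mul]; simp
  rw [this, card_mod_eq hκ]
  field_simp

/-- Chebyshev's inequality for the estimate of a sum from one random element of each block. -/
theorem tapeLaw_deviation_le (hκ : κ ≤ L) (hf : ∀ i < n, 0 ≤ f i ∧ f i ≤ H) (hH : 0 ≤ H) {c : ℝ}
    (hc : 0 < c) :
    tapeLaw L {ω : Tape L | c ≤ |∑ i ∈ range n with i % 2 ^ κ = (ω (i / 2 ^ κ) : ℕ) % 2 ^ κ,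
      2 ^ κ * f i - ∑ i ∈ range n, f i|}
      ≤ ENNReal.ofReal ((n / 2 ^ κ + 1 : ℕ) * (2 ^ κ * H) ^ 2 / c ^ 2) := by
  set Y : ℕ → Tape L → ℝ := fun j ω => blockSum κ n f j (ω j : ℕ) with hY
  have hmeas : ∀ j, Measurable (Y j) := fun j =>
    (Measurable.of_discrete (f := fun a : Fin (2 ^ L) => blockSum κ n f j a)).comp
      (measurable_pi_apply j)
  have hmem : ∀ j ω, Y j ω ∈ Set.Icc 0 (2 ^ κ * H) := fun j ω => blockSum_mem hf hH _ _
  have hL2 : ∀ j, MemLp (Y j) 2 (tapeLaw L) := fun j =>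
    memLp_of_bounded (Filter.Eventually.of_forall (hmem j)) (hmeas j).aestronglyMeasurable 2
  have hind : iIndepFun Y (tapeLaw L) := by
    unfold tapeLaw
    exact iIndepFun_infinitePi (X := fun j (a : Fin (2 ^ L)) => blockSum κ n f j a)
      (fun j => Measurable.of_discrete)
  set J := n / 2 ^ κ + 1 with hJ
  have hvar : Var[∑ j ∈ range J, Y j; tapeLaw L] ≤ J * (2 ^ κ * H) ^ 2 := by
    rw [IndepFun.variance_sum (fun j _ => hL2 j) fun i _ j _ hij => hind.indepFun hij]
    refine (sum_le_sum (g := fun _ => (2 ^ κ * H) ^ 2) fun j _ => ?_).trans (by simp)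
    refine (variance_le_sq_of_bounded (Filter.Eventually.of_forall (hmem j))
      (hmeas j).aemeasurable).trans ?_
    have : 0 ≤ 2 ^ κ * H := by positivity
    nlinarith
  have hmean : ∫ ω, (∑ j ∈ range J, Y j) ω ∂tapeLaw L = ∑ i ∈ range n, f i := by
    simp only [Finset.sum_apply]
    rw [integral_finsetSum _ fun j _ => (hL2 j).integrable (by norm_num)]
    simp only [hY, integral_blockSum hκ]
    refine sum_fiberwise_of_maps_to (g := fun i => i / 2 ^ κ) (fun i hi => ?_) f
    exact mem_range.2 (Nat.lt_succ_of_le (Nat.div_le_div_right (mem_range.1 hi).le))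
  have hcheb := meas_ge_le_variance_div_sq (μ := tapeLaw L) (X := ∑ j ∈ range J, Y j)
    (memLp_finsetSum' _ fun j _ => hL2 j) hc
  rw [hmean] at hcheb
  refine le_trans (le_of_eq ?_) (hcheb.trans (ENNReal.ofReal_le_ofReal (by gcongr)))
  congr 1
  ext ω
  simp only [Set.mem_ofPred_eq, Finset.sum_apply, hY]
  rw [sum_blockSum fun j => (ω j : ℕ)]

end Sampling

lemma abs_coef_le (Bc E : ℕ) (g : ℤ) (i : ℕ) : |coef Bc E g i| ≤ Bc * E := by
  have h0 : (0 : ℤ) < 2 * Bc * E + 1 := by positivity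
  have h1 := Int.emod_nonneg (g / (2 * Bc * E + 1) ^ i) h0.ne'
  have h2 := Int.emod_lt_of_pos (g / (2 * Bc * E + 1) ^ i) h0
  rw [coef, abs_le]
  constructor <;> linarith

/-! ### From half-size coresets to acceptable digits -/

namespace Env

variable {X : Env}

/-- The reduction steps are possible, because there are coresets of half the size. -/
theorem hasReductions (hX : X.Bounds) (hd : 1 ≤ X.d) {r Rc : ℕ} (hr : 1 ≤ r)
    (hs : 2 * ((X.d + 1) * ((X.d + 1) * r + 1) ^ X.d) ≤ X.s) (hRc : 1 ≤ Rc) (hBc : 1 ≤ X.Bc)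
    (hE : 1 ≤ X.E) (hZ : ∀ i < X.n, ∀ t < X.d, |X.Z i t| ≤ Rc * X.P)
    (hη : (X.Λ : ℝ) * (X.Bc * X.E * Rc) * (8 * X.d * (X.d + 2) * (Real.log (2 * X.N)
      + 3 * (X.d + 1) * Real.log (2 * X.s)) / Real.sqrt (X.s * r ^ 3)) ≤ 1) :
    X.HasReductions := by
  intro R hR hR' v hsum m hm
  have hN : 0 < X.N := by unfold N; positivity
  have : Nonempty (Fin X.N) := ⟨⟨0, hN⟩⟩
  have hP := hX.hP
  have hget : ∀ j < 2 * X.s, R.getD j (0, 0) ∈ R := fun j hj => by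
    rw [List.getD_eq_getElem _ _ (by omega)]
    exact List.getElem_mem _
  set ρ : ℕ → ℕ × ℤ := fun j => R.getD j (0, 0) with hρ
  have hρn : ∀ j < 2 * X.s, 0 ≤ (ρ j).2 ∧ (ρ j).1 < X.n := fun j hj => hR' _ (hget j hj)
  have hRP : (0 : ℝ) < Rc * X.P := by positivity
  have hBE : (0 : ℝ) < X.Bc * X.E := by positivity
  have hRc' : (1 : ℝ) ≤ Rc := by exact_mod_cast hRc
  have hco : ∀ g i, |((coef X.Bc X.E g i : ℤ) : ℝ)| ≤ X.Bc * X.E := fun g i => by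
    have := abs_coef_le X.Bc X.E g i
    exact_mod_cast this
  set D : ℝ := X.Bc * X.E * (Rc * X.P) with hD
  have hD0 : 0 < D := by positivity
  -- Points are scaled by `Rc * P` and test functions by `D = Bc * E * Rc * P`, so that coordinates
  -- and linear coefficients are at most `1`.
  obtain ⟨u', hu0, hus, huc, herr⟩ := HingeCoreset.exists_half_coreset (ι := Fin (2 * X.s))
    (F := Fin X.N) X.d r X.s hd hr hs (fun i t => (X.Z (ρ i).1 t : ℝ) / (Rc * X.P))
    (fun i t => by
      rw [abs_div, abs_of_pos hRP, div_le_one hRP]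
      have := hZ _ (hρn i i.2).2 t t.2
      exact_mod_cast this)
    (fun f t => -((coef X.Bc X.E f t : ℤ) : ℝ) / (X.Bc * X.E))
    (fun f t => by
      rw [abs_div, abs_neg, abs_of_pos hBE, div_le_one hBE]
      exact hco _ _)
    (fun f => ((coef X.Bc X.E f X.d : ℤ) : ℝ) / (X.Bc * X.E * Rc))
    (fun f i => ((X.fn f (ρ i).1 : ℤ) : ℝ) / D)
    (fun f i => by
      rw [fn, testFn]
      push_cast
      rw [← max_div_div_right hD0.le, zero_div]
      congr 1
      rw [sub_div, Finset.sum_range, sum_div, sub_eq_add_neg, ← sum_neg_distrib]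
      congr 1
      · rw [hD]; field_simp
      · refine sum_congr rfl fun t _ => ?_
        rw [hD]; field_simp)
    (fun i => ((ρ i).2 : ℝ)) (fun i => by exact_mod_cast (hρn i i.2).1) (by simp)
  -- The support is padded to exactly `s` positions; an added position gets digit `1`, that is,
  -- weight `0`.
  obtain ⟨K, hK1, -, hK2⟩ := exists_subsuperset_card_eq (subset_univ _) huc
    (by rw [card_univ, Fintype.card_fin]; omega)
  have hu'K : ∀ i, i ∉ K → u' i = 0 := fun i hi => by
    by_contra hne
    exact hi (hK1 (mem_filter.2 ⟨mem_univ _, hne⟩))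
  set g : ℕ → ℕ := fun j => if h : j < 2 * X.s then
    (if (⟨j, h⟩ : Fin (2 * X.s)) ∈ K then ⌊u' ⟨j, h⟩⌋₊ + 1 else 0) else 0 with hg
  have hgi : ∀ i : Fin (2 * X.s), g i = if i ∈ K then ⌊u' i⌋₊ + 1 else 0 := fun i => by
    simp [hg, i.2]
  have hwt : ∀ i : Fin (2 * X.s), wt (g i) = (⌊u' i⌋₊ : ℤ) := fun i => by
    rw [hgi, wt]
    split_ifs with h1 h2 h2
    · push_cast; ring
    · push_cast at h2; omega
    · simp at h2
    · simp [hu'K i h1]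
  have hfl : ∀ i, ((⌊u' i⌋₊ : ℕ) : ℝ) ≤ u' i := fun i => Nat.floor_le (hu0 i)
  have hsum1 : ∑ i : Fin (2 * X.s), (ρ i).2 = (R.map Prod.snd).sum := by
    rw [← sum_getD Prod.snd R _ hR, Finset.sum_range]
  have hW : ∑ i : Fin (2 * X.s), ((ρ i).2 : ℝ) * X.P ≤ v := by
    rw [← sum_mul]
    have : (∑ i : Fin (2 * X.s), (ρ i).2) * X.P ≤ (v : ℤ) := by rw [hsum1]; exact hsum
    exact_mod_cast this
  rw [← sum_mul] at hW
  have hu'v : ∑ i, u' i ≤ v := by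
    rw [hus]
    refine le_trans (le_mul_of_one_le_right ?_ (by exact_mod_cast hP)) hW
    exact sum_nonneg fun i _ => by exact_mod_cast (hρn i i.2).1
  refine ⟨g, fun j hj => ?_, fun k hk => ?_, ?_, ?_⟩
  · have h1 := hgi ⟨j, hj⟩
    simp only at h1
    rw [h1]
    split_ifs
    · refine Nat.add_le_add_right ?_ 1
      have h2 : u' ⟨j, hj⟩ ≤ v := (single_le_sum (fun i _ => hu0 i) (mem_univ _)).trans hu'v
      exact_mod_cast (hfl _).trans h2
    · omega
  · change (X.Λ : ℤ) * |∑ j ∈ range (2 * X.s), (wt (g j) - (ρ j).2) * X.fn k (ρ j).1|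
      ≤ v + X.Λ * X.s * X.Hc * X.E * X.P
    have hH : ∀ i : Fin (2 * X.s), 0 ≤ ((X.fn k (ρ i).1 : ℤ) : ℝ) ∧
        ((X.fn k (ρ i).1 : ℤ) : ℝ) ≤ X.Hc * X.E * X.P := fun i => by
      have h1 := hX.hH k hk _ (hρn i i.2).2
      have h2 : 0 ≤ X.fn k (ρ i).1 := le_max_left _ _
      exact ⟨by exact_mod_cast h2, by exact_mod_cast h1⟩
    have e1 : ∀ i : Fin (2 * X.s), ((⌊u' i⌋₊ : ℕ) - ((ρ i).2 : ℝ)) * ((X.fn k (ρ i).1 : ℤ) : ℝ)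
        = D * ((u' i - (ρ i).2) * (((X.fn k (ρ i).1 : ℤ) : ℝ) / D))
          - (u' i - (⌊u' i⌋₊ : ℕ)) * ((X.fn k (ρ i).1 : ℤ) : ℝ) := fun i => by
      field_simp
      ring
    -- Rounding down costs less than `1` in each of the `s` kept weights and nothing elsewhere.
    have e2 : |∑ i : Fin (2 * X.s), (u' i - (⌊u' i⌋₊ : ℕ)) * ((X.fn k (ρ i).1 : ℤ) : ℝ)|
        ≤ X.s * (X.Hc * X.E * X.P) := by
      have e3 : ∀ i : Fin (2 * X.s), |(u' i - (⌊u' i⌋₊ : ℕ)) * ((X.fn k (ρ i).1 : ℤ) : ℝ)|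
          ≤ if i ∈ K then (X.Hc * X.E * X.P : ℝ) else 0 := fun i => by
        split_ifs with hi
        · rw [abs_mul, abs_of_nonneg (sub_nonneg.2 (hfl i)), abs_of_nonneg (hH i).1]
          have h1 := Nat.lt_floor_add_one (u' i)
          calc (u' i - (⌊u' i⌋₊ : ℕ)) * ((X.fn k (ρ i).1 : ℤ) : ℝ)
              ≤ 1 * (X.Hc * X.E * X.P : ℝ) :=
                mul_le_mul (by linarith) (hH i).2 (hH i).1 zero_le_one
            _ = _ := one_mul _
        · simp [hu'K i hi]
      refine (abs_sum_le_sum_abs _ _).trans ((sum_le_sum fun i _ => e3 i).trans (le_of_eq ?_))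
      rw [← sum_filter, filter_mem_eq_inter, univ_inter, sum_const, hK2, nsmul_eq_mul]
    have e4 := herr ⟨k, hk⟩
    simp only [Fintype.card_fin] at e4
    set η := 8 * (X.d : ℝ) * (X.d + 2) * (Real.log (2 * X.N)
      + 3 * (X.d + 1) * Real.log (2 * X.s)) / Real.sqrt (X.s * r ^ 3) with hη'
    have hΛ : (0 : ℝ) ≤ X.Λ := by positivity
    have key : (X.Λ : ℝ) * |∑ i : Fin (2 * X.s),
        (((⌊u' i⌋₊ : ℕ) : ℝ) - ((ρ i).2 : ℝ)) * ((X.fn k (ρ i).1 : ℤ) : ℝ)|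
        ≤ v + X.Λ * X.s * X.Hc * X.E * X.P := by
      rw [sum_congr rfl fun i _ => e1 i, sum_sub_distrib, ← mul_sum]
      have e5 := abs_sub (D * ∑ i, (u' i - (ρ i).2) * (((X.fn k (ρ i).1 : ℤ) : ℝ) / D))
        (∑ i : Fin (2 * X.s), (u' i - (⌊u' i⌋₊ : ℕ)) * ((X.fn k (ρ i).1 : ℤ) : ℝ))
      rw [abs_mul, abs_of_pos hD0] at e5
      have hW0 : 0 ≤ (∑ i : Fin (2 * X.s), ((ρ i).2 : ℝ)) * X.P :=
        mul_nonneg (sum_nonneg fun i _ => by exact_mod_cast (hρn i i.2).1) (by positivity)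
      -- Of the scale `D`, the factor `P` is absorbed by the tolerance, as `W * P ≤ v`, and the
      -- remaining factors by `hη`.
      calc _ ≤ X.Λ * (D * ((∑ i : Fin (2 * X.s), ((ρ i).2 : ℝ)) * η)
            + X.s * (X.Hc * X.E * X.P)) := by
            refine mul_le_mul_of_nonneg_left (e5.trans (add_le_add ?_ e2)) hΛ
            exact mul_le_mul_of_nonneg_left e4 hD0.le
        _ = (X.Λ * (X.Bc * X.E * Rc) * η) * ((∑ i : Fin (2 * X.s), ((ρ i).2 : ℝ)) * X.P)
            + X.Λ * X.s * X.Hc * X.E * X.P := by rw [hD]; ring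
        _ ≤ 1 * ((∑ i : Fin (2 * X.s), ((ρ i).2 : ℝ)) * X.P)
            + X.Λ * X.s * X.Hc * X.E * X.P := by gcongr
        _ ≤ _ := by rw [one_mul]; gcongr
    have e6 : ∑ j ∈ range (2 * X.s), (wt (g j) - (ρ j).2) * X.fn k (ρ j).1
        = ∑ i : Fin (2 * X.s), ((⌊u' i⌋₊ : ℤ) - (ρ i).2) * X.fn k (ρ i).1 := by
      rw [Finset.sum_range]
      exact sum_congr rfl fun i _ => by rw [hwt]
    rw [e6]
    exact_mod_cast key
  · change ∑ j ∈ range (2 * X.s), (if 0 < ((g j : ℕ) : ℤ) then 1 else 0) = (X.s : ℤ)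
    rw [Finset.sum_range]
    have : ∀ i : Fin (2 * X.s), (if 0 < ((g i : ℕ) : ℤ) then (1 : ℤ) else 0)
        = if i ∈ K then 1 else 0 := fun i => by
      rw [hgi]
      split_ifs with h1 h2 h2 <;> simp_all
    rw [sum_congr rfl fun i _ => this i, sum_boole, filter_mem_eq_inter, univ_inter, hK2]
  · change ∑ j ∈ range (2 * X.s), (wt (g j) - (ρ j).2) ≤ 0
    rw [Finset.sum_range, sum_sub_distrib, sub_nonpos]
    simp only [hwt]
    have : ∑ i, ((⌊u' i⌋₊ : ℕ) : ℝ) ≤ ∑ i : Fin (2 * X.s), ((ρ i).2 : ℝ) := by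
      rw [← hus]; exact sum_le_sum fun i _ => hfl i
    exact_mod_cast this

end Env

/-! ### The net of test functions -/

lemma exists_coef_eq (d Bc E : ℕ) (t : ℕ → ℤ) (ht : ∀ i ≤ d, |t i| ≤ Bc * E) :
    ∃ k < (2 * Bc * E + 1) ^ (d + 1), ∀ i ≤ d, coef Bc E (k : ℕ) i = t i := by
  obtain ⟨k, hk, h⟩ := exists_digits (b := 2 * Bc * E + 1) (n := d + 1)
    (fun i => (t i + Bc * E).toNat) fun i hi => by
      have := abs_le.1 (ht i (by omega))
      zify
      rw [Int.toNat_of_nonneg (by linarith)]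
      linarith
  refine ⟨k, hk, fun i hi => ?_⟩
  have h1 := h i (by omega)
  rw [digit] at h1
  have := abs_le.1 (ht i hi)
  zify at h1
  rw [Int.toNat_of_nonneg (by linarith)] at h1
  rw [coef, h1]
  ring

/-- Every function of the problem is close to a test function. -/
lemma exists_testFn_close (d Bc E P Rc : ℕ) (hP : 1 ≤ P) (θ : ℕ → ℝ) (b : ℝ)
    (hθ : ∀ t < d, |θ t| ≤ Bc) (hb : |b| ≤ Bc) :
    ∃ k < (2 * Bc * E + 1) ^ (d + 1), ∀ z : ℕ → ℤ, (∀ t < d, |z t| ≤ Rc * P) →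
      |E * P * max 0 (b - ∑ t ∈ range d, θ t * (z t / P)) - testFn d Bc E P k z|
        ≤ (1 + d * Rc) * P := by
  have hfl : ∀ x : ℝ, |x| ≤ Bc → |⌊E * x⌋| ≤ Bc * E := fun x hx => by
    have h1 := abs_le.1 hx
    rw [abs_le]
    constructor
    · rw [Int.le_floor]
      push_cast
      nlinarith [(Nat.cast_nonneg E : (0 : ℝ) ≤ E)]
    · have h2 : ((⌊(E : ℝ) * x⌋ : ℤ) : ℝ) ≤ Bc * E := (Int.floor_le _).trans (by
        nlinarith [(Nat.cast_nonneg E : (0 : ℝ) ≤ E)])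
      exact_mod_cast h2
  -- All parameters are rounded down to multiples of `1/E`; the digit with index `d` encodes the
  -- offset `b`.
  obtain ⟨k, hk, hco⟩ := exists_coef_eq d Bc E (fun i => if i < d then ⌊E * θ i⌋ else ⌊E * b⌋)
    fun i hi => by
      split_ifs with h
      · exact hfl _ (hθ i h)
      · exact hfl _ hb
  refine ⟨k, hk, fun z hz => ?_⟩
  have hP' : (0 : ℝ) < P := by exact_mod_cast hP
  have hcd := hco d le_rfl
  rw [if_neg (lt_irrefl d)] at hcd
  have hsum : ∑ t ∈ range d, coef Bc E (k : ℕ) t * z t = ∑ t ∈ range d, ⌊E * θ t⌋ * z t :=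
    sum_congr rfl fun t ht => by rw [hco t (mem_range.1 ht).le, if_pos (mem_range.1 ht)]
  rw [testFn, hcd, hsum]
  push_cast
  rw [mul_max_of_nonneg _ _ (by positivity), mul_zero]
  have hfr : ∀ x : ℝ, |x - ⌊x⌋| ≤ 1 := fun x => by
    rw [abs_le]
    have h1 := Int.floor_le x
    have h2 := Int.lt_floor_add_one x
    constructor <;> linarith
  have hz' : ∀ t < d, |(z t : ℝ)| ≤ Rc * P := fun t ht => by exact_mod_cast hz t ht
  calc _ ≤ |E * P * (b - ∑ t ∈ range d, θ t * (z t / P))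
        - (⌊E * b⌋ * P - ∑ t ∈ range d, (⌊E * θ t⌋ : ℝ) * z t)| := by
        have := abs_max_sub_max_le_abs (E * P * (b - ∑ t ∈ range d, θ t * (z t / P)))
          (⌊E * b⌋ * P - ∑ t ∈ range d, (⌊E * θ t⌋ : ℝ) * z t) 0
        rwa [max_comm _ 0, max_comm _ 0] at this
    _ = |(E * b - ⌊E * b⌋) * P - ∑ t ∈ range d, (E * θ t - ⌊E * θ t⌋) * z t| := by
        congr 1
        simp only [sub_mul, sum_sub_distrib, mul_sub, mul_sum]
        have : ∀ t, (E : ℝ) * P * (θ t * (z t / P)) = E * θ t * z t := fun t => by field_simp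
        simp only [this]
        ring
    _ ≤ |(E * b - ⌊E * b⌋) * P| + |∑ t ∈ range d, (E * θ t - ⌊E * θ t⌋) * z t| := abs_sub _ _
    _ ≤ P + ∑ t ∈ range d, (Rc * P : ℝ) := by
        refine add_le_add ?_ ((abs_sum_le_sum_abs _ _).trans (sum_le_sum fun t ht => ?_))
        · rw [abs_mul, abs_of_pos hP']
          exact mul_le_of_le_one_left hP'.le (hfr _)
        · rw [abs_mul]
          exact (mul_le_of_le_one_left (abs_nonneg _) (hfr _)).trans (hz' t (mem_range.1 ht))
    _ = _ := by rw [sum_const, card_range, nsmul_eq_mul]; ring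

lemma testFn_le {d Bc E P Rc : ℕ} {k : ℤ} {z : ℕ → ℤ} (hz : ∀ t < d, |z t| ≤ Rc * P) :
    testFn d Bc E P k z ≤ (Bc * (1 + d * Rc) : ℕ) * E * P := by
  have h1 := (abs_le.1 (abs_coef_le Bc E k d)).2
  have h2 : |∑ t ∈ range d, coef Bc E k t * z t| ≤ ∑ t ∈ range d, (Bc * E * (Rc * P) : ℤ) := by
    refine (abs_sum_le_sum_abs _ _).trans (sum_le_sum fun t ht => ?_)
    rw [abs_mul]
    exact mul_le_mul (abs_coef_le _ _ _ _) (hz t (mem_range.1 ht)) (abs_nonneg _) (by positivity)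
  rw [sum_const, card_range, nsmul_eq_mul] at h2
  have h3 := (abs_le.1 h2).1
  have h4 : coef Bc E k d * P ≤ Bc * E * P := mul_le_mul_of_nonneg_right h1 (by positivity)
  refine max_le (by positivity) ?_
  push_cast
  linarith

/-! ### Parameters -/

/-- The factor between `rate` and the number of separating test functions. -/
def sepFactor (d Bc Rc : ℕ) : ℕ :=
  8 * d * (d + 2) * Bc * Rc * (1 + (d + 1) * (3 * Bc + 1)
    + 3 * (d + 1) * (4 * (d + 1) * (d + 2) ^ d + 6 * d)) + 8 * d * (d + 2) * Bc * Rc * (3 * (d + 1) * d)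

/-- The factor between `rate ^ d` and the size of the coresets. -/
def sizeFactor (d Bc Rc : ℕ) : ℕ := 2 * (d + 1) * (d + 2) ^ d * sepFactor d Bc Rc ^ d

lemma one_le_sepFactor {d Bc Rc : ℕ} (hd : 1 ≤ d) (hBc : 1 ≤ Bc) (hRc : 1 ≤ Rc) :
    1 ≤ sepFactor d Bc Rc := by
  unfold sepFactor
  have : 0 < d := hd
  have : 0 < Bc := hBc
  have : 0 < Rc := hRc
  exact Nat.succ_le_of_lt (by positivity)

lemma one_le_size {E : ℕ} (hE : 1 ≤ E) : 1 ≤ E.size := Nat.size_pos.2 hE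

lemma size_le_self (E : ℕ) : E.size ≤ E := Nat.size_le.2 E.lt_two_pow_self

lemma rate_le (d : ℕ) (E : ℕ) : rate d E ≤ E ^ 2 * E.size ^ 4 :=
  Nat.find_min' (exists_rate d E) (Nat.le_self_pow (by omega) _)

lemma rate_le_pow (d : ℕ) (E : ℕ) : rate d E ≤ E ^ 6 := by
  refine (rate_le d E).trans ?_
  calc E ^ 2 * E.size ^ 4 ≤ E ^ 2 * E ^ 4 := by have := size_le_self E; gcongr
    _ = E ^ 6 := by ring

lemma log_le_size {E : ℕ} (hE : 1 ≤ E) : Real.log E ≤ E.size := by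
  have h1 : (E : ℝ) ≤ 2 ^ E.size := by exact_mod_cast (Nat.lt_size_self E).le
  have h2 := Real.log_le_log (by exact_mod_cast hE) h1
  rw [Real.log_pow] at h2
  have h3 := Real.log_two_lt_d9
  nlinarith [(Nat.cast_nonneg E.size : (0 : ℝ) ≤ E.size)]

lemma log_natCast_le (a : ℕ) : Real.log a ≤ a := Real.log_le_self (by positivity)

/-- The size of the coresets is large enough for reductions. -/
lemma reduction_error_le {d Bc Rc E : ℕ} (hd : 1 ≤ d) (hBc : 1 ≤ Bc) (hRc : 1 ≤ Rc) (hE : 1 ≤ E) :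
    (E.size : ℝ) * (Bc * E * Rc) * (8 * d * (d + 2)
      * (Real.log (2 * ((2 * Bc * E + 1) ^ (d + 1) : ℕ))
        + 3 * (d + 1) * Real.log (2 * (sizeFactor d Bc Rc * rate d E ^ d : ℕ)))
      / Real.sqrt ((sizeFactor d Bc Rc * rate d E ^ d : ℕ)
        * ((sepFactor d Bc Rc * rate d E : ℕ) : ℝ) ^ 3)) ≤ 1 := by
  set Λ := E.size with hΛ
  set C := sepFactor d Bc Rc with hC
  set ρ := rate d E with hρ
  have hC1 : 1 ≤ C := one_le_sepFactor hd hBc hRc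
  have hΛ1 : (1 : ℝ) ≤ Λ := by exact_mod_cast one_le_size hE
  have hρ1 : 1 ≤ ρ := one_le_rate d hE
  have hlogE : Real.log E ≤ Λ := log_le_size hE
  have hE' : (1 : ℝ) ≤ E := by exact_mod_cast hE
  have hBc' : (1 : ℝ) ≤ Bc := by exact_mod_cast hBc
  have hC1' : (1 : ℝ) ≤ C := by exact_mod_cast hC1
  have hρ1' : (1 : ℝ) ≤ ρ := by exact_mod_cast hρ1
  set a := 4 * (d + 1) * (d + 2) ^ d with ha
  have hN : Real.log (2 * ((2 * Bc * E + 1) ^ (d + 1) : ℕ)) ≤ (1 + (d + 1) * (3 * Bc + 1)) * Λ := by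
    push_cast
    have h1 : (2 : ℝ) * Bc * E + 1 ≤ 3 * Bc * E := by nlinarith
    calc Real.log (2 * (2 * Bc * E + 1 : ℝ) ^ (d + 1))
        ≤ Real.log (2 * (((3 * Bc : ℕ) : ℝ) * E) ^ (d + 1)) := by
          push_cast
          exact Real.log_le_log (by positivity) (by gcongr)
      _ = Real.log 2 + (d + 1) * (Real.log (3 * Bc : ℕ) + Real.log E) := by
          rw [Real.log_mul (by norm_num) (by positivity), Real.log_pow,
            Real.log_mul (by positivity) (by positivity)]
          push_cast; rfl
      _ ≤ 1 + (d + 1) * (((3 * Bc : ℕ) : ℝ) + Λ) := by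
          have := Real.log_two_lt_d9
          have := log_natCast_le (3 * Bc)
          gcongr
          linarith
      _ ≤ _ := by
          push_cast
          have : (0 : ℝ) ≤ (1 + (d + 1) * (3 * Bc)) * (Λ - 1) := by
            have : (0 : ℝ) ≤ Λ - 1 := by linarith
            positivity
          nlinarith
  have hs : Real.log (2 * (sizeFactor d Bc Rc * ρ ^ d : ℕ)) ≤ (a + 6 * d + d * C) * Λ := by
    have e : (2 : ℝ) * (sizeFactor d Bc Rc * ρ ^ d : ℕ) = (a : ℕ) * (C ^ d * ρ ^ d) := by
      rw [sizeFactor, ha]; push_cast; ring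
    have hρE : (ρ : ℝ) ≤ E ^ 6 := by exact_mod_cast rate_le_pow d E
    have h1 : Real.log ρ ≤ 6 * Λ := by
      refine (Real.log_le_log (by linarith) hρE).trans ?_
      rw [Real.log_pow]; push_cast; linarith
    have h2 := log_natCast_le C
    have h3 := log_natCast_le a
    have ha0 : (0 : ℝ) < a := by rw [ha]; positivity
    rw [e, Real.log_mul (by positivity) (by positivity), Real.log_mul (by positivity) (by positivity),
      Real.log_pow, Real.log_pow]
    have h4 : (d : ℝ) * Real.log ρ ≤ d * (6 * Λ) := by gcongr
    have h5 : (d : ℝ) * Real.log C ≤ d * C := by gcongr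
    have h6 : (0 : ℝ) ≤ (a + d * C) * (Λ - 1) := by
      have : (0 : ℝ) ≤ Λ - 1 := by linarith
      positivity
    nlinarith
  -- The defining inequality of `rate` enters here: `s r³ ≥ (C ρ)^(d+3) ≥ C⁴ E² Λ⁴`, where `d ≥ 1`
  -- gives `C^(d+3) ≥ C⁴`.
  have hsq : (C : ℝ) ^ 2 * E * Λ ^ 2 ≤ Real.sqrt ((sizeFactor d Bc Rc * ρ ^ d : ℕ)
        * ((C * ρ : ℕ) : ℝ) ^ 3) := by
    apply Real.le_sqrt_of_sq_le
    have h1 : C ^ 4 * (E ^ 2 * Λ ^ 4) ≤ sizeFactor d Bc Rc * ρ ^ d * (C * ρ) ^ 3 := by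
      calc C ^ 4 * (E ^ 2 * Λ ^ 4) ≤ C ^ (d + 3) * ρ ^ (d + 3) :=
            Nat.mul_le_mul (Nat.pow_le_pow_right hC1 (by omega)) (le_rate_pow d E)
        _ = 1 * C ^ d * ρ ^ d * (C * ρ) ^ 3 := by ring
        _ ≤ (2 * (d + 1) * (d + 2) ^ d) * C ^ d * ρ ^ d * (C * ρ) ^ 3 := by
            gcongr
            exact Nat.succ_le_of_lt (by positivity)
        _ = _ := by rw [sizeFactor]
    calc ((C : ℝ) ^ 2 * E * Λ ^ 2) ^ 2 = ((C ^ 4 * (E ^ 2 * Λ ^ 4) : ℕ) : ℝ) := by push_cast; ring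
      _ ≤ ((sizeFactor d Bc Rc * ρ ^ d * (C * ρ) ^ 3 : ℕ) : ℝ) := by exact_mod_cast h1
      _ = _ := by push_cast; ring
  have hpos : (0 : ℝ) < (C : ℝ) ^ 2 * E * Λ ^ 2 := by positivity
  rw [← mul_div_assoc, div_le_one (hpos.trans_le hsq)]
  refine le_trans ?_ hsq
  -- The logarithm of the coreset size contains `d log C ≤ d C`, so `C` has to satisfy `x + y C ≤
  -- C²`; this explains the choice `C = x + y` in `sepFactor`.
  have hCC : 8 * d * (d + 2) * Bc * Rc * (1 + (d + 1) * (3 * Bc + 1)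
      + 3 * (d + 1) * (a + 6 * d + d * C)) ≤ C ^ 2 := by
    set x := 8 * d * (d + 2) * Bc * Rc * (1 + (d + 1) * (3 * Bc + 1) + 3 * (d + 1) * (a + 6 * d))
      with hx
    set y := 8 * d * (d + 2) * Bc * Rc * (3 * (d + 1) * d) with hy
    have hCxy : C = x + y := rfl
    have e1 : 8 * d * (d + 2) * Bc * Rc * (1 + (d + 1) * (3 * Bc + 1)
      + 3 * (d + 1) * (a + 6 * d + d * C)) = x + y * C := by rw [hx, hy]; ring
    rw [e1, sq]
    calc x + y * C ≤ x * C + y * C := Nat.add_le_add_right (Nat.le_mul_of_pos_right _ hC1) _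
      _ = C * C := by rw [hCxy]; ring
  have hCC' : 8 * (d : ℝ) * (d + 2) * Bc * Rc * (1 + (d + 1) * (3 * Bc + 1)
      + 3 * (d + 1) * (a + 6 * d + d * C)) ≤ C ^ 2 := by exact_mod_cast hCC
  calc (Λ : ℝ) * (Bc * E * Rc) * (8 * d * (d + 2)
      * (Real.log (2 * ((2 * Bc * E + 1) ^ (d + 1) : ℕ))
        + 3 * (d + 1) * Real.log (2 * (sizeFactor d Bc Rc * ρ ^ d : ℕ))))
      ≤ (Λ : ℝ) * (Bc * E * Rc) * (8 * d * (d + 2)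
        * ((1 + (d + 1) * (3 * Bc + 1)) * Λ + 3 * (d + 1) * ((a + 6 * d + d * C) * Λ))) := by gcongr
    _ = 8 * (d : ℝ) * (d + 2) * Bc * Rc * (1 + (d + 1) * (3 * Bc + 1)
      + 3 * (d + 1) * (a + 6 * d + d * C)) * (E * Λ ^ 2) := by ring
    _ ≤ C ^ 2 * (E * Λ ^ 2) := by gcongr
    _ = _ := by ring

/-- The parameters for a stream of `n` points with `w` binary digits and accuracy `1 / E`. -/
def env (d Bc Rc cM p w n E β S : ℕ) (Z : ℕ → ℕ → ℤ) : Env where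
  d := d
  Bc := Bc
  Hc := Bc * (1 + d * Rc)
  E := E
  P := 2 ^ w
  Λ := E.size
  s := sizeFactor d Bc Rc * rate d E ^ d
  len := 2 ^ logLen n (cM * E ^ p)
  n := n
  Vmax := 2 * (sizeFactor d Bc Rc * rate d E ^ d) * 2 ^ logLen n (cM * E ^ p) * 2 ^ w * 2 ^ w
    * (n / 2 ^ logLen n (cM * E ^ p) + 1)
  mmax := sizeFactor d Bc Rc * rate d E ^ d * ((n / 2 ^ logLen n (cM * E ^ p) + 1).size + 2)
  β := β
  S := S
  Z := Z

lemma two_pow_logLen_le {n M : ℕ} (hn : 1 ≤ n) (hM : 1 ≤ M) : 2 ^ logLen n M ≤ 2 * n := by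
  rcases h : logLen n M with _ | κ
  · simp; omega
  · have := lt_of_lt_logLen (n := n) (M := M) (κ := κ) (by omega)
    have := Nat.le_mul_of_pos_right (2 ^ κ) hM
    rw [pow_succ]
    omega

lemma div_two_pow_logLen_le (n : ℕ) {M : ℕ} (hM : 1 ≤ M) : n / 2 ^ logLen n M ≤ M :=
  Nat.div_le_of_le_mul (le_two_pow_logLen n hM)

lemma one_le_sizeFactor {d Bc Rc : ℕ} (hd : 1 ≤ d) (hBc : 1 ≤ Bc) (hRc : 1 ≤ Rc) :
    1 ≤ sizeFactor d Bc Rc := by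
  have : 0 < sepFactor d Bc Rc := one_le_sepFactor hd hBc hRc
  unfold sizeFactor
  exact Nat.succ_le_of_lt (by positivity)

/-- The purpose of sampling: the number of samples is polynomial in `E`, so there are `O(Λ)` levels
of merging regardless of `n`. -/
lemma size_samples_le {cM E p : ℕ} (n : ℕ) (hcM : 1 ≤ cM) (hE : 1 ≤ E) :
    (n / 2 ^ logLen n (cM * E ^ p) + 1).size ≤ (cM + 1 + p) * E.size := by
  have hM : 1 ≤ cM * E ^ p := Nat.mul_pos hcM (Nat.pow_pos hE)
  have h1 := div_two_pow_logLen_le n hM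
  have hΛ := one_le_size hE
  rw [Nat.size_le]
  calc n / 2 ^ logLen n (cM * E ^ p) + 1 ≤ 2 * (cM * E ^ p) := by omega
    _ < 2 * (2 ^ cM * (2 ^ E.size) ^ p) := by
        have h2 : E ^ p ≤ (2 ^ E.size) ^ p := Nat.pow_le_pow_left (Nat.lt_size_self E).le p
        have h3 : cM < 2 ^ cM := cM.lt_two_pow_self
        have h4 : 0 < E ^ p := Nat.pow_pos hE
        have : cM * E ^ p < 2 ^ cM * (2 ^ E.size) ^ p :=
          lt_of_lt_of_le (Nat.mul_lt_mul_of_pos_right h3 h4) (Nat.mul_le_mul_left _ h2)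
        omega
    _ = 2 ^ (cM + 1 + E.size * p) := by rw [← pow_mul]; ring
    _ ≤ 2 ^ ((cM + 1 + p) * E.size) := by
        refine Nat.pow_le_pow_right (by norm_num) ?_
        have : cM + 1 ≤ (cM + 1) * E.size := Nat.le_mul_of_pos_right _ hΛ
        rw [add_mul (cM + 1), mul_comm p]
        omega

/-- Exponent of a power of `2 ^ w` that bounds all numbers. -/
def wordExp (d Bc Rc : ℕ) : ℕ :=
  (2 * d + 3) * (4 * sizeFactor d Bc Rc ^ 2 * (Bc * (1 + d * Rc))) + (3 * Bc) ^ (d + 1) + Rc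
    + (12 * d + 8)

/-- Constant factors are absorbed into the exponent, at the price of `G` additional factors `Q`. -/
lemma mul_pow_le_pow {Q G h c : ℕ} (hQ : 2 ≤ Q) (hc : G + h ≤ c) : G * Q ^ h ≤ Q ^ c := by
  have h1 : G ≤ Q ^ G := G.lt_two_pow_self.le.trans (Nat.pow_le_pow_left hQ G)
  calc G * Q ^ h ≤ Q ^ G * Q ^ h := Nat.mul_le_mul_right _ h1
    _ = Q ^ (G + h) := (pow_add _ _ _).symm
    _ ≤ Q ^ c := Nat.pow_le_pow_right (by omega) hc

section Bounds

variable {d Bc Rc cM p w n E S : ℕ} {Z : ℕ → ℕ → ℤ}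

/-- Admissible parameters: positive constants, and numbers that fit into words. -/
structure Fits (d Bc Rc cM w n E : ℕ) : Prop where
  hd : 1 ≤ d
  hBc : 1 ≤ Bc
  hRc : 1 ≤ Rc
  hcM : 1 ≤ cM
  hw : 1 ≤ w
  hn : 1 ≤ n
  hnw : n ≤ 2 ^ w
  hE : 1 ≤ E
  hEw : E ≤ 2 ^ w

lemma Fits.two_le (h : Fits d Bc Rc cM w n E) : 2 ≤ 2 ^ w :=
  le_trans (by norm_num) (Nat.pow_le_pow_right (n := 2) (by norm_num) h.hw)

lemma Fits.hM (h : Fits d Bc Rc cM w n E) (p : ℕ) : 1 ≤ cM * E ^ p :=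
  Nat.mul_pos h.hcM (Nat.pow_pos h.hE)

/-- Bounds the largest accumulator of the acceptance test; `Fits.mmax_le` compares many of the other
quantities with it. The factor `2 * d + 3` pays for the number of cells that the records occupy. -/
lemma Fits.le_beta (h : Fits d Bc Rc cM w n E) (p : ℕ) :
    (2 * d + 3) * (2 * (sizeFactor d Bc Rc * rate d E ^ d)
      * (2 * (sizeFactor d Bc Rc * rate d E ^ d) * 2 ^ logLen n (cM * E ^ p) * 2 ^ w * 2 ^ w
        * (n / 2 ^ logLen n (cM * E ^ p) + 1) * (Bc * (1 + d * Rc) * E * 2 ^ w)))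
      ≤ (2 ^ w) ^ wordExp d Bc Rc := by
  have hQ := h.two_le
  have hl := two_pow_logLen_le h.hn (h.hM p)
  have hT : n / 2 ^ logLen n (cM * E ^ p) + 1 ≤ n + 1 := Nat.succ_le_succ (Nat.div_le_self _ _)
  have hn := h.hn
  have hnw := h.hnw
  have hr : rate d E ^ d ≤ (2 ^ w) ^ (6 * d) := by
    rw [pow_mul]
    exact Nat.pow_le_pow_left ((rate_le_pow d E).trans (Nat.pow_le_pow_left h.hEw 6)) d
  have hEw := h.hEw
  set Q := 2 ^ w
  set F := sizeFactor d Bc Rc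
  set l := 2 ^ logLen n (cM * E ^ p)
  have hQ2 : 2 * n ≤ Q ^ 2 := by rw [sq]; exact Nat.mul_le_mul hQ hnw
  calc (2 * d + 3) * (2 * (F * rate d E ^ d) * (2 * (F * rate d E ^ d) * l * Q * Q
        * (n / l + 1) * (Bc * (1 + d * Rc) * E * Q)))
      ≤ (2 * d + 3) * (2 * (F * Q ^ (6 * d)) * (2 * (F * Q ^ (6 * d)) * Q ^ 2 * Q * Q
        * Q ^ 2 * (Bc * (1 + d * Rc) * Q * Q))) := by
        have h1 : l ≤ Q ^ 2 := hl.trans hQ2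
        have h2 : n / l + 1 ≤ Q ^ 2 := hT.trans (le_trans (by omega) hQ2)
        gcongr
    _ = (2 * d + 3) * (4 * F ^ 2 * (Bc * (1 + d * Rc))) * Q ^ (12 * d + 8) := by ring
    _ ≤ Q ^ wordExp d Bc Rc := mul_pow_le_pow hQ (by
        have e : wordExp d Bc Rc = (2 * d + 3) * (4 * F ^ 2 * (Bc * (1 + d * Rc)))
          + (3 * Bc) ^ (d + 1) + Rc + (12 * d + 8) := rfl
        omega)

lemma Fits.net_le_beta (h : Fits d Bc Rc cM w n E) :
    (2 * Bc * E + 1) ^ (d + 1) ≤ (2 ^ w) ^ wordExp d Bc Rc := by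
  calc (2 * Bc * E + 1) ^ (d + 1) ≤ (3 * Bc * E) ^ (d + 1) := by
        refine Nat.pow_le_pow_left ?_ _
        have : 1 ≤ Bc * E := Nat.mul_pos h.hBc h.hE
        nlinarith
    _ ≤ (3 * Bc * 2 ^ w) ^ (d + 1) := by have := h.hEw; gcongr
    _ = (3 * Bc) ^ (d + 1) * (2 ^ w) ^ (d + 1) := by rw [mul_pow]
    _ ≤ _ := mul_pow_le_pow h.two_le (by unfold wordExp; omega)

lemma Fits.mul_le_beta (h : Fits d Bc Rc cM w n E) :
    Rc * 2 ^ w ≤ (2 ^ w) ^ wordExp d Bc Rc := by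
  have := mul_pow_le_pow (G := Rc) (h := 1) (c := wordExp d Bc Rc) h.two_le
    (by unfold wordExp; omega)
  rwa [pow_one] at this

lemma Fits.one_le_coreset (h : Fits d Bc Rc cM w n E) :
    1 ≤ sizeFactor d Bc Rc * rate d E ^ d :=
  Nat.mul_pos (one_le_sizeFactor h.hd h.hBc h.hRc) (Nat.pow_pos (one_le_rate d h.hE))

lemma Fits.mmax_le (h : Fits d Bc Rc cM w n E) (p β : ℕ) :
    let X := env d Bc Rc cM p w n E β S Z
    X.mmax * (d + 1) + 1 ≤ (2 ^ w) ^ wordExp d Bc Rc ∧ X.Vmax + 1 ≤ (2 ^ w) ^ wordExp d Bc Rc ∧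
    2 * X.s * (X.Vmax * (X.Hc * X.E * X.P)) ≤ (2 ^ w) ^ wordExp d Bc Rc ∧
    2 * X.s * X.Vmax ≤ (2 ^ w) ^ wordExp d Bc Rc ∧ 2 * X.s ≤ (2 ^ w) ^ wordExp d Bc Rc ∧
    X.len ≤ (2 ^ w) ^ wordExp d Bc Rc ∧ X.mmax ≤ (2 ^ w) ^ wordExp d Bc Rc := by
  intro X
  have hmain := h.le_beta p
  have hs : 0 < X.s := h.one_le_coreset
  have hl : 0 < X.len := by change 0 < 2 ^ _; positivity
  have hP : 0 < X.P := by change 0 < 2 ^ _; positivity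
  have hHc : 0 < X.Hc := Nat.mul_pos h.hBc (by omega)
  have hE : 0 < X.E := h.hE
  set y := X.Hc * X.E * X.P with hy
  have hy1 : 0 < y := by positivity
  have hV : X.Vmax = 2 * X.s * X.len * X.P * X.P * (X.n / X.len + 1) := rfl
  have hmm : X.mmax = X.s * ((X.n / X.len + 1).size + 2) := rfl
  change (2 * d + 3) * (2 * X.s * (X.Vmax * y)) ≤ _ at hmain
  set β' := (2 ^ w) ^ wordExp d Bc Rc
  have hT := size_le_self (X.n / X.len + 1)
  set T := X.n / X.len + 1 with hTdef
  have hT1 : 1 ≤ T := Nat.succ_le_succ (Nat.zero_le _)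
  have hVs : 2 * X.s * T ≤ X.Vmax := by
    rw [hV]
    have h1 : 1 ≤ X.len * X.P * X.P := Nat.succ_le_of_lt (by positivity)
    calc 2 * X.s * T = 2 * X.s * 1 * T := by ring
      _ ≤ 2 * X.s * (X.len * X.P * X.P) * T := by gcongr
      _ = _ := by ring
  have hVl : X.len ≤ X.Vmax := by
    rw [hV]
    have h1 : 1 ≤ 2 * X.s * X.P * X.P * T := Nat.succ_le_of_lt (by positivity)
    calc X.len = X.len * 1 := by ring
      _ ≤ X.len * (2 * X.s * X.P * X.P * T) := by gcongr
      _ = _ := by ring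
  have hm2 : X.mmax ≤ 2 * X.Vmax := by
    rw [hmm]
    calc X.s * (T.size + 2) ≤ X.s * (4 * T) := by gcongr; omega
      _ = 2 * (2 * X.s * T) := by ring
      _ ≤ _ := by gcongr
  have hs2 : 2 * X.s ≤ X.Vmax := (Nat.le_mul_of_pos_right _ hT1).trans hVs
  have hy2 : X.Vmax ≤ X.Vmax * y := Nat.le_mul_of_pos_right _ hy1
  have hx1 : 2 * X.s * X.Vmax ≤ 2 * X.s * (X.Vmax * y) := by gcongr
  have hx2 : 2 * X.Vmax ≤ 2 * X.s * X.Vmax := by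
    have := Nat.le_mul_of_pos_right 2 hs
    gcongr
  set x := 2 * X.s * (X.Vmax * y)
  have hx3 : x ≤ (2 * d + 3) * x := Nat.le_mul_of_pos_left _ (by omega)
  have hm3 : X.mmax * (d + 1) + 1 ≤ (2 * d + 3) * x := by
    calc X.mmax * (d + 1) + 1 ≤ x * (d + 1) + x := by
          have : X.mmax * (d + 1) ≤ x * (d + 1) := Nat.mul_le_mul_right _ (by omega)
          omega
      _ = (d + 2) * x := by ring
      _ ≤ _ := by gcongr <;> omega
  refine ⟨hm3.trans hmain, ?_, ?_, ?_, ?_, ?_, ?_⟩ <;> omega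

/-- The parameters fit into words and into the memory. -/
lemma Fits.bounds (h : Fits d Bc Rc cM w n E) (hZ : ∀ i < n, ∀ t < d, |Z i t| ≤ Rc * (2 ^ w : ℕ))
    (hS : adr d (env d Bc Rc cM p w n E 0 S Z).mmax (2 * (env d Bc Rc cM p w n E 0 S Z).s) ≤ S) :
    (env d Bc Rc cM p w n E ((2 ^ w) ^ wordExp d Bc Rc) S Z).Bounds := by
  obtain ⟨-, b2, b3, b4, b5, b6, b7⟩ := h.mmax_le (S := S) (Z := Z) p ((2 ^ w) ^ wordExp d Bc Rc)
  exact {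
    hs1 := h.one_le_coreset
    hP := Nat.one_le_two_pow
    hlen := Nat.one_le_two_pow
    hV := b2
    hs := b5
    hN := h.net_le_beta
    hp := fun i hi t ht => (hZ i hi t ht).trans (by exact_mod_cast h.mul_le_beta)
    hH := fun k _ i hi => testFn_le (hZ i hi)
    hacc := b3
    hsum := b4
    hm := b7
    hS := hS }

lemma Fits.le_beta_of_le (h : Fits d Bc Rc cM w n E) {x : ℕ} (hx : x ≤ 2 ^ w) :
    x ≤ (2 ^ w) ^ wordExp d Bc Rc :=
  hx.trans ((Nat.le_mul_of_pos_left _ h.hRc).trans h.mul_le_beta)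

lemma Fits.room (h : Fits d Bc Rc cM w n E) :
    (env d Bc Rc cM p w n E ((2 ^ w) ^ wordExp d Bc Rc) S Z).Room where
  hlen := ⟨_, rfl⟩
  hn := h.le_beta_of_le h.hnw
  hV := le_rfl
  hm := le_rfl

lemma Fits.hasReductions {β : ℕ} (h : Fits d Bc Rc cM w n E)
    (hb : (env d Bc Rc cM p w n E β S Z).Bounds)
    (hZ : ∀ i < n, ∀ t < d, |Z i t| ≤ Rc * (2 ^ w : ℕ)) :
    (env d Bc Rc cM p w n E β S Z).HasReductions := by
  refine Env.hasReductions hb h.hd (r := sepFactor d Bc Rc * rate d E) (Rc := Rc) ?_ ?_ h.hRc h.hBc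
    h.hE hZ (reduction_error_le h.hd h.hBc h.hRc h.hE)
  · exact Nat.mul_pos (one_le_sepFactor h.hd h.hBc h.hRc) (one_le_rate d h.hE)
  · change 2 * ((d + 1) * ((d + 1) * (sepFactor d Bc Rc * rate d E) + 1) ^ d)
      ≤ sizeFactor d Bc Rc * rate d E ^ d
    have h1 : 1 ≤ sepFactor d Bc Rc * rate d E :=
      Nat.mul_pos (one_le_sepFactor h.hd h.hBc h.hRc) (one_le_rate d h.hE)
    calc 2 * ((d + 1) * ((d + 1) * (sepFactor d Bc Rc * rate d E) + 1) ^ d)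
        ≤ 2 * ((d + 1) * ((d + 2) * (sepFactor d Bc Rc * rate d E)) ^ d) := by
          gcongr
          nlinarith
      _ = _ := by rw [sizeFactor, mul_pow, mul_pow]; ring

/-- Factor in the bound for the memory. -/
def spaceFactor (d cM p : ℕ) : ℕ := (d + 1) * (cM + p + 3) + 24 * (d + 1) + 3

lemma Fits.space_le {β : ℕ} (h : Fits d Bc Rc cM w n E) :
    adr d (env d Bc Rc cM p w n E β S Z).mmax (2 * (env d Bc Rc cM p w n E β S Z).s)
      ≤ (spaceFactor d cM p * (sizeFactor d Bc Rc * rate d E ^ d * E.size) : ℕ) := by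
  have h1 := size_samples_le (p := p) n h.hcM h.hE
  have hΛ := one_le_size h.hE
  have hs := h.one_le_coreset
  change adr d ((sizeFactor d Bc Rc * rate d E ^ d
    * ((n / 2 ^ logLen n (cM * E ^ p) + 1).size + 2) : ℕ) : ℤ)
    (2 * (sizeFactor d Bc Rc * rate d E ^ d : ℕ)) ≤ _
  set s := sizeFactor d Bc Rc * rate d E ^ d
  set τ := (n / 2 ^ logLen n (cM * E ^ p) + 1).size
  set Λ := E.size
  have h2 : s * (τ + 2) ≤ (cM + p + 3) * (s * Λ) := by
    calc s * (τ + 2) ≤ s * ((cM + 1 + p) * Λ + 2 * Λ) := by gcongr; omega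
      _ = _ := by ring
  have h3 : s ≤ s * Λ := Nat.le_mul_of_pos_right _ hΛ
  have h4 : 1 + 24 * (d + 1) + s * (τ + 2) * (d + 1) + 2 * s
      ≤ spaceFactor d cM p * (s * Λ) := by
    unfold spaceFactor
    have h5 : s * (τ + 2) * (d + 1) ≤ (cM + p + 3) * (s * Λ) * (d + 1) :=
      Nat.mul_le_mul_right _ h2
    have h6 : 24 * (d + 1) * 1 ≤ 24 * (d + 1) * (s * Λ) := Nat.mul_le_mul_left _ (hs.trans h3)
    have e : ((d + 1) * (cM + p + 3) + 24 * (d + 1) + 3) * (s * Λ)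
      = (cM + p + 3) * (s * Λ) * (d + 1) + 24 * (d + 1) * (s * Λ) + 3 * (s * Λ) := by ring
    omega
  unfold adr
  exact_mod_cast h4

end Bounds

/-! ### The memory in terms of `ε` -/

lemma size_le_log {ε : ℝ} (hε : 0 < ε) (hε2 : ε ≤ 1 / 2) :
    ((⌈1 / ε⌉₊).size : ℝ) ≤ 6 * Real.log (1 / ε) := by
  have h1 : (2 : ℝ) ≤ 1 / ε := by rw [le_div_iff₀ hε]; linarith
  have hl : Real.log 2 ≤ Real.log (1 / ε) := Real.log_le_log (by norm_num) h1
  have hE : (⌈1 / ε⌉₊ : ℝ) ≤ 2 * (1 / ε) := by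
    have := Nat.ceil_lt_add_one (show (0 : ℝ) ≤ 1 / ε by positivity)
    linarith
  set E := ⌈1 / ε⌉₊ with hEdef
  have hE1 : 1 ≤ E := Nat.one_le_ceil_iff.2 (by positivity)
  have hs := one_le_size hE1
  have h2 : 2 ^ (E.size - 1) ≤ E := Nat.lt_size.1 (by omega)
  have h3 : (2 : ℝ) ^ (E.size - 1) ≤ 2 * (1 / ε) := le_trans (by exact_mod_cast h2) hE
  have h4 := Real.log_le_log (by positivity) h3
  rw [Real.log_pow, Real.log_mul (by norm_num) (by positivity)] at h4
  push_cast [hs] at h4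
  have := Real.log_two_gt_d9
  by_contra hcon
  push Not at hcon
  nlinarith

/-- By minimality, `rate` is at most twice `(E² Λ⁴) ^ (1/(d+3))`. Its `d`-th power contributes `2 ^
d`, replacing `E` by `2/ε` costs at most `2²`, and the exponent `4d/(d+3)` of `Λ` is rounded up to
`4`. -/
lemma rate_pow_le {d : ℕ} {ε : ℝ} (hε : 0 < ε) (hε2 : ε ≤ 1 / 2) :
    (rate d ⌈1 / ε⌉₊ : ℝ) ^ d ≤ 2 ^ (d + 2) * ε ^ (-(2 * (d : ℝ) / ((d : ℝ) + 3)))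
      * (⌈1 / ε⌉₊.size : ℝ) ^ 4 := by
  have h1 : (2 : ℝ) ≤ 1 / ε := by rw [le_div_iff₀ hε]; linarith
  have hE : (⌈1 / ε⌉₊ : ℝ) ≤ 2 * (1 / ε) := by
    have := Nat.ceil_lt_add_one (show (0 : ℝ) ≤ 1 / ε by positivity)
    linarith
  set E := ⌈1 / ε⌉₊ with hEdef
  have hE1 : 1 ≤ E := Nat.one_le_ceil_iff.2 (by positivity)
  have hE1' : (1 : ℝ) ≤ E := by exact_mod_cast hE1
  have hΛ1 : (1 : ℝ) ≤ E.size := by exact_mod_cast one_le_size hE1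
  have hd3 : (0 : ℝ) < (d : ℝ) + 3 := by positivity
  set y : ℝ := (E : ℝ) ^ 2 * (E.size : ℝ) ^ 4 with hy
  have hy1 : 1 ≤ y := by
    have h2 : (1 : ℝ) ≤ (E : ℝ) ^ 2 := one_le_pow₀ hE1'
    have h3 : (1 : ℝ) ≤ (E.size : ℝ) ^ 4 := one_le_pow₀ hΛ1
    nlinarith
  have hr : (rate d E : ℝ) ≤ 2 * y ^ (1 / ((d : ℝ) + 3)) := by
    have hx1 : 1 ≤ y ^ (1 / ((d : ℝ) + 3)) := Real.one_le_rpow hy1 (by positivity)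
    rcases Nat.lt_or_ge (rate d E) 2 with h2 | h2
    · have : (rate d E : ℝ) ≤ 1 := by exact_mod_cast Nat.lt_succ_iff.1 h2
      linarith
    · have h3 := pow_lt_of_lt_rate (d := d) (E := E) (r := rate d E - 1) (by omega)
      have h4 : ((rate d E - 1 : ℕ) : ℝ) ^ (d + 3) ≤ y := by rw [hy]; exact_mod_cast h3.le
      have h5 := Real.rpow_le_rpow (by positivity) h4 (show 0 ≤ 1 / ((d : ℝ) + 3) by positivity)
      rw [← Real.rpow_natCast, ← Real.rpow_mul (by positivity)] at h5
      have h6 : ((d + 3 : ℕ) : ℝ) * (1 / ((d : ℝ) + 3)) = 1 := by push_cast; field_simp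
      rw [h6, Real.rpow_one] at h5
      have h7 : rate d E ≤ 2 * (rate d E - 1) := by omega
      have h8 : (rate d E : ℝ) ≤ 2 * ((rate d E - 1 : ℕ) : ℝ) := by exact_mod_cast h7
      linarith
  have he : (0 : ℝ) ≤ 2 * (d : ℝ) / ((d : ℝ) + 3) := by positivity
  have he2 : 2 * (d : ℝ) / ((d : ℝ) + 3) ≤ 2 := by rw [div_le_iff₀ hd3]; linarith
  calc (rate d E : ℝ) ^ d ≤ (2 * y ^ (1 / ((d : ℝ) + 3))) ^ d := by gcongr
    _ = 2 ^ d * ((E : ℝ) ^ (2 * (d : ℝ) / ((d : ℝ) + 3))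
        * (E.size : ℝ) ^ (4 * ((d : ℝ) / ((d : ℝ) + 3)))) := by
        rw [mul_pow, ← Real.rpow_natCast (y ^ _), ← Real.rpow_mul (by positivity), hy,
          Real.mul_rpow (by positivity) (by positivity), ← Real.rpow_natCast (E : ℝ) 2,
          ← Real.rpow_mul (by positivity), ← Real.rpow_natCast (E.size : ℝ) 4,
          ← Real.rpow_mul (by positivity)]
        congr 3 <;> push_cast <;> field_simp
    _ ≤ 2 ^ d * ((2 * (1 / ε)) ^ (2 * (d : ℝ) / ((d : ℝ) + 3)) * (E.size : ℝ) ^ (4 : ℝ)) := by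
        gcongr
        · have : (d : ℝ) / ((d : ℝ) + 3) ≤ 1 := by rw [div_le_one hd3]; linarith
          linarith
    _ ≤ 2 ^ d * (4 * ε ^ (-(2 * (d : ℝ) / ((d : ℝ) + 3))) * (E.size : ℝ) ^ 4) := by
        rw [Real.mul_rpow (by norm_num) (by positivity), one_div, Real.inv_rpow hε.le,
          Real.rpow_neg hε.le]
        have h9 : (2 : ℝ) ^ (2 * (d : ℝ) / ((d : ℝ) + 3)) ≤ 4 := by
          refine (Real.rpow_le_rpow_of_exponent_le (by norm_num) he2).trans ?_
          norm_num
        have h10 : (E.size : ℝ) ^ (4 : ℝ) = (E.size : ℝ) ^ 4 := by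
          exact_mod_cast Real.rpow_natCast (E.size : ℝ) 4
        rw [h10]
        gcongr
    _ = _ := by ring

/-- The memory is as small as required. -/
lemma mul_size_le_sizeBound {d F G : ℕ} {ε : ℝ} (hε : 0 < ε) (hε2 : ε ≤ 1 / 2) :
    ((G * (F * rate d ⌈1 / ε⌉₊ ^ d * ⌈1 / ε⌉₊.size) : ℕ) : ℝ)
      ≤ StreamSVM.sizeBound d (G * F * 2 ^ (d + 2) * 6 ^ 5) 5 ε := by
  have h1 := size_le_log hε hε2
  have h2 := rate_pow_le (d := d) hε hε2
  have h3 : 0 ≤ Real.log (1 / ε) := Real.log_nonneg (by rw [le_div_iff₀ hε]; linarith)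
  push_cast
  unfold StreamSVM.sizeBound
  set E := ⌈1 / ε⌉₊
  have h4 : 0 < ε ^ (-(2 * (d : ℝ) / ((d : ℝ) + 3))) := by positivity
  calc (G : ℝ) * (F * (rate d E : ℝ) ^ d * E.size)
      ≤ G * (F * (2 ^ (d + 2) * ε ^ (-(2 * (d : ℝ) / ((d : ℝ) + 3))) * (E.size : ℝ) ^ 4)
          * E.size) := by gcongr
    -- Four of the logarithmic factors come from `rate`, the fifth from the number of levels.
    _ = G * F * 2 ^ (d + 2) * ε ^ (-(2 * (d : ℝ) / ((d : ℝ) + 3))) * (E.size : ℝ) ^ 5 := by ring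
    _ ≤ G * F * 2 ^ (d + 2) * ε ^ (-(2 * (d : ℝ) / ((d : ℝ) + 3)))
        * (6 * Real.log (1 / ε)) ^ 5 := by gcongr
    _ = _ := by ring

/-! ### Accuracy of the sample and total error -/

namespace Env

variable {X : Env} {L : ℕ} {ω : Tape L} {S : List ℕ} {R : List (ℕ × ℤ)}

lemma Kept.nonneg (hK : X.Kept S R) : ∀ r ∈ R, 0 ≤ r.2 := by
  obtain ⟨q, S₁, R₁, S₂, hst, rfl, rfl, hlt⟩ := hK
  intro r hr
  rcases List.mem_append.1 hr with hr | hr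
  · exact hst.nonneg r hr
  · obtain ⟨i, -, rfl⟩ := List.mem_map.1 hr
    positivity

lemma Kept.sum_le (hK : X.Kept S R) : (R.map Prod.snd).sum ≤ S.length * (X.len * X.P) := by
  obtain ⟨q, S₁, R₁, S₂, hst, rfl, rfl, hlt⟩ := hK
  have h1 := hst.sum_le
  have h2 := hst.length
  have h3 : ((X.fresh S₂).map Prod.snd).sum = S₂.length * (X.len * X.P : ℤ) := by
    simp [fresh, Function.comp_def]
  rw [List.map_append, List.sum_append, h3, List.length_append, h2]
  push_cast at h1 ⊢
  linarith

lemma ssum_sampled (k n : ℕ) : X.ssum k (X.sampled ω n)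
    = X.P * ∑ i ∈ range n with i % X.len = (ω (i / X.len) : ℕ) % X.len, X.len * X.fn k i := by
  have h1 : (range n).filter (fun i => i % X.len = (ω (i / X.len) : ℕ) % X.len)
      = (X.sampled ω n).toFinset := by
    ext i
    simp [sampled]
  rw [h1, List.sum_toFinset _ nodup_sampled, ssum, ← List.sum_map_mul_left]
  congr 1
  refine List.map_congr_left fun i _ => ?_
  ring

/-- The sample represents the stream. -/
def Accurate (X : Env) {L : ℕ} (ω : Tape L) : Prop :=
  ∀ k < X.N, |X.ssum k (X.sampled ω X.n) - X.P * ∑ i ∈ range X.n, X.fn k i| < X.n * X.P ^ 2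

end Env

/-- The sampling rate that is needed. -/
def sampleFactor (d Bc Rc : ℕ) : ℕ := 6 * (Bc * (1 + d * Rc)) ^ 2 * (3 * Bc) ^ (d + 1)

variable {d Bc Rc p w n E β S L : ℕ} {Z : ℕ → ℕ → ℤ}

lemma Fits.samples_mul_len_le {cM : ℕ} (h : Fits d Bc Rc cM w n E) (p : ℕ) :
    (n / 2 ^ logLen n (cM * E ^ p) + 1) * 2 ^ logLen n (cM * E ^ p) ≤ 3 * n := by
  have h1 := two_pow_logLen_le h.hn (h.hM p)
  have h2 := Nat.div_mul_le_self n (2 ^ logLen n (cM * E ^ p))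
  rw [add_mul, one_mul]
  omega

open MeasureTheory in
/-- The sample represents the stream with high probability. -/
theorem Fits.tapeLaw_not_accurate_le {q : ℕ} {ε : ℝ} (hε : 1 / (E : ℝ) ≤ ε)
    (h : Fits d Bc Rc (sampleFactor d Bc Rc) w n E)
    (hZ : ∀ i < n, ∀ t < d, |Z i t| ≤ Rc * (2 ^ w : ℕ))
    (hL : logLen n (sampleFactor d Bc Rc * E ^ (d + 3 + q)) ≤ L) :
    tapeLaw L {ω | ¬ (env d Bc Rc (sampleFactor d Bc Rc) (d + 3 + q) w n E β S Z).Accurate ω}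
      ≤ ENNReal.ofReal (ε ^ q) := by
  set cM := sampleFactor d Bc Rc with hcM
  set X := env d Bc Rc cM (d + 3 + q) w n E β S Z with hX
  set κ := logLen n (cM * E ^ (d + 3 + q)) with hκ
  have hlen : X.len = 2 ^ κ := rfl
  have hn : X.n = n := rfl
  have hXE : X.E = E := rfl
  have hn0 : (0 : ℝ) < n := by exact_mod_cast h.hn
  have hE0 : (0 : ℝ) < E := by exact_mod_cast h.hE
  have hP0 : (0 : ℝ) < X.P := by change (0 : ℝ) < ((2 ^ w : ℕ) : ℝ); positivity
  have hP1 : 0 < X.P := by exact_mod_cast hP0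
  have hN0 : (0 : ℝ) ≤ X.N := by positivity
  have hiff : ∀ (ω : Tape L) (k : ℕ),
      ¬ |X.ssum k (X.sampled ω X.n) - X.P * ∑ i ∈ range X.n, X.fn k i| < X.n * X.P ^ 2 ↔
      (n * X.P : ℝ) ≤ |∑ i ∈ range n with i % 2 ^ κ = (ω (i / 2 ^ κ) : ℕ) % 2 ^ κ,
        2 ^ κ * ((X.fn k i : ℤ) : ℝ) - ∑ i ∈ range n, ((X.fn k i : ℤ) : ℝ)| := by
    intro ω k
    rw [Env.ssum_sampled, ← mul_sub, abs_mul, not_lt, hlen, hn, abs_of_nonneg (by positivity)]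
    have e : (n : ℤ) * (X.P : ℤ) ^ 2 = X.P * (n * X.P) := by ring
    rw [e, mul_le_mul_iff_right₀ (by exact_mod_cast hP1), ← Int.cast_le (R := ℝ)]
    push_cast
    rfl
  -- For blocks of length one every point is sampled and there is no error. Otherwise minimality of
  -- `κ` bounds the block length by `2n / (cM E^(d+3+q))`.
  rcases Nat.eq_zero_or_pos κ with h0 | hpos
  · have : {ω : Tape L | ¬ X.Accurate ω} = ∅ := by
      ext ω
      simp only [Set.mem_ofPred_eq, Set.mem_empty_iff_false, iff_false, not_not]
      intro k hk
      by_contra hcon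
      rw [hiff, h0] at hcon
      simp [Nat.mod_one] at hcon
      have : (0 : ℝ) < n * X.P := by positivity
      linarith
    rw [this, measure_empty]
    exact zero_le
  have hlM : 2 ^ κ * (cM * E ^ (d + 3 + q)) ≤ 2 * n := by
    have := lt_of_lt_logLen (n := n) (M := cM * E ^ (d + 3 + q)) (κ := κ - 1) (by omega)
    have e : 2 ^ κ = 2 * 2 ^ (κ - 1) := by rw [← pow_succ']; congr 1; omega
    rw [e, mul_assoc]
    omega
  have hJ : (n / 2 ^ κ + 1) * 2 ^ κ ≤ 3 * n := h.samples_mul_len_le (d + 3 + q)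
  set H : ℝ := X.Hc * E * X.P with hH
  have hfn : ∀ k i, i < n → 0 ≤ ((X.fn k i : ℤ) : ℝ) ∧ ((X.fn k i : ℤ) : ℝ) ≤ H := fun k i hi => by
    have h1 : X.fn k i ≤ X.Hc * X.E * X.P := testFn_le (hZ i hi)
    have h2 : 0 ≤ X.fn k i := le_max_left _ _
    exact ⟨by exact_mod_cast h2, by rw [hH, ← hXE]; exact_mod_cast h1⟩
  have hsub : {ω : Tape L | ¬ X.Accurate ω} ⊆ ⋃ k ∈ range X.N, {ω : Tape L | (n * X.P : ℝ)
      ≤ |∑ i ∈ range n with i % 2 ^ κ = (ω (i / 2 ^ κ) : ℕ) % 2 ^ κ,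
        2 ^ κ * ((X.fn k i : ℤ) : ℝ) - ∑ i ∈ range n, ((X.fn k i : ℤ) : ℝ)|} := by
    intro ω hω
    simp only [Set.mem_ofPred_eq, Env.Accurate] at hω
    push Not at hω
    obtain ⟨k, hk, hk2⟩ := hω
    simp only [Set.mem_iUnion]
    exact ⟨k, mem_range.2 hk, (hiff ω k).1 (not_lt.2 hk2)⟩
  set v : ℝ := (n / 2 ^ κ + 1 : ℕ) * (2 ^ κ * H) ^ 2 / (n * X.P) ^ 2 with hv
  have hv0 : 0 ≤ v := by positivity
  -- The union bound consumes `E^(d+1)` and the squared ratio of range and tolerance consumes `E²`;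
  -- `E^q` is left. The constants cancel against `sampleFactor`.
  have hbound : X.N * v ≤ ε ^ q := by
    set T : ℕ := n / 2 ^ κ + 1 with hT
    have hJ' : (T : ℝ) * 2 ^ κ ≤ 3 * n := by exact_mod_cast hJ
    have hlM' : (2 : ℝ) ^ κ * (cM * E ^ (d + 3 + q)) ≤ 2 * n := by exact_mod_cast hlM
    have hNle : X.N ≤ (3 * Bc) ^ (d + 1) * E ^ (d + 1) := by
      rw [← mul_pow]
      refine Nat.pow_le_pow_left ?_ _
      change 2 * Bc * E + 1 ≤ _
      have : 1 ≤ Bc * E := Nat.mul_pos h.hBc h.hE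
      nlinarith
    have hNle' : (X.N : ℝ) ≤ (3 * Bc) ^ (d + 1) * E ^ (d + 1) := by exact_mod_cast hNle
    have hcM' : (cM : ℝ) = 6 * (X.Hc : ℝ) ^ 2 * (3 * Bc) ^ (d + 1) := by
      have : cM = 6 * X.Hc ^ 2 * (3 * Bc) ^ (d + 1) := rfl
      rw [this]; push_cast; ring
    have hcM0 : (0 : ℝ) < cM := by exact_mod_cast h.hcM
    have e1 : v = (T * 2 ^ κ) * 2 ^ κ * (X.Hc * E) ^ 2 / n ^ 2 := by
      rw [hv, hH]; field_simp
    have e2 : v ≤ 6 * (X.Hc * E) ^ 2 / (cM * E ^ (d + 3 + q)) := by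
      rw [e1, div_le_div_iff₀ (by positivity) (by positivity)]
      calc (T * 2 ^ κ) * 2 ^ κ * (X.Hc * E) ^ 2 * (cM * E ^ (d + 3 + q))
          = (T * 2 ^ κ) * (2 ^ κ * (cM * E ^ (d + 3 + q))) * (X.Hc * E : ℝ) ^ 2 := by ring
        _ ≤ (3 * n) * (2 * n) * (X.Hc * E : ℝ) ^ 2 := by gcongr
        _ = _ := by ring
    calc X.N * v ≤ ((3 * Bc) ^ (d + 1) * E ^ (d + 1))
          * (6 * (X.Hc * E) ^ 2 / (cM * E ^ (d + 3 + q))) := by gcongr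
      _ = (cM * E ^ (d + 3)) / (cM * E ^ (d + 3 + q)) := by
          rw [hcM']; ring
      _ = (1 / E) ^ q := by
          rw [pow_add (E : ℝ) (d + 3) q, one_div_pow]; field_simp
      _ ≤ ε ^ q := by gcongr
  calc tapeLaw L {ω | ¬ X.Accurate ω}
      ≤ ∑ k ∈ range X.N, tapeLaw L {ω : Tape L | (n * X.P : ℝ)
      ≤ |∑ i ∈ range n with i % 2 ^ κ = (ω (i / 2 ^ κ) : ℕ) % 2 ^ κ,
        2 ^ κ * ((X.fn k i : ℤ) : ℝ) - ∑ i ∈ range n, ((X.fn k i : ℤ) : ℝ)|} :=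
        (measure_mono hsub).trans (measure_biUnion_finset_le _ _)
    _ ≤ ∑ k ∈ range X.N, ENNReal.ofReal v := sum_le_sum fun k _ =>
        tapeLaw_deviation_le hL (hfn k) (by positivity) (by positivity)
    _ = ENNReal.ofReal (X.N * v) := by
        rw [sum_const, card_range, nsmul_eq_mul, ENNReal.ofReal_mul hN0, ENNReal.ofReal_natCast]
    _ ≤ _ := ENNReal.ofReal_le_ofReal hbound

/-- Constant in the error bound. -/
def errFactor (d Bc Rc cM p : ℕ) : ℕ :=
  4 * (1 + d * Rc) + 6 * (cM + 1 + p) + 1 + 2 * (Bc * (1 + d * Rc))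

lemma sum_map_eq_sum_fin {α β : Type*} [AddCommMonoid β] (f : α → β) (l : List α) :
    (l.map f).sum = ∑ j : Fin l.length, f l[j] := by
  rw [← List.sum_ofFn]
  congr 1
  exact List.ext_getElem (by simp) fun i h1 h2 => by simp

set_option maxHeartbeats 1000000 in
/-- The records represent the stream, if the sample does. -/
theorem Fits.error_le {cM : ℕ} {ω : Tape L} {ε : ℝ} (h : Fits d Bc Rc cM w n E)
    (hε : 1 / (E : ℝ) ≤ ε) (hwε : 1 / (2 : ℝ) ^ w ≤ ε)
    (hZ : ∀ i < n, ∀ t < d, |Z i t| ≤ Rc * (2 ^ w : ℕ))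
    (hacc : (env d Bc Rc cM p w n E β S Z).Accurate ω) {R : List (ℕ × ℤ)}
    (hK : (env d Bc Rc cM p w n E β S Z).Kept
      ((env d Bc Rc cM p w n E β S Z).sampled ω n) R)
    (θ : ℕ → ℝ) (b : ℝ) (hθ : ∀ t < d, |θ t| ≤ Bc) (hb : |b| ≤ Bc) :
    |1 / (n : ℝ) * ∑ j : Fin R.length, (R[j].2 : ℝ) / 2 ^ w
        * max 0 (b - ∑ t ∈ range d, θ t * (Z R[j].1 t / 2 ^ w))
      - 1 / (n : ℝ) * ∑ i ∈ range n, max 0 (b - ∑ t ∈ range d, θ t * (Z i t / 2 ^ w))|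
      ≤ errFactor d Bc Rc cM p * ε := by
  set X := env d Bc Rc cM p w n E β S Z with hX
  obtain ⟨k, hk, hclose⟩ := exists_testFn_close d Bc E (2 ^ w) Rc Nat.one_le_two_pow θ b hθ hb
  have hTlen : (X.n / X.len + 1) * X.len ≤ 3 * X.n := h.samples_mul_len_le p
  have hSlen := Env.length_sampled_le' (X := X) (ω := ω) n
  have hrec := hK.err h.one_le_coreset hSlen hk
  have hτ : (n / X.len + 1).size ≤ (cM + 1 + p) * X.Λ := size_samples_le n h.hcM h.hE
  have hΛ : 0 < X.Λ := one_le_size h.hE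
  have hsmall : n / X.len + 1 ≤ 2 * n := by
    have := Nat.div_le_self n X.len
    have := h.hn
    omega
  have hlt : ∀ j : Fin R.length, R[j].1 < n := fun j => by
    have h1 : R[j].1 ∈ R.map Prod.fst := List.mem_map.2 ⟨R[j], List.getElem_mem _, rfl⟩
    exact Env.lt_of_mem_sampled (hK.sub.subset h1)
  have hnn : ∀ j : Fin R.length, (0 : ℝ) ≤ (R[j].2 : ℝ) := fun j => by
    exact_mod_cast hK.nonneg _ (List.getElem_mem j.2)
  have hsumW := hK.sum_le
  rw [sum_map_eq_sum_fin] at hsumW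
  set T := n / X.len + 1 with hT
  set P : ℝ := 2 ^ w with hP
  have hXP : (X.P : ℝ) = P := by change ((2 ^ w : ℕ) : ℝ) = _; push_cast; rfl
  have hP0 : 0 < P := by positivity
  have hE0 : (0 : ℝ) < E := by exact_mod_cast h.hE
  have hn0 : (0 : ℝ) < n := by exact_mod_cast h.hn
  have hΛ0 : (0 : ℝ) < X.Λ := by exact_mod_cast hΛ
  set g : ℕ → ℝ := fun i => max 0 (b - ∑ t ∈ range d, θ t * (Z i t / P)) with hg
  set f : ℕ → ℝ := fun i => ((X.fn k i : ℤ) : ℝ) with hf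
  set c : ℝ := 1 + d * Rc with hc
  have hc0 : 0 ≤ c := by positivity
  have hgf : ∀ i < n, |E * P * g i - f i| ≤ c * P := fun i hi => by
    have := hclose (Z i) (hZ i hi)
    push_cast at this
    exact this
  have hT3 : (T : ℝ) * X.len ≤ 3 * n := by exact_mod_cast hTlen
  have hT2 : (T : ℝ) ≤ 2 * n := by exact_mod_cast hsmall
  have hτ' : (T.size : ℝ) ≤ (cM + 1 + p) * X.Λ := by exact_mod_cast hτ
  have hW : ∑ j : Fin R.length, (R[j].2 : ℝ) ≤ 3 * n * P := by
    have h1 : ∑ j : Fin R.length, (R[j].2 : ℝ) ≤ (X.sampled ω n).length * (X.len * X.P) := by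
      exact_mod_cast hsumW
    have h2 : ((X.sampled ω n).length : ℝ) ≤ T := by exact_mod_cast hSlen
    rw [hXP] at h1
    calc _ ≤ _ := h1
      _ ≤ T * (X.len * P) := by gcongr
      _ = (T * X.len) * P := by ring
      _ ≤ _ := by gcongr
  -- All sums are compared at the scale `n E P²`: weights carry a factor `P`, test functions a
  -- factor `E P`. The four errors stem from the net on the records (`d1`), the reductions (`d2`),
  -- the sampling (`d3`) and the net on the stream (`d4`).
  have d1 : |∑ j : Fin R.length, (R[j].2 : ℝ) * (E * P * g R[j].1)
      - ∑ j : Fin R.length, (R[j].2 : ℝ) * f R[j].1| ≤ 3 * c * (n * P ^ 2) := by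
    rw [← sum_sub_distrib]
    calc _ ≤ ∑ j : Fin R.length, (R[j].2 : ℝ) * (c * P) := by
          refine (abs_sum_le_sum_abs _ _).trans (sum_le_sum fun j _ => ?_)
          rw [← mul_sub, abs_mul, abs_of_nonneg (hnn j)]
          exact mul_le_mul_of_nonneg_left (hgf _ (hlt j)) (hnn j)
      _ = (∑ j : Fin R.length, (R[j].2 : ℝ)) * (c * P) := by rw [sum_mul]
      _ ≤ (3 * n * P) * (c * P) := by gcongr
      _ = _ := by ring
  have d2 : |∑ j : Fin R.length, (R[j].2 : ℝ) * f R[j].1 - X.ssum k (X.sampled ω n)|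
      ≤ 6 * (cM + 1 + p) * (n * P ^ 2) + 2 * X.Hc * (n * E * P) := by
    have h1 : (X.Λ : ℝ) * |((X.wsum k R : ℤ) : ℝ) - X.ssum k (X.sampled ω n)|
        ≤ T * (T.size * (2 * X.len * X.P * X.P) + X.Λ * X.Hc * E * X.P) := by
      exact_mod_cast hrec
    have h2 : ((X.wsum k R : ℤ) : ℝ) = ∑ j : Fin R.length, (R[j].2 : ℝ) * f R[j].1 := by
      rw [Env.wsum, sum_map_eq_sum_fin]; push_cast; rfl
    rw [h2, hXP] at h1
    refine le_of_mul_le_mul_left (h1.trans ?_) hΛ0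
    calc (T : ℝ) * (T.size * (2 * X.len * P * P) + X.Λ * X.Hc * E * P)
        ≤ T * (((cM + 1 + p) * X.Λ) * (2 * X.len * P * P) + X.Λ * X.Hc * E * P) := by gcongr
      _ = X.Λ * (2 * (cM + 1 + p) * P ^ 2 * (T * X.len) + T * (X.Hc * E * P)) := by ring
      _ ≤ X.Λ * (2 * (cM + 1 + p) * P ^ 2 * (3 * n) + (2 * n) * (X.Hc * E * P)) := by gcongr
      _ = _ := by ring
  have d3 : |(X.ssum k (X.sampled ω n) : ℝ) - P * ∑ i ∈ range n, f i| ≤ 1 * (n * P ^ 2) := by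
    have h1 : |(X.ssum k (X.sampled ω n) : ℝ) - X.P * ∑ i ∈ range n, f i| ≤ n * X.P ^ 2 := by
      have h0 := (Int.cast_le (R := ℝ)).2 (hacc k hk).le
      push_cast at h0
      exact h0
    rw [hXP] at h1
    linarith
  have d4 : |P * ∑ i ∈ range n, f i - P * ∑ i ∈ range n, E * P * g i| ≤ c * (n * P ^ 2) := by
    rw [← mul_sub, ← sum_sub_distrib, abs_mul, abs_of_pos hP0]
    calc _ ≤ P * ∑ i ∈ range n, c * P := by
          refine mul_le_mul_of_nonneg_left ((abs_sum_le_sum_abs _ _).trans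
            (sum_le_sum fun i hi => ?_)) hP0.le
          rw [abs_sub_comm]
          exact hgf i (mem_range.1 hi)
      _ = _ := by rw [sum_const, card_range, nsmul_eq_mul]; ring
  have d5 : |∑ j : Fin R.length, (R[j].2 : ℝ) * (E * P * g R[j].1)
      - P * ∑ i ∈ range n, E * P * g i|
      ≤ (4 * c + 6 * (cM + 1 + p) + 1) * (n * P ^ 2) + 2 * X.Hc * (n * E * P) := by
    rw [abs_le] at d1 d2 d3 d4 ⊢
    constructor <;> linarith
  have hD : 0 < n * E * P ^ 2 := by positivity
  have e1 : 1 / (n : ℝ) * ∑ j : Fin R.length, (R[j].2 : ℝ) / P * g R[j].1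
      - 1 / (n : ℝ) * ∑ i ∈ range n, g i
      = (∑ j : Fin R.length, (R[j].2 : ℝ) * (E * P * g R[j].1)
      - P * ∑ i ∈ range n, E * P * g i) / (n * E * P ^ 2) := by
    have e2 : ∑ j : Fin R.length, (R[j].2 : ℝ) * (E * P * g R[j].1)
        = E * P ^ 2 * ∑ j : Fin R.length, (R[j].2 : ℝ) / P * g R[j].1 := by
      rw [mul_sum]
      refine sum_congr rfl fun j _ => ?_
      field_simp
    rw [e2, ← mul_sum]
    field_simp
  change |1 / (n : ℝ) * ∑ j : Fin R.length, (R[j].2 : ℝ) / P * g R[j].1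
      - 1 / (n : ℝ) * ∑ i ∈ range n, g i| ≤ _
  rw [e1, abs_div, abs_of_pos hD, div_le_iff₀ hD]
  refine d5.trans ?_
  -- Terms `n P²` are worth `1/E`, and the rounding term `n E P` is worth `1/P`. The latter is why
  -- `1/ε ≤ 2 ^ w` is needed.
  have hεE : 1 ≤ ε * E := by rwa [div_le_iff₀ hE0] at hε
  have hεP : 1 ≤ ε * P := by rwa [div_le_iff₀ hP0] at hwε
  have hHc : X.Hc = Bc * (1 + d * Rc) := rfl
  have e3 : (errFactor d Bc Rc cM p : ℝ) = (4 * c + 6 * (cM + 1 + p) + 1) + 2 * X.Hc := by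
    rw [hHc, errFactor, hc]; push_cast; ring
  rw [e3]
  calc (4 * c + 6 * (cM + 1 + p) + 1) * (n * P ^ 2) + 2 * X.Hc * (n * E * P)
      = (4 * c + 6 * (cM + 1 + p) + 1) * (n * P ^ 2) * 1 + 2 * X.Hc * (n * E * P) * 1 := by ring
    _ ≤ (4 * c + 6 * (cM + 1 + p) + 1) * (n * P ^ 2) * (ε * E)
        + 2 * X.Hc * (n * E * P) * (ε * P) := by gcongr
    _ = _ := by ring

open StreamSVM

/-! ### Euclidean points and the integer stream -/

section Stream

variable {n d w : ℕ} {z : Fin n → Fin d → ℤ}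

/-- The coordinates of the points, continued by `0`. -/
def extend (z : Fin n → Fin d → ℤ) (i t : ℕ) : ℤ :=
  if h : i < n ∧ t < d then z ⟨i, h.1⟩ ⟨t, h.2⟩ else 0

lemma extend_apply (i : Fin n) (t : Fin d) : extend z i t = z i t := by
  simp [extend]

lemma stream_eq (z : Fin n → Fin d → ℤ) :
    stream z = (List.range n).flatMap fun i => (List.range d).map (extend z i) := by
  unfold stream
  rw [List.flatMap_def]
  congr 1
  refine List.ext_getElem (by simp) fun i h1 h2 => ?_
  simp only [List.length_ofFn] at h1
  simp only [List.getElem_ofFn, List.getElem_map, List.getElem_range]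
  refine List.ext_getElem (by simp) fun t h3 h4 => ?_
  simp only [List.length_ofFn] at h3
  simp only [List.getElem_ofFn, List.getElem_map, List.getElem_range]
  exact (extend_apply ⟨i, h1⟩ ⟨t, h3⟩).symm

lemma abs_extend_le {R : ℝ} {Rc : ℕ} (hR : R ≤ Rc) (hz : ∀ i, ‖point w (z i)‖ ≤ R) :
    ∀ i < n, ∀ t < d, |extend z i t| ≤ Rc * (2 ^ w : ℕ) := by
  intro i hi t ht
  have h1 := (PiLp.norm_apply_le (point w (z ⟨i, hi⟩)) ⟨t, ht⟩).trans ((hz ⟨i, hi⟩).trans hR)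
  have h2 : (point w (z ⟨i, hi⟩)) ⟨t, ht⟩ = (extend z i t : ℝ) / 2 ^ w := by
    have := extend_apply (z := z) ⟨i, hi⟩ ⟨t, ht⟩
    simp only at this
    rw [this]; rfl
  rw [h2, Real.norm_eq_abs, abs_div, abs_of_pos (by positivity : (0 : ℝ) < 2 ^ w),
    div_le_iff₀ (by positivity)] at h1
  have h3 : (|extend z i t| : ℝ) ≤ (Rc * (2 ^ w : ℕ) : ℕ) := by push_cast; exact h1
  exact_mod_cast h3

/-- Coordinates of a vector, continued by `0`. -/
noncomputable def coords (θ : EuclideanSpace ℝ (Fin d)) (t : ℕ) : ℝ :=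
  if h : t < d then θ ⟨t, h⟩ else 0

lemma hinge_eq (θ : EuclideanSpace ℝ (Fin d)) (b : ℝ) (i : Fin n) :
    hinge θ b (point w (z i))
      = max 0 (b - ∑ t ∈ range d, coords θ t * (extend z i t / 2 ^ w)) := by
  rw [hinge, PiLp.inner_apply, Finset.sum_range]
  congr 2
  refine sum_congr rfl fun t _ => ?_
  rw [extend_apply]
  simp [coords, point, fixedPoint, mul_comm]

lemma abs_coords_le {θ : EuclideanSpace ℝ (Fin d)} {b B : ℝ} (h : Real.sqrt (‖θ‖ ^ 2 + b ^ 2) ≤ B) :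
    (∀ t < d, |coords θ t| ≤ B) ∧ |b| ≤ B := by
  have h1 : ‖θ‖ ≤ B := (Real.le_sqrt_of_sq_le (by nlinarith [sq_nonneg b])).trans h
  refine ⟨fun t ht => ?_, (Real.abs_le_sqrt (by nlinarith [sq_nonneg ‖θ‖])).trans h⟩
  rw [coords, dif_pos ht, ← Real.norm_eq_abs]
  exact (PiLp.norm_apply_le θ ⟨t, ht⟩).trans h1

variable {Bc Rc cM p E β S L : ℕ} {ω : Tape L} {c : Config}

/-- The indices of the records form a sublist of the sample, which has no repetitions. -/
lemma Env.Output.exists_embedding {X : Env} (hX : X = env d Bc Rc cM p w n E β S (extend z))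
    (h : X.Output ω c) :
    ∃ R, X.Kept (X.sampled ω n) R ∧ R.length < X.mmax ∧ outSize c = R.length ∧
      ∃ σ : Fin R.length ↪ Fin n, (∀ j, (σ j : ℕ) = R[j].1) ∧
        ∀ j : Fin R.length, outPoint d c j = z (σ j) ∧ outWeight d w c j = (R[j].2 : ℝ) / 2 ^ w := by
  subst hX
  obtain ⟨R, hK, hlt, h0, hrec⟩ := h
  have hsub := hK.sub
  have hnd : (R.map Prod.fst).Nodup := hsub.nodup Env.nodup_sampled
  have hn : ∀ j : Fin R.length, R[j].1 < n := fun j =>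
    Env.lt_of_mem_sampled (hsub.subset (List.mem_map.2 ⟨R[j], List.getElem_mem _, rfl⟩))
  refine ⟨R, hK, hlt, by simp [outSize, h0], ⟨fun j => ⟨R[j].1, hn j⟩, fun j j' he => ?_⟩,
    fun _ => rfl, fun j => ?_⟩
  · have he' : R[j].1 = R[j'].1 := congrArg Fin.val he
    have := (List.Nodup.getElem_inj_iff hnd (i := j) (j := j') (hi := by simp)
      (hj := by simp)).1 (by simpa using he')
    exact Fin.ext this
  · obtain ⟨h1, h2⟩ := hrec j R[j] (List.getElem?_eq_getElem j.2)
    constructor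
    · funext t
      refine (h1 t t.2).trans ?_
      exact extend_apply ⟨R[j].1, hn j⟩ t
    · rw [outWeight, fixedPoint]
      congr 2

lemma estimate_sub_objective {R : List (ℕ × ℤ)} (hsize : outSize c = R.length)
    {σ : Fin R.length ↪ Fin n} (hσ : ∀ j, (σ j : ℕ) = R[j].1)
    (hout : ∀ j : Fin R.length, outPoint d c j = z (σ j) ∧ outWeight d w c j = (R[j].2 : ℝ) / 2 ^ w)
    (θ : EuclideanSpace ℝ (Fin d)) (b : ℝ) :
    estimate n w c θ b - objective (fun i => point w (z i)) θ b
      = 1 / (n : ℝ) * ∑ j : Fin R.length, (R[j].2 : ℝ) / 2 ^ w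
          * max 0 (b - ∑ t ∈ range d, coords θ t * (extend z R[j].1 t / 2 ^ w))
        - 1 / (n : ℝ) * ∑ i ∈ range n,
          max 0 (b - ∑ t ∈ range d, coords θ t * (extend z i t / 2 ^ w)) := by
  unfold estimate objective
  rw [hsize, Finset.sum_range, Finset.sum_range (n := n)]
  congr 2
  · refine sum_congr rfl fun j _ => ?_
    rw [(hout j).1, (hout j).2, hinge_eq, hσ]
  · exact sum_congr rfl fun i _ => hinge_eq θ b i

end Stream

end StreamRAM

/-! ### Proof of the main theorem -/

open StreamRAM StreamSVM in
theorem mainTheorem7 (d : ℕ) (hd : 1 ≤ d) (R B : ℝ) (hR : 0 < R) (hB : 0 < B) (q : ℕ) :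
    ∃ (P : Program) (K : ℕ) (A C : ℝ) (k : ℕ),
      ∀ (ε : ℝ), 0 < ε → ε ≤ 1 / 2 →
      ∀ (n w : ℕ), 1 ≤ n → (n : ℝ) ≤ 2 ^ w → 1 / ε ≤ 2 ^ w →
      ∀ (z : Fin n → Fin d → ℤ), (∀ i, ‖point w (z i)‖ ≤ R) →
        let L : ℕ := K * w
        let S : ℕ := ⌊sizeBound d C k ε⌋₊
        (∀ ω : Tape L, ∃ c, Exec L S ω P (start ε w z) c) ∧
        (∀ (ω : Tape L) (c : Config), Exec L S ω P (start ε w z) c →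
          (outSize c : ℝ) ≤ sizeBound d C k ε ∧
          ∃ σ : Fin (outSize c) ↪ Fin n, ∀ j : Fin (outSize c), outPoint d c j = z (σ j)) ∧
        tapeLaw L {ω : Tape L | ¬ ∃ c, Exec L S ω P (start ε w z) c ∧
            ∀ (θ : EuclideanSpace ℝ (Fin d)) (b : ℝ), Real.sqrt (‖θ‖ ^ 2 + b ^ 2) ≤ B →
              |estimate n w c θ b - objective (fun i => point w (z i)) θ b| ≤ A * ε}
          ≤ ENNReal.ofReal (ε ^ q) := by
  set Bc := ⌈B⌉₊ with hBc
  set Rc := ⌈R⌉₊ with hRc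
  have hBc1 : 1 ≤ Bc := Nat.one_le_ceil_iff.2 hB
  have hRc1 : 1 ≤ Rc := Nat.one_le_ceil_iff.2 hR
  set cM := sampleFactor d Bc Rc with hcM
  have hcM1 : 1 ≤ cM := by
    have : 0 < Bc := hBc1
    rw [hcM, sampleFactor]
    exact Nat.succ_le_of_lt (by positivity)
  set p := d + 3 + q with hp
  set F := sizeFactor d Bc Rc with hF
  set G := spaceFactor d cM p with hG
  set W := wordExp d Bc Rc with hW
  set prog := program d Bc (Bc * (1 + d * Rc)) F cM p with hprog
  obtain ⟨D, hD⟩ := prog.exists_mag_le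
  -- Stored numbers are at most `β = 2 ^ (W w)` and intermediate results at most `β ^ D`; the
  -- summand `2` leaves room for the sign.
  refine ⟨prog, W * (D + 1) + 2, errFactor d Bc Rc cM p, G * F * 2 ^ (d + 2) * 6 ^ 5, 5,
    fun ε hε hε2 n w hn hnw hεw z hz => ?_⟩
  intro L S
  set E := ⌈1 / ε⌉₊ with hE
  have h2 : (2 : ℝ) ≤ 1 / ε := by rw [le_div_iff₀ hε]; linarith
  have hw : 1 ≤ w := by
    by_contra hcon
    obtain rfl : w = 0 := by omega
    norm_num at hεw
    norm_num at h2
    linarith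
  have hfit : Fits d Bc Rc cM w n E := {
    hd := hd
    hBc := hBc1
    hRc := hRc1
    hcM := hcM1
    hw := hw
    hn := hn
    hnw := by exact_mod_cast hnw
    hE := Nat.one_le_ceil_iff.2 (by positivity)
    hEw := Nat.ceil_le.2 (by push_cast; exact hεw) }
  have hEε : 1 / (E : ℝ) ≤ ε := by
    rw [div_le_comm₀ (by exact_mod_cast hfit.hE) hε]
    exact Nat.le_ceil _
  have hwε : 1 / (2 : ℝ) ^ w ≤ ε := by
    rw [div_le_comm₀ (by positivity) hε]
    exact hεw
  have hZ := abs_extend_le (Nat.le_ceil R) hz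
  set β := (2 ^ w) ^ W with hβ
  set X := env d Bc Rc cM p w n E β S (extend z) with hX
  have hspace := mul_size_le_sizeBound (d := d) (F := F) (G := G) hε hε2
  have hS0 := le_trans (Nat.cast_nonneg _) hspace
  have hadr : adr d X.mmax (2 * X.s) ≤ S := by
    refine (hfit.space_le (S := S) (Z := extend z) (p := p) (β := β)).trans ?_
    exact Int.ofNat_le.2 (Nat.le_floor hspace)
  have hXb : X.Bounds := hfit.bounds hZ hadr
  obtain ⟨m1, -, -, -, -, m6, -⟩ := hfit.mmax_le (S := S) (Z := extend z) p β
  have hβ2 : 2 ≤ β := by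
    exact hfit.two_le.trans (hfit.le_beta_of_le le_rfl)
  have hβpow : ∀ e, β ^ e = 2 ^ (W * e * w) := fun e => by
    rw [hβ, ← pow_mul, ← pow_mul]; congr 1; ring
  have hL1 : W * (D + 1) * w < L - 1 := by
    have : L = W * (D + 1) * w + 2 * w := by ring
    omega
  have hlt : ∀ e ≤ D + 1, β ^ e < 2 ^ (L - 1) := fun e he => by
    rw [hβpow]
    refine Nat.pow_lt_pow_right (by norm_num) (lt_of_le_of_lt ?_ hL1)
    gcongr
  have hβL : β < 2 ^ (L - 1) := by
    have := hlt 1 (by omega)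
    rwa [pow_one] at this
  have hmag : prog.mag β < 2 ^ (L - 1) := (hD β hβ2).trans_lt (hlt D (by omega))
  -- The block length is at most `β`, so a single random word suffices to choose a position in a
  -- block.
  have hκ : logLen n (cM * E ^ p) ≤ L := by
    by_contra hcon
    have h1 : 2 ^ (L - 1) ≤ 2 ^ logLen n (cM * E ^ p) :=
      Nat.pow_le_pow_right (by norm_num) (by omega)
    exact absurd m6 (not_le.2 (hβL.trans_le h1))
  have hmem : ∀ a, |(start ε w z).mem a| ≤ β := fun a => by
    have hx : ∀ {x : ℕ}, x ≤ 2 ^ w → |(x : ℤ)| ≤ β := fun {x} h => by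
      rw [abs_of_nonneg (by positivity)]
      exact_mod_cast hfit.le_beta_of_le h
    simp only [start]
    split_ifs
    · exact hx hfit.hnw
    · exact hx hfit.hEw
    · exact hx w.lt_two_pow_self.le
    · simp
  have hrate : rate d E ≤ β := by
    have h1 : rate d E ≤ F * rate d E ^ d :=
      (Nat.le_self_pow (by omega) _).trans (Nat.le_mul_of_pos_left _
        (one_le_sizeFactor hd hBc1 hRc1))
    have h3 : 2 * (F * rate d E ^ d) ≤ β := hXb.hs
    exact le_trans (by omega) h3
  have hzero : ∀ a, 2 < a → (start ε w z).mem a = 0 := fun a ha => by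
    simp only [start]
    rw [if_neg (by omega), if_neg (by omega), if_neg (by omega)]
  have hrun : ∀ ω : Tape L, ∃ c, Exec L S ω prog (start ε w z) c ∧ X.Output ω c := by
    intro ω
    obtain ⟨c, hc, ho⟩ := Env.wp_program (ω := ω) (c := start ε w z) (X := X) hXb hfit.room
      (hfit.hasReductions hXb hZ) hfit.hE hcM1 rfl rfl rfl rfl hrate (hfit.le_beta_of_le le_rfl)
      (hfit.le_beta_of_le hfit.hEw) m6 m1 hmem rfl rfl rfl hzero (stream_eq z) rfl
    exact ⟨c, (hc.exec (by omega) hβL hmag hmem).1, ho⟩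
  refine ⟨fun ω => ?_, fun ω c hc => ?_, ?_⟩
  · obtain ⟨c, hc, -⟩ := hrun ω
    exact ⟨c, hc⟩
  · obtain ⟨c', hc', ho⟩ := hrun ω
    obtain rfl := hc.unique hc'
    obtain ⟨Q, -, hlen, hsize, σ, -, hout⟩ := ho.exists_embedding hX
    constructor
    · refine le_trans ?_ (Nat.floor_le hS0)
      have h1 : (X.mmax : ℤ) ≤ S := by
        refine le_trans ?_ hadr
        unfold adr
        have : (X.mmax : ℤ) * 1 ≤ X.mmax * ((d : ℤ) + 1) := by gcongr; omega
        have : (0 : ℤ) ≤ d := by positivity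
        omega
      have h3 : outSize c ≤ S := by omega
      exact Nat.cast_le.2 h3
    · refine ⟨(finCongr hsize).toEmbedding.trans σ, fun j => ?_⟩
      exact (hout (finCongr hsize j)).1
  -- The program halts with well-formed output on every tape; the error bound can fail only on tapes
  -- whose sample is not accurate.
  · refine le_trans (MeasureTheory.measure_mono ?_)
      (hfit.tapeLaw_not_accurate_le (β := β) (S := S) hEε hZ hκ)
    intro ω hω hacc
    apply hω
    obtain ⟨c, hc, ho⟩ := hrun ω
    refine ⟨c, hc, fun θ b hθ => ?_⟩
    obtain ⟨Q, hK, -, hsize, σ, hσ, hout⟩ := ho.exists_embedding hX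
    obtain ⟨h1, h3⟩ := abs_coords_le hθ
    rw [estimate_sub_objective hsize hσ hout]
    exact hfit.error_le hEε hwε hZ hacc hK _ _ (fun t ht => (h1 t ht).trans (Nat.le_ceil B))
      (h3.trans (Nat.le_ceil B))
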